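/- Let $n\ge 0$ be an integer and let $p,q,t\in\mathbb{C}^*$ satisfy $|p|,|q|,|t|<1$ and $|p|<|q|^{25/4}|t|^{2n-2}$. For $u\in\mathbb{C}^*$ put $(u;p,q)_\infty=\prod_{\mu,\nu\ge 0}(1-p^\mu q^\nu u)$, and let $\Gamma(u;p,q)=(pqu^{-1};p,q)_\infty/(u;p,q)_\infty$ be the elliptic gamma function. For $a_1,\dots,a_6\in\mathbb{C}^*$ let $$\Psi(a_1,\dots,a_6;z)=\prod_{i=1}^{n}\frac{\prod_{m=1}^{6}\Gamma(a_mz_i^{\pm1};p,q)}{\Gamma(z_i^{\pm2};p,q)}\prod_{1\le j<k\le n}\frac{\Gamma(tz_j^{\pm1}z_k^{\pm1};p,q)}{\Gamma(z_j^{\pm1}z_k^{\pm1};p,q)},$$ where double signs denote the product over all choices of signs, and, for $|a_1|,\dots,|a_6|<1$, let $$I(a_1,\dots,a_6)=\frac{1}{(2\pi\sqrt{-1})^n}\int_{\mathbb{T}^n}\Psi(a_1,\dots,a_6;z)\,\frac{dz_1\cdots dz_n}{z_1\cdots z_n},$$ where $\mathbb{T}^n=\{|z_1|=\cdots=|z_n|=1\}$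 (so $I=1$ if $n=0$). Impose the balancing condition $a_1\cdots a_6\,t^{2n-2}=pq$, i.e. regard $a_6=pq/(a_1\cdots a_5t^{2n-2})$ as a function of $(a_1,\dots,a_5)\in(\mathbb{C}^*)^5$, and let $$U_0=\{(a_1,\dots,a_5)\in(\mathbb{C}^*)^5 : |a_1|,\dots,|a_5|<1,\ |a_1\cdots a_5|>|p||q|/|t|^{2n-2}\}.$$ Then the integral $I(a_1,\dots,a_6)$ converges absolutely for $(a_1,\dots,a_5)\in U_0$ and is a holomorphic function of $(a_1,\dots,a_5)\in U_0$, and this function continues to a meromorphic function on $(\mathbb{C}^*)^5$. Furthermore, there is a constant $c_n\in\mathbb{C}$, independent of $a_1,\dots,a_6$, such that the continued function satisfies $$I(a_1,\dots,a_6)=c_n\prod_{i=1}^{n}\prod_{1\le j<k\le 6}\Gamma(a_ja_kt^{i-1};p,q)$$ as meromorphic functions on $(\mathbb{C}^*)^5$, namely at every point at which no $p^\mu q^\nu t^{i-1}a_ja_k$ ($\mu,\nu\ge0$, $1\le i\le n$, $1\le j<k\le 6$) equals $1$; in particular at every point of $U_0$. -/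

import Mathlib

noncomputable section

namespace EllipticSelberg

/-- The double infinite product `(u; p, q)_∞ = ∏_{μ, ν ≥ 0} (1 - p^μ q^ν u)`. -/
def qPoch (p q u : ℂ) : ℂ :=
  ∏' k : ℕ × ℕ, (1 - p ^ k.1 * q ^ k.2 * u)

/-- The Ruijsenaars elliptic gamma function `Γ(u; p, q)`. At a pole the quotient takes the
value `0`, so that `(Γ(u; p, q))⁻¹` has its correct value there as well. -/
def eGamma (p q u : ℂ) : ℂ :=
  qPoch p q (p * q * u⁻¹) / qPoch p q u

/-- `Γ(x w^{±1}; p, q) = Γ(x w; p, q) Γ(x w⁻¹; p, q)`. -/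
def eGammaPM (p q x w : ℂ) : ℂ :=
  eGamma p q (x * w) * eGamma p q (x * w⁻¹)

/-- The integrand `Ψ(a_1, …, a_6; z)`. -/
def Psi (n : ℕ) (p q t : ℂ) (a : Fin 6 → ℂ) (z : Fin n → ℂ) : ℂ :=
  (∏ i, (∏ m, eGammaPM p q (a m) (z i)) / eGammaPM p q 1 (z i ^ 2)) *
    ∏ j, ∏ k ∈ Finset.Ioi j,
      (eGammaPM p q (t * z j) (z k) * eGammaPM p q (t * (z j)⁻¹) (z k)) /
        (eGammaPM p q (z j) (z k) * eGammaPM p q (z j)⁻¹ (z k))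

/-- The integrand with respect to `dz_1 ⋯ dz_n`, that is `Ψ(z) / (z_1 ⋯ z_n)`. -/
def integrand (n : ℕ) (p q t : ℂ) (a : Fin 6 → ℂ) (z : Fin n → ℂ) : ℂ :=
  Psi n p q t a z / ∏ i, z i

/-- The elliptic Selberg integral
`I(a) = (2π√-1)^{-n} ∫_{𝕋ⁿ} Ψ(a; z) dz_1 ⋯ dz_n / (z_1 ⋯ z_n)`, where `𝕋ⁿ` is the product
of the positively oriented unit circles. -/
def selbergI (n : ℕ) (p q t : ℂ) (a : Fin 6 → ℂ) : ℂ :=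
  (1 / (2 * (Real.pi : ℂ) * Complex.I) ^ n) *
    torusIntegral (integrand n p q t a) (0 : Fin n → ℂ) (1 : Fin n → ℝ)

/-- `J(a) = ∏_{i=1}^n ∏_{1 ≤ j < k ≤ 6} Γ(a_j a_k t^{i-1}; p, q)`. -/
def gammaJ (n : ℕ) (p q t : ℂ) (a : Fin 6 → ℂ) : ℂ :=
  ∏ i : Fin n, ∏ j, ∏ k ∈ Finset.Ioi j, eGamma p q (a j * a k * t ^ (i : ℕ))

/-- The polar locus of the factors of `J`: some `p^μ q^ν t^{i-1} a_j a_k` equals `1`. -/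
def OnPolarDivisor (n : ℕ) (p q t : ℂ) (a : Fin 6 → ℂ) : Prop :=
  ∃ (i : Fin n) (j k : Fin 6) (μ ν : ℕ), j < k ∧
    p ^ μ * q ^ ν * t ^ (i : ℕ) * (a j * a k) = 1

/-- The tuple `(a_1, …, a_6)` with `a_6 = p q / (a_1 ⋯ a_5 t^{2n-2})`. -/
def balanced (n : ℕ) (p q t : ℂ) (b : Fin 5 → ℂ) : Fin 6 → ℂ :=
  Fin.snoc b (p * q / ((∏ m, b m) * t ^ (2 * (n : ℤ) - 2)))

/-- The complex torus `(ℂ^*)^5`. -/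
def cTorus : Set (Fin 5 → ℂ) := {b | ∀ m, b m ≠ 0}

/-- The domain `U_0`: all `0 < |a_m| < 1` for `m ≤ 5`, and
`|a_1 ⋯ a_5| > |p| |q| / |t|^{2n-2}`, which says `|a_6| < 1`. -/
def domainU0 (n : ℕ) (p q t : ℂ) : Set (Fin 5 → ℂ) :=
  {b | b ∈ cTorus ∧ (∀ m, ‖b m‖ < 1) ∧
    ‖p‖ * ‖q‖ / ‖t‖ ^ (2 * (n : ℤ) - 2) < ‖∏ m, b m‖}

/-- `F` represents a meromorphic function of several complex variables on `Ω`: near every point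
of `Ω` it is a quotient `g / h` of holomorphic functions, where `h` vanishes identically on no
nonempty open set and the values of `F` on the zero locus of `h` are irrelevant. -/
def IsMeromorphicOn {E : Type*} [NormedAddCommGroup E] [NormedSpace ℂ E]
    (F : E → ℂ) (Ω : Set E) : Prop :=
  ∀ x ∈ Ω, ∃ V : Set E, IsOpen V ∧ x ∈ V ∧ V ⊆ Ω ∧ ∃ g h : E → ℂ,
    AnalyticOnNhd ℂ g V ∧ AnalyticOnNhd ℂ h V ∧ V ⊆ closure {y ∈ V | h y ≠ 0} ∧
      ∀ y ∈ V, h y ≠ 0 → F y = g y / h y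

end EllipticSelberg

end

/-! Write J for the product of elliptic gamma functions on the right-hand side. The heart of the
matter is that I/J is constant on the set of balanced parameters of norm less than one. Once I = cJ
is known there, cJ is itself the meromorphic continuation, and the holomorphy of I on U_0 is read
off from that of J.

Shifts of parameters. Let c be six parameters that miss balancing by one factor q, so that their
product times t^{2n-2} is p. Since Γ(qu) = θ(u;p)Γ(u), multiplying Ψ(c; z) by ∏_j θ(c_i z_j^{±1};p)
replaces c_i by q c_i. The integrals in which q has been given to different parameters are thus
values of a single function ℓ(y) = ∫ Ψ ∏_j θ(y z_j^{±1};p), taken at y = c_i (`thetaMoment_self`).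
Two facts control ℓ. Analytically, Ψ times a sum of shift factors integrates to zero, because the
substitution x ↦ 1/(qx) reverses the sign of the integrand and its contour can be moved back
(`angleIntegral_kernel_eq_zero`). Algebraically, partial fractions for theta functions convert that
sum, acting on ∏_j θ(y z_j^{±1}), into a second order difference operator in y
(`exists_kernel_identity`). So ℓ satisfies a difference equation (`thetaMoment_relation`).

The coefficients of this equation are never computed. Each function z ↦ ∏_j θ(y z_j^{±1}) is
determined by its values at n+1 nodes built from two geometric progressions with ratio t, hence ℓ is
a combination of these values (`exists_node_expansion`). At the nodes almost all shift factors
vanish, and the difference equation collapses to a two-term recursion for the coefficients of ℓ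
(`node_recursion`). Its product telescopes (`node_ratio`) and gives ℓ(c_i)/ℓ(c_j) in closed form; it
is the corresponding quotient of values of J (`torusMean_Psi_mul_gammaJ_update`).

Constancy. Vary a_i = x and a_j with the product a_i a_j fixed. Then I/J is holomorphic in x on the
annulus |a_i a_j| < |x| < 1 and invariant under x ↦ qx. If |a_i a_j| < |q|, the annulus is wide
enough for the Laurent coefficients of nonzero index to be killed, so I/J does not depend on x
(`selbergRatio_transfer`). The smallness of p forces some |a_k| < |q|, and through that entry any
two balanced tuples can be moved to a common one (`selbergRatio_eq`). -/

open Filter Topology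
open scoped Real

namespace EllipticSelberg

/-! ### Infinite products with linear factors. -/

section Products

variable {ι : Type*} {c : ι → ℂ}

theorem multipliable_one_sub_mul (hc : Summable fun i => ‖c i‖) (u : ℂ) :
    Multipliable fun i => 1 - c i * u := by
  have := multipliable_one_add_of_summable (f := fun i => -(c i * u))
    (by simpa using hc.mul_right ‖u‖)
  simpa [sub_eq_add_neg] using this

theorem tprod_one_sub_mul_ne_zero (hc : Summable fun i => ‖c i‖) {u : ℂ}
    (h : ∀ i, c i * u ≠ 1) : ∏' i, (1 - c i * u) ≠ 0 := by
  have := tprod_one_add_ne_zero_of_summable (f := fun i => -(c i * u))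
    (fun i hi => h i (by linear_combination -hi)) (by simpa using hc.mul_right ‖u‖)
  simpa [sub_eq_add_neg] using this

theorem differentiable_tprod_one_sub_mul (hc : Summable fun i => ‖c i‖) :
    Differentiable ℂ fun u => ∏' i, (1 - c i * u) := by
  intro u
  have hb : IsOpen (Metric.ball (0 : ℂ) (‖u‖ + 1)) := Metric.isOpen_ball
  have h := Summable.hasProdLocallyUniformlyOn_one_add (f := fun i u => -(c i * u)) hb
    (hc.mul_right (‖u‖ + 1)) (.of_forall fun i x hx => by
      have : ‖x‖ ≤ ‖u‖ + 1 := by simpa using (mem_ball_zero_iff.1 hx).le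
      simpa using mul_le_mul_of_nonneg_left this (norm_nonneg _)) (fun i => by fun_prop)
  have h2 := TendstoLocallyUniformlyOn.differentiableOn h
    (.of_forall fun _ => by simpa [Finset.prod_fn] using
      DifferentiableOn.finsetProd (fun _ _ => by fun_prop)) hb
  have h3 := h2.differentiableAt (hb.mem_nhds (by simp : u ∈ Metric.ball (0 : ℂ) (‖u‖ + 1)))
  simpa [sub_eq_add_neg] using h3

end Products

/-! ### One-base products and theta functions. -/

/-- The infinite product `(u; p)_∞ = ∏_{k ≥ 0} (1 - p^k u)`. -/
noncomputable def qPochS (p u : ℂ) : ℂ := ∏' k : ℕ, (1 - p ^ k * u)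

/-- The theta function `θ(u; p) = (u; p)_∞ (p / u; p)_∞`. -/
noncomputable def theta (p u : ℂ) : ℂ := qPochS p u * qPochS p (p / u)

section OneBase

variable {p : ℂ}

theorem summable_norm_pow (hp₁ : ‖p‖ < 1) : Summable fun k : ℕ => ‖p ^ k‖ := by
  simpa using summable_geometric_of_lt_one (norm_nonneg p) hp₁

theorem qPochS_eq (hp₁ : ‖p‖ < 1) (u : ℂ) : qPochS p u = (1 - u) * qPochS p (p * u) := by
  have := multipliable_one_sub_mul (summable_norm_pow hp₁) (p * u)
  have h2 := tprod_eq_zero_mul' (f := fun k : ℕ => 1 - p ^ k * u)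
    (by simpa [pow_succ, mul_assoc] using this)
  rw [qPochS, h2, qPochS]
  simp [pow_succ, mul_assoc]

theorem qPochS_ne_zero (hp₁ : ‖p‖ < 1) {u : ℂ} (h : ∀ k : ℕ, p ^ k * u ≠ 1) :
    qPochS p u ≠ 0 :=
  tprod_one_sub_mul_ne_zero (summable_norm_pow hp₁) h

theorem qPochS_ne_zero_of_norm_lt (hp₁ : ‖p‖ < 1) {u : ℂ} (h : ‖u‖ < 1) : qPochS p u ≠ 0 := by
  refine qPochS_ne_zero hp₁ fun k hk => ?_
  have : ‖p ^ k * u‖ < 1 := by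
    rw [norm_mul, norm_pow]
    exact (mul_le_of_le_one_left (norm_nonneg _)
      (pow_le_one₀ (norm_nonneg _) hp₁.le)).trans_lt h
  rw [hk] at this
  simp at this

theorem differentiable_qPochS (hp₁ : ‖p‖ < 1) : Differentiable ℂ (qPochS p) :=
  differentiable_tprod_one_sub_mul (summable_norm_pow hp₁)

theorem differentiableAt_theta (hp₁ : ‖p‖ < 1) {u : ℂ} (hu : u ≠ 0) :
    DifferentiableAt ℂ (theta p) u := by
  have h := differentiable_qPochS hp₁
  exact (h u).mul ((h _).comp u ((differentiableAt_const p).div differentiableAt_id hu))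

theorem theta_mul_self (hp₁ : ‖p‖ < 1) (hp₀ : p ≠ 0) {u : ℂ} (hu : u ≠ 0) :
    theta p (p * u) = -theta p u / u := by
  have h1 := qPochS_eq hp₁ u
  have h2 := qPochS_eq hp₁ u⁻¹
  have e1 : p / (p * u) = u⁻¹ := by field_simp
  rw [theta, theta, e1, h1, h2]
  simp only [div_eq_mul_inv]
  field_simp
  ring

theorem theta_inv (hp₁ : ‖p‖ < 1) {u : ℂ} (hu : u ≠ 0) :
    theta p u⁻¹ = -theta p u / u := by
  have h1 := qPochS_eq hp₁ u
  have h2 := qPochS_eq hp₁ u⁻¹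
  rw [theta, theta, h1, h2]
  simp only [div_eq_mul_inv, inv_inv]
  field_simp
  ring

theorem theta_one (hp₁ : ‖p‖ < 1) : theta p 1 = 0 := by
  rw [theta, qPochS_eq hp₁]; simp

theorem theta_div_self (hp₁ : ‖p‖ < 1) (hp₀ : p ≠ 0) {u : ℂ} (hu : u ≠ 0) :
    theta p (u / p) = -(u / p) * theta p u := by
  have h := theta_mul_self hp₁ hp₀ (u := u / p) (div_ne_zero hu hp₀)
  rw [mul_div_cancel₀ _ hp₀] at h
  rw [h]
  field_simp

theorem theta_ne_zero (hp₁ : ‖p‖ < 1) (hp₀ : p ≠ 0) {u : ℂ} (hu : u ≠ 0)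
    (h : ∀ k : ℤ, u ≠ p ^ k) : theta p u ≠ 0 := by
  refine mul_ne_zero (qPochS_ne_zero hp₁ fun k hk => h (-k) ?_)
    (qPochS_ne_zero hp₁ fun k hk => h (k + 1) ?_)
  · rw [zpow_neg, zpow_natCast]
    exact eq_inv_of_mul_eq_one_right hk
  · rw [zpow_add_one₀ hp₀, zpow_natCast]
    field_simp at hk
    linear_combination -hk

theorem theta_ne_zero_of_norm (hp₁ : ‖p‖ < 1) {u : ℂ} (h : ‖p‖ < ‖u‖) (h' : ‖u‖ < 1) :
    theta p u ≠ 0 := by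
  refine mul_ne_zero (qPochS_ne_zero_of_norm_lt hp₁ h') (qPochS_ne_zero_of_norm_lt hp₁ ?_)
  rw [norm_div, div_lt_one ((norm_nonneg p).trans_lt h)]
  exact h

theorem qPochS_sq {r : ℂ} (hr₁ : ‖r‖ < 1) (x : ℂ) :
    qPochS (r ^ 2) (x ^ 2) = qPochS r x * qPochS r (-x) := by
  have h1 := multipliable_one_sub_mul (summable_norm_pow hr₁) x
  have h2 := multipliable_one_sub_mul (summable_norm_pow hr₁) (-x)
  rw [qPochS, qPochS, qPochS, ← h1.tprod_mul h2]
  congr 1; ext k; ring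

theorem qPochS_even_odd {r : ℂ} (hr₁ : ‖r‖ < 1) (x : ℂ) :
    qPochS r x = qPochS (r ^ 2) x * qPochS (r ^ 2) (r * x) := by
  have hr2 : ‖r ^ 2‖ < 1 := by
    rw [norm_pow]; exact pow_lt_one₀ (norm_nonneg _) hr₁ two_ne_zero
  have h1 := multipliable_one_sub_mul (summable_norm_pow hr2) x
  have h2 := multipliable_one_sub_mul (summable_norm_pow hr2) (r * x)
  rw [qPochS, qPochS, qPochS, ← tprod_even_mul_odd]
  · congr 2
    · ext k; rw [pow_mul]
    · ext k; rw [pow_succ, pow_mul]; ring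
  · simpa only [pow_mul] using h1
  · simpa only [pow_succ, pow_mul, mul_assoc] using h2

/-- The splitting 1 - u² = (1 - u)(1 + u) of each factor, followed by separating even from odd
powers of r. It displays the zeros of x ↦ θ(x²) as four classes modulo the base; this is why the
base is written as a square. -/
theorem theta_sq {r : ℂ} (hr₁ : ‖r‖ < 1) (hr₀ : r ≠ 0) {x : ℂ} (hx : x ≠ 0) :
    theta (r ^ 2) (x ^ 2) = theta (r ^ 2) x * theta (r ^ 2) (-x) *
      (theta (r ^ 2) (r * x) * theta (r ^ 2) (-(r * x))) := by
  have e1 : r ^ 2 / x ^ 2 = (r / x) ^ 2 := by ring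
  have e2 : r ^ 2 / -x = r * -(r / x) := by field_simp
  have e3 : r ^ 2 / (r * x) = r / x := by field_simp
  have e4 : r ^ 2 / -(r * x) = -(r / x) := by field_simp
  have e5 : r ^ 2 / x = r * (r / x) := by field_simp
  have e6 : -(r * x) = r * -x := by ring
  simp only [theta, e1, e2, e3, e4, e5]
  rw [qPochS_sq hr₁, qPochS_sq hr₁, qPochS_even_odd hr₁ x, qPochS_even_odd hr₁ (-x),
    qPochS_even_odd hr₁ (r / x), qPochS_even_odd hr₁ (-(r / x)), e6]
  ring

end OneBase

/-! ### The elliptic gamma function: difference equation and reflection. -/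

section TwoBases

variable {p q : ℂ}

theorem summable_norm_pow_mul_pow (hp₁ : ‖p‖ < 1) (hq₁ : ‖q‖ < 1) :
    Summable fun k : ℕ × ℕ => ‖p ^ k.1 * q ^ k.2‖ := by
  simp only [norm_mul, norm_pow]
  exact (summable_geometric_of_lt_one (norm_nonneg p) hp₁).mul_of_nonneg
    (summable_geometric_of_lt_one (norm_nonneg q) hq₁) (fun _ => by positivity)
    (fun _ => by positivity)

theorem differentiable_qPoch (hp₁ : ‖p‖ < 1) (hq₁ : ‖q‖ < 1) : Differentiable ℂ (qPoch p q) :=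
  differentiable_tprod_one_sub_mul (summable_norm_pow_mul_pow hp₁ hq₁)

theorem qPoch_ne_zero (hp₁ : ‖p‖ < 1) (hq₁ : ‖q‖ < 1) {u : ℂ}
    (h : ∀ μ ν : ℕ, p ^ μ * q ^ ν * u ≠ 1) : qPoch p q u ≠ 0 :=
  tprod_one_sub_mul_ne_zero (summable_norm_pow_mul_pow hp₁ hq₁) fun i => h i.1 i.2

theorem qPoch_ne_zero_of_norm_lt (hp₁ : ‖p‖ < 1) (hq₁ : ‖q‖ < 1) {u : ℂ} (h : ‖u‖ < 1) :
    qPoch p q u ≠ 0 := by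
  refine qPoch_ne_zero hp₁ hq₁ fun μ ν hk => ?_
  have : ‖p ^ μ * q ^ ν * u‖ < 1 := by
    rw [norm_mul, norm_mul, norm_pow, norm_pow]
    exact (mul_le_of_le_one_left (norm_nonneg _) (mul_le_one₀
      (pow_le_one₀ (norm_nonneg _) hp₁.le) (by positivity)
      (pow_le_one₀ (norm_nonneg _) hq₁.le))).trans_lt h
  rw [hk] at this
  simp at this

theorem hasProd_qPochS (hp₁ : ‖p‖ < 1) (hq₁ : ‖q‖ < 1) (u : ℂ) :
    HasProd (fun μ : ℕ => qPochS q (p ^ μ * u)) (qPoch p q u) := by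
  refine HasProd.prod_fiberwise
    (multipliable_one_sub_mul (summable_norm_pow_mul_pow hp₁ hq₁) u).hasProd fun μ => ?_
  have := (multipliable_one_sub_mul (summable_norm_pow hq₁) (p ^ μ * u)).hasProd
  refine this.congr_fun ?_
  intro ν
  ring

theorem qPoch_eq (hp₁ : ‖p‖ < 1) (hq₁ : ‖q‖ < 1) (u : ℂ) :
    qPoch p q u = qPochS q u * qPoch p q (p * u) := by
  have h1 := hasProd_qPochS hp₁ hq₁ (p * u)
  rw [← (hasProd_qPochS hp₁ hq₁ u).tprod_eq, tprod_eq_zero_mul', ← h1.tprod_eq]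
  · simp [pow_succ, mul_assoc]
  · simpa [pow_succ, mul_assoc] using h1.multipliable

theorem qPoch_comm (p q u : ℂ) : qPoch p q u = qPoch q p u := by
  rw [qPoch, qPoch, ← (Equiv.prodComm ℕ ℕ).tprod_eq]
  congr 1; ext k; simp [mul_comm]

theorem qPoch_eq' (hp₁ : ‖p‖ < 1) (hq₁ : ‖q‖ < 1) (u : ℂ) :
    qPoch p q u = qPochS p u * qPoch p q (q * u) := by
  rw [qPoch_comm, qPoch_eq hq₁ hp₁, qPoch_comm q p]

/-- Passing from u to qu removes a one-base product from the denominator and adds one to the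
numerator, and together these form a theta function. The bound on u keeps the denominator of `eGamma
p q u` away from zero, where the quotient would take its default value. -/
theorem eGamma_mul (hp₁ : ‖p‖ < 1) (hq₁ : ‖q‖ < 1) (hq₀ : q ≠ 0) {u : ℂ} (hu : u ≠ 0)
    (h : ‖u‖ < 1) : eGamma p q (q * u) = theta p u * eGamma p q u := by
  have e1 : p * q * (q * u)⁻¹ = p / u := by field_simp
  have e2 : p * q * u⁻¹ = q * (p / u) := by ring
  have h1 := qPoch_eq' hp₁ hq₁ u
  have h3 := qPochS_ne_zero_of_norm_lt hp₁ h
  have h4 := qPoch_ne_zero_of_norm_lt hp₁ hq₁ h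
  rw [h1] at h4
  have h5 := right_ne_zero_of_mul h4
  rw [eGamma, eGamma, e1, e2, h1, qPoch_eq' hp₁ hq₁ (p / u), theta]
  field_simp

theorem eGamma_ne_zero (hp₁ : ‖p‖ < 1) (hq₁ : ‖q‖ < 1) {u : ℂ}
    (h : ‖p * q‖ < ‖u‖) (h' : ‖u‖ < 1) : eGamma p q u ≠ 0 := by
  refine div_ne_zero (qPoch_ne_zero_of_norm_lt hp₁ hq₁ ?_) (qPoch_ne_zero_of_norm_lt hp₁ hq₁ h')
  rw [norm_mul, norm_inv, ← div_eq_mul_inv, div_lt_one ((norm_nonneg _).trans_lt h)]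
  exact h

theorem differentiableAt_eGamma (hp₁ : ‖p‖ < 1) (hq₁ : ‖q‖ < 1) {u : ℂ} (hu : u ≠ 0)
    (h : ‖u‖ < 1) : DifferentiableAt ℂ (eGamma p q) u := by
  have hd := differentiable_qPoch hp₁ hq₁
  exact ((hd _).comp u ((differentiableAt_const _).mul (differentiableAt_inv hu))).div (hd u)
    (qPoch_ne_zero_of_norm_lt hp₁ hq₁ h)

/-- Only the factors of (u;p,q)(1/u;p,q) that are not matched by the numerators survive. No
denominator is required to be nonzero apart from those matched factors, so the formula is also valid
at u = 1, where both sides vanish. It makes the singular-looking weights of Ψ continuous on the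
torus. -/
theorem inv_eGamma_mul_eGamma_inv (hp₁ : ‖p‖ < 1) (hq₁ : ‖q‖ < 1) {u : ℂ} (hu : ‖u‖ = 1) :
    (eGamma p q u * eGamma p q u⁻¹)⁻¹ = theta p u * theta q u⁻¹ := by
  have hu0 : u ≠ 0 := by intro h; simp [h] at hu
  have hpq : ‖p * q‖ < 1 := by
    rw [norm_mul]; exact mul_lt_one_of_nonneg_of_lt_one_left (norm_nonneg _) hp₁ hq₁.le
  have h1 : qPoch p q (p * q * u) ≠ 0 :=
    qPoch_ne_zero_of_norm_lt hp₁ hq₁ (by rw [norm_mul, hu, mul_one]; exact hpq)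
  have h2 : qPoch p q (p * q * u⁻¹) ≠ 0 :=
    qPoch_ne_zero_of_norm_lt hp₁ hq₁ (by rw [norm_mul, norm_inv, hu, inv_one, mul_one]; exact hpq)
  have e1 : qPoch p q u = qPochS p u * (qPochS q (q * u) * qPoch p q (p * q * u)) := by
    rw [qPoch_eq' hp₁ hq₁ u, qPoch_eq hp₁ hq₁ (q * u), mul_assoc p q u]
  have e2 : qPoch p q u⁻¹ = qPochS q u⁻¹ * (qPochS p (p * u⁻¹) * qPoch p q (p * q * u⁻¹)) := by
    rw [qPoch_eq hp₁ hq₁ u⁻¹, qPoch_eq' hp₁ hq₁ (p * u⁻¹), ← mul_assoc q p u⁻¹, mul_comm q p]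
  rw [eGamma, eGamma, e1, e2, theta, theta, inv_inv, ← div_eq_mul_inv p, div_inv_eq_mul]
  rw [← div_eq_mul_inv] at h2
  rw [← div_eq_mul_inv (p * q), div_mul_div_comm, inv_div, div_eq_iff (mul_ne_zero h2 h1)]
  ring

end TwoBases


/-! ### Circle integrals, Laurent coefficients and quasi-periodic functions. -/

/-- The integral of `g` over the circle of radius `ρ` with respect to the angle. -/
noncomputable def angleIntegral (g : ℂ → ℂ) (ρ : ℝ) : ℂ := ∫ θ in 0..2 * π, g (circleMap 0 ρ θ)

theorem circleIntegral_inv_smul_eq {ρ : ℝ} (hρ : 0 < ρ) (g : ℂ → ℂ) :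
    (∮ x in C(0, ρ), (x - 0)⁻¹ • g x) = Complex.I * angleIntegral g ρ := by
  rw [circleIntegral, angleIntegral, ← intervalIntegral.integral_const_mul]
  refine intervalIntegral.integral_congr fun θ _ => ?_
  have h0 : circleMap 0 ρ θ ≠ 0 := circleMap_ne_center hρ.ne'
  simp only [deriv_circleMap, sub_zero, smul_eq_mul]
  field_simp

theorem angleIntegral_eq_of_differentiableOn {r R : ℝ} (hr : 0 < r) (hle : r ≤ R) {g : ℂ → ℂ}
    (hg : ∀ x : ℂ, r ≤ ‖x‖ → ‖x‖ ≤ R → DifferentiableAt ℂ g x) :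
    angleIntegral g R = angleIntegral g r := by
  have h := Complex.circleIntegral_sub_center_inv_smul_eq_of_differentiable_on_annulus_off_countable
    hr hle (f := g) (c := 0) Set.countable_empty
    (fun x hx => (hg x (by simpa using hx.2) (by simpa using hx.1)).continuousAt.continuousWithinAt)
    (fun x hx => hg x (le_of_lt (by simpa using hx.1.2)) (le_of_lt (by simpa using hx.1.1)))
  rw [circleIntegral_inv_smul_eq (hr.trans_le hle), circleIntegral_inv_smul_eq hr] at h
  exact mul_left_cancel₀ Complex.I_ne_zero h

theorem periodic_comp_circleMap (g : ℂ → ℂ) (ρ : ℝ) :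
    Function.Periodic (fun θ => g (circleMap 0 ρ θ)) (2 * π) :=
  fun θ => by simp only [periodic_circleMap 0 ρ θ]

/-- Multiplication by p scales the radius by ‖p‖ and rotates by arg p; the rotation is absorbed by
periodicity in the angle. -/
theorem angleIntegral_comp_mul (p : ℂ) (g : ℂ → ℂ) (ρ : ℝ) :
    angleIntegral (fun x => g (p * x)) ρ = angleIntegral g (‖p‖ * ρ) := by
  have h : ∀ θ : ℝ, p * circleMap 0 ρ θ = circleMap 0 (‖p‖ * ρ) (θ + p.arg) := by
    intro θ
    conv_lhs => rw [← Complex.norm_mul_exp_arg_mul_I p]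
    simp only [circleMap_zero]
    push_cast
    rw [add_mul, Complex.exp_add]
    ring
  simp only [angleIntegral, h]
  rw [intervalIntegral.integral_comp_add_right fun θ => g (circleMap 0 (‖p‖ * ρ) θ), zero_add,
    add_comm (2 * π), (periodic_comp_circleMap g _).intervalIntegral_add_eq p.arg 0, zero_add]

theorem angleIntegral_comp_inv (g : ℂ → ℂ) :
    angleIntegral (fun x => g x⁻¹) 1 = angleIntegral g 1 := by
  have h : ∀ θ : ℝ, (circleMap 0 1 θ)⁻¹ = circleMap 0 1 (-θ) := by
    intro θ
    simp [circleMap_zero, Complex.exp_neg]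
  simp only [angleIntegral, h]
  rw [intervalIntegral.integral_comp_neg fun θ => g (circleMap 0 1 θ)]
  have := (periodic_comp_circleMap g 1).intervalIntegral_add_eq (-(2 * π)) 0
  simpa using this

/-- The hypotheses say that every Fourier coefficient on the circle vanishes. The Fourier series is
then trivially summable, hence converges pointwise to the function, which is therefore zero. -/
theorem eq_zero_of_angleIntegral_zpow_eq_zero {ρ : ℝ} (hρ : 0 < ρ) {f : ℂ → ℂ}
    (hf : ContinuousOn f (Metric.sphere 0 ρ))
    (h : ∀ n : ℤ, angleIntegral (fun x => x ^ n * f x) ρ = 0)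
    {x : ℂ} (hx : ‖x‖ = ρ) : f x = 0 := by
  have : Fact (0 < 2 * π) := ⟨Real.two_pi_pos⟩
  let F : C(AddCircle (2 * π), ℂ) := ⟨fun θ => f (ρ * AddCircle.toCircle θ), by
    refine hf.comp_continuous ?_ fun θ => ?_
    · have := AddCircle.continuous_toCircle (T := 2 * π)
      fun_prop
    · rw [mem_sphere_zero_iff_norm, norm_mul, Circle.norm_coe, mul_one, Complex.norm_real,
        Real.norm_of_nonneg hρ.le]⟩
  have hmap : ∀ θ : ℝ, (ρ : ℂ) * AddCircle.toCircle (θ : AddCircle (2 * π)) = circleMap 0 ρ θ := by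
    intro θ
    rw [AddCircle.toCircle_apply_mk, circleMap_zero, div_self Real.two_pi_pos.ne', one_mul,
      Circle.coe_exp]
  have hcoef : ∀ n, fourierCoeff F n = 0 := by
    intro n
    rw [fourierCoeff_eq_intervalIntegral _ n 0, zero_add]
    have h1 := h (-n)
    rw [angleIntegral] at h1
    have h2 : ∀ θ : ℝ, (fourier (-n) (θ : AddCircle (2 * π)) : ℂ) • F θ =
        (ρ : ℂ) ^ n * ((circleMap 0 ρ θ) ^ (-n) * f (circleMap 0 ρ θ)) := by
      intro θ
      have hρ' : (ρ : ℂ) ≠ 0 := by exact_mod_cast hρ.ne'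
      simp only [F, ContinuousMap.coe_mk, fourier_apply, AddCircle.toCircle_zsmul, smul_eq_mul]
      rw [← hmap θ, mul_zpow, Circle.coe_zpow, ← mul_assoc, ← mul_assoc, ← zpow_add₀ hρ']
      simp
    simp only [h2]
    rw [intervalIntegral.integral_const_mul, h1]
    simp
  have hs := has_pointwise_sum_fourier_series_of_summable (f := F)
    (by simp only [funext hcoef]; exact summable_zero) ((x.arg : ℝ) : AddCircle (2 * π))
  simp only [hcoef, zero_smul] at hs
  have h0 := hs.unique hasSum_zero
  simp only [F, ContinuousMap.coe_mk, hmap] at h0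
  rwa [circleMap_zero, ← hx, Complex.norm_mul_exp_arg_mul_I] at h0

/-- A holomorphic function on `ℂ^*` with `f (p x) = f x / x ^ 2` is determined by two of its
Laurent coefficients. -/
theorem eq_zero_of_quasiPeriodic {p : ℂ} (hp₀ : p ≠ 0) (hp₁ : ‖p‖ < 1) {f : ℂ → ℂ}
    (hf : ∀ x ≠ 0, DifferentiableAt ℂ f x) (hper : ∀ x ≠ 0, f (p * x) = f x / x ^ 2)
    (h0 : angleIntegral f 1 = 0) (h1 : angleIntegral (fun x => x * f x) 1 = 0)
    {x : ℂ} (hx : x ≠ 0) : f x = 0 := by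
  have hd : ∀ n : ℤ, ∀ x ≠ 0, DifferentiableAt ℂ (fun x => x ^ n * f x) x := fun n x hx =>
    (differentiableAt_zpow.2 (Or.inl hx)).mul (hf x hx)
  have hρ : ∀ n : ℤ, ∀ r R : ℝ, 0 < r → r ≤ R → angleIntegral (fun x => x ^ n * f x) R =
      angleIntegral (fun x => x ^ n * f x) r := fun n r R hr hle =>
    angleIntegral_eq_of_differentiableOn hr hle fun x hx _ =>
      hd n x (norm_pos_iff.1 (hr.trans_le hx))
  -- Contracting the circle to radius ‖p‖ and applying the quasi-period links the coefficient of
  -- index n with that of index n - 2.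
  have hstep : ∀ n : ℤ, angleIntegral (fun x => x ^ n * f x) 1 =
      p ^ n * angleIntegral (fun x => x ^ (n - 2) * f x) 1 := by
    intro n
    have hpp := norm_pos_iff.2 hp₀
    rw [hρ n (‖p‖ * 1) 1 (by simpa using hpp) (by simpa using hp₁.le), ← angleIntegral_comp_mul,
      angleIntegral, angleIntegral, ← intervalIntegral.integral_const_mul]
    refine intervalIntegral.integral_congr fun θ _ => ?_
    have hc : circleMap 0 1 θ ≠ 0 := circleMap_ne_center one_ne_zero
    simp only [hper _ hc, mul_zpow, zpow_sub₀ hc]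
    norm_cast
    ring
  -- The indices k and 1 - k are treated together: the two known coefficients 0 and 1 start both the
  -- upward and the downward chain.
  have hall : ∀ k : ℕ, ∀ n : ℤ, (n = k ∨ n = 1 - k) →
      angleIntegral (fun x => x ^ n * f x) 1 = 0 := by
    intro k
    induction k using Nat.strong_induction_on with
    | _ k ih =>
      intro n hn
      have e0 : angleIntegral (fun x => x ^ (0 : ℤ) * f x) 1 = 0 := by simpa using h0
      have e1 : angleIntegral (fun x => x ^ (1 : ℤ) * f x) 1 = 0 := by simpa using h1
      rcases k with _ | _ | k
      · rcases hn with rfl | rfl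
        · simpa using e0
        · simpa using e1
      · rcases hn with rfl | rfl
        · simpa using e1
        · simpa using e0
      · rcases hn with rfl | rfl
        · rw [hstep, ih k (by omega) _ (Or.inl (by push_cast; ring)), mul_zero]
        · have := hstep (1 - ((k + 1 + 1 : ℕ) : ℤ) + 2)
          rw [ih k (by omega) _ (Or.inr (by push_cast; ring)), add_sub_cancel_right] at this
          exact (mul_eq_zero.1 this.symm).resolve_left (zpow_ne_zero _ hp₀)
  have hall' : ∀ n : ℤ, angleIntegral (fun x => x ^ n * f x) 1 = 0 := by
    intro n
    rcases le_total 0 n with h | h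
    · exact hall n.toNat n (Or.inl (by omega))
    · exact hall (1 - n).toNat n (Or.inr (by omega))
  have hxp := norm_pos_iff.2 hx
  refine eq_zero_of_angleIntegral_zpow_eq_zero hxp
    (fun y hy => (hf y (norm_pos_iff.1 (by
      rw [mem_sphere_zero_iff_norm.1 hy]; exact hxp))).continuousAt.continuousWithinAt)
    (fun n => ?_) rfl
  rcases le_total ‖x‖ 1 with h | h
  · rw [← hρ n _ _ hxp h, hall' n]
  · rw [hρ n _ _ one_pos h, hall' n]

/-! ### Paired theta factors and the three-term relation. -/

/-- `θ(y z^{±1}; p) = θ(y z; p) θ(y / z; p)`. -/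
noncomputable def thetaPM (p y z : ℂ) : ℂ := theta p (y * z) * theta p (y / z)

section ThetaPM

variable {p : ℂ}

theorem thetaPM_inv_right (p y z : ℂ) : thetaPM p y z⁻¹ = thetaPM p y z := by
  rw [thetaPM, thetaPM, div_inv_eq_mul, ← div_eq_mul_inv, mul_comm]

theorem thetaPM_comm (hp₁ : ‖p‖ < 1) {y z : ℂ} (hy : y ≠ 0) (hz : z ≠ 0) :
    thetaPM p y z = -(y / z) * thetaPM p z y := by
  have h := theta_inv hp₁ (div_ne_zero hz hy)
  rw [inv_div] at h
  rw [thetaPM, thetaPM, h, mul_comm z y]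
  field_simp

theorem thetaPM_self (hp₁ : ‖p‖ < 1) {y : ℂ} (hy : y ≠ 0) : thetaPM p y y = 0 := by
  rw [thetaPM, div_self hy, theta_one hp₁, mul_zero]

theorem thetaPM_mul_left (hp₁ : ‖p‖ < 1) (hp₀ : p ≠ 0) {y z : ℂ} (hy : y ≠ 0) (hz : z ≠ 0) :
    thetaPM p (p * y) z = thetaPM p y z / y ^ 2 := by
  rw [thetaPM, thetaPM, mul_assoc, mul_div_assoc, theta_mul_self hp₁ hp₀ (mul_ne_zero hy hz),
    theta_mul_self hp₁ hp₀ (div_ne_zero hy hz)]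
  field_simp

theorem thetaPM_inv_left (hp₁ : ‖p‖ < 1) {y z : ℂ} (hy : y ≠ 0) (hz : z ≠ 0) :
    thetaPM p y⁻¹ z = thetaPM p y z / y ^ 2 := by
  have h := theta_inv hp₁ (mul_ne_zero hy hz)
  have h' := theta_inv hp₁ (div_ne_zero hy hz)
  rw [thetaPM, thetaPM, show y⁻¹ * z = (y / z)⁻¹ by field_simp,
    show y⁻¹ / z = (y * z)⁻¹ by field_simp, h, h']
  field_simp

theorem differentiableAt_thetaPM (hp₁ : ‖p‖ < 1) {y z : ℂ} (hy : y ≠ 0) (hz : z ≠ 0) :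
    DifferentiableAt ℂ (fun y => thetaPM p y z) y := by
  refine DifferentiableAt.mul ?_ ?_
  · exact (differentiableAt_theta hp₁ (mul_ne_zero hy hz)).comp y
      (differentiableAt_id.mul_const z)
  · exact (differentiableAt_theta hp₁ (div_ne_zero hy hz)).comp y
      (differentiableAt_id.div_const z)

theorem exists_linear_relation (v : Fin 3 → ℂ × ℂ) :
    ∃ l : Fin 3 → ℂ, l ≠ 0 ∧ ∑ j, l j * (v j).1 = 0 ∧ ∑ j, l j * (v j).2 = 0 := by
  have h : ¬ LinearIndependent ℂ v := by
    intro h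
    have := h.fintype_card_le_finrank
    simp at this
  rw [Fintype.not_linearIndependent_iff] at h
  obtain ⟨l, hl, i, hi⟩ := h
  refine ⟨l, fun h => hi (by simp [h]), ?_, ?_⟩
  · simpa [Prod.fst_sum] using congrArg Prod.fst hl
  · simpa [Prod.snd_sum] using congrArg Prod.snd hl

/-- Weierstrass' three-term relation for theta functions. -/
theorem thetaPM_three_term (hp₁ : ‖p‖ < 1) (hp₀ : p ≠ 0) {x y u v : ℂ} (hx : x ≠ 0) (hy : y ≠ 0)
    (hu : u ≠ 0) (hv : v ≠ 0) :
    thetaPM p x y * thetaPM p u v - thetaPM p x v * thetaPM p u y =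
      u / y * thetaPM p y v * thetaPM p x u := by
  let Y : Fin 3 → ℂ := ![y, v, u]
  have hY : ∀ j, Y j ≠ 0 := by intro j; fin_cases j <;> assumption
  -- Three functions of the first variable have three moment vectors in ℂ², which are dependent. The
  -- corresponding combination of the functions has both moments zero, so it vanishes identically by
  -- `eq_zero_of_quasiPeriodic`.
  obtain ⟨l, hl, h0, h1⟩ := exists_linear_relation fun j =>
    (angleIntegral (fun x => thetaPM p x (Y j)) 1,
      angleIntegral (fun x => x * thetaPM p x (Y j)) 1)
  have hint : ∀ j, Continuous fun θ => thetaPM p (circleMap 0 1 θ) (Y j) := fun j =>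
    continuous_iff_continuousAt.2 fun θ =>
      ContinuousAt.comp (f := circleMap 0 1) (g := fun x => thetaPM p x (Y j))
        (differentiableAt_thetaPM hp₁ (circleMap_ne_center one_ne_zero) (hY j)).continuousAt
        (continuous_circleMap 0 1).continuousAt
  have hrel : ∀ x ≠ 0, ∑ j, l j * thetaPM p x (Y j) = 0 := by
    intro x hx
    refine eq_zero_of_quasiPeriodic (f := fun x => ∑ j, l j * thetaPM p x (Y j)) hp₀ hp₁
      (fun x hx => ?_) (fun x hx => ?_) ?_ ?_ hx
    · exact DifferentiableAt.fun_sum fun j _ =>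
        (differentiableAt_thetaPM hp₁ hx (hY j)).const_mul _
    · simp only [thetaPM_mul_left hp₁ hp₀ hx (hY _), Finset.sum_div, mul_div_assoc]
    · rw [← h0]
      simp only [angleIntegral, ← intervalIntegral.integral_const_mul]
      exact intervalIntegral.integral_finsetSum fun j _ =>
        ((hint j).const_mul _).intervalIntegrable _ _
    · rw [← h1]
      simp only [angleIntegral, ← intervalIntegral.integral_const_mul, Finset.mul_sum,
        mul_left_comm (circleMap 0 1 _)]
      exact intervalIntegral.integral_finsetSum fun j _ =>
        (((continuous_circleMap 0 1).mul (hint j)).const_mul _).intervalIntegrable _ _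
  simp only [Fin.sum_univ_three, Y, Matrix.cons_val_zero, Matrix.cons_val_one,
    Matrix.cons_val] at hrel
  have ry := hrel y hy
  have rv := hrel v hv
  have ru := hrel u hu
  have rx := hrel x hx
  rw [thetaPM_self hp₁ hy] at ry
  rw [thetaPM_self hp₁ hv] at rv
  rw [thetaPM_self hp₁ hu] at ru
  have c1 := thetaPM_comm hp₁ hv hy
  have c2 := thetaPM_comm hp₁ hy hu
  have c3 := thetaPM_comm hp₁ hv hu
  rw [c2] at ry
  rw [c1, c3] at rv
  -- Evaluating the dependence at y, v and u determines the ratios of the coefficients. Which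
  -- coefficient is nonzero is unknown, and each of the three cases allows it to be cancelled.
  have h3 : l 0 ≠ 0 ∨ l 1 ≠ 0 ∨ l 2 ≠ 0 := by
    by_contra! h
    exact hl (by ext j; fin_cases j <;> simp [h.1, h.2.1, h.2.2])
  generalize thetaPM p x y = A at *
  generalize thetaPM p x v = A1 at *
  generalize thetaPM p x u = A2 at *
  generalize thetaPM p y v = D at *
  generalize thetaPM p u v = D1 at *
  generalize thetaPM p u y = D2 at *
  rcases h3 with h | h | h
  · refine mul_left_cancel₀ h ?_
    linear_combination (norm := (field_simp; ring)) D1 * rx - A1 * ru + A2 * (u / v) * rv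
  · refine mul_left_cancel₀ h ?_
    linear_combination (norm := (field_simp; ring)) -D2 * rx + A * ru - A2 * (u / y) * ry
  · refine mul_left_cancel₀ h ?_
    linear_combination (norm := (field_simp; ring))
      -(u / y) * D * rx - A * (u / v) * rv + A1 * (u / y) * ry

end ThetaPM


/-! ### Partial fractions for theta functions. -/

section PartialFractions

variable {p : ℂ}

theorem theta_zpow (hp₁ : ‖p‖ < 1) (hp₀ : p ≠ 0) (k : ℤ) : theta p (p ^ k) = 0 := by
  induction k using Int.induction_on with
  | zero => simpa using theta_one hp₁
  | succ k ih =>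
    rw [zpow_add_one₀ hp₀, mul_comm, theta_mul_self hp₁ hp₀ (zpow_ne_zero _ hp₀), ih]; simp
  | pred k ih =>
    rw [zpow_sub_one₀ hp₀, ← div_eq_mul_inv, theta_div_self hp₁ hp₀ (zpow_ne_zero _ hp₀), ih]; simp

theorem theta_eq_zero_iff (hp₁ : ‖p‖ < 1) (hp₀ : p ≠ 0) {u : ℂ} (hu : u ≠ 0) :
    theta p u = 0 ↔ ∃ k : ℤ, u = p ^ k := by
  constructor
  · intro h
    by_contra! h'
    exact theta_ne_zero hp₁ hp₀ hu h' h
  · rintro ⟨k, rfl⟩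
    exact theta_zpow hp₁ hp₀ k

/-- The span of the functions `thetaPM p x` is two-dimensional in the second variable. -/
theorem thetaPM_eq_interpolation (hp₁ : ‖p‖ < 1) (hp₀ : p ≠ 0) {x w v₁ v₂ : ℂ} (hx : x ≠ 0)
    (hw : w ≠ 0) (h₁ : v₁ ≠ 0) (h₂ : v₂ ≠ 0) (h : thetaPM p v₁ v₂ ≠ 0) :
    thetaPM p x w = v₁ / w * thetaPM p w v₂ / thetaPM p v₁ v₂ * thetaPM p x v₁ -
      v₁ / w * thetaPM p w v₁ / thetaPM p v₁ v₂ * thetaPM p x v₂ := by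
  have := thetaPM_three_term hp₁ hp₀ hx h₁ hw h₂
  field_simp at this ⊢
  linear_combination -this

variable {ι : Type*}

theorem sum_thetaPM_eq_zero_of_two_points (hp₁ : ‖p‖ < 1) (hp₀ : p ≠ 0) {s : Finset ι}
    {l x : ι → ℂ} {w v₁ v₂ : ℂ} (hx : ∀ i, x i ≠ 0) (hw : w ≠ 0) (h₁ : v₁ ≠ 0) (h₂ : v₂ ≠ 0)
    (h : thetaPM p v₁ v₂ ≠ 0) (hs₁ : ∑ i ∈ s, l i * thetaPM p (x i) v₁ = 0)
    (hs₂ : ∑ i ∈ s, l i * thetaPM p (x i) v₂ = 0) : ∑ i ∈ s, l i * thetaPM p (x i) w = 0 := by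
  calc ∑ i ∈ s, l i * thetaPM p (x i) w
      = ∑ i ∈ s, (v₁ / w * thetaPM p w v₂ / thetaPM p v₁ v₂ * (l i * thetaPM p (x i) v₁) -
          v₁ / w * thetaPM p w v₁ / thetaPM p v₁ v₂ * (l i * thetaPM p (x i) v₂)) :=
        Finset.sum_congr rfl fun i _ => by
          rw [thetaPM_eq_interpolation hp₁ hp₀ (hx i) hw h₁ h₂ h]; ring
    _ = 0 := by rw [Finset.sum_sub_distrib, ← Finset.mul_sum, ← Finset.mul_sum, hs₁, hs₂]; simp

variable [DecidableEq ι]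

/-- The choice w = κ / c i₁ makes the paired factor equal to θ(c_i / c_{i₁}) θ(c_i c_{i₁} / κ²). The
first factor kills the term of i₁ and cancels one denominator in every other term; the second plays
the role of a new zero κ² / c i₁. What remains is the identity for one point fewer. -/
theorem theta_partialFractions_step {s : Finset ι} {c b : ι → ℂ} (hp₁ : ‖p‖ < 1)
    (hc : ∀ i, c i ≠ 0) {i₁ i₂ : ι} (h₁ : i₁ ∈ s) (h₂ : i₂ ∈ s) (h₁₂ : i₁ ≠ i₂) {κ : ℂ}
    (hκ₀ : κ ≠ 0)
    (hdist : ∀ i ∈ s, ∀ j ∈ s, i ≠ j → theta p (c i / c j) ≠ 0)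
    (ih : ∑ i ∈ s.erase i₁,
      (∏ k ∈ s.erase i₁, theta p (c i / Function.update b i₂ (κ ^ 2 / c i₁) k)) /
        ∏ k ∈ (s.erase i₁).erase i, theta p (c i / c k) = 0) :
    ∑ i ∈ s, ((∏ k ∈ (s.erase i₁).erase i₂, theta p (c i / b k)) /
      ∏ k ∈ s.erase i, theta p (c i / c k)) * thetaPM p (c i / κ) (κ / c i₁) = 0 := by
  have e : ∀ i, thetaPM p (c i / κ) (κ / c i₁) =
      theta p (c i / c i₁) * theta p (c i / (κ ^ 2 / c i₁)) := fun i => by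
    have h0 := hc i₁
    rw [thetaPM]; congr 2 <;> field_simp
  rw [← Finset.add_sum_erase _ _ h₁, e i₁, div_self (hc i₁), theta_one hp₁, zero_mul, mul_zero,
    zero_add, ← ih]
  refine Finset.sum_congr rfl fun i hi => ?_
  have hi' := Finset.mem_erase.1 hi
  rw [e, ← Finset.mul_prod_erase (s.erase i) _ (Finset.mem_erase.2 ⟨hi'.1.symm, h₁⟩),
    ← Finset.mul_prod_erase (s.erase i₁) _ (Finset.mem_erase.2 ⟨h₁₂.symm, h₂⟩),
    Function.update_self, Finset.erase_right_comm (a := i)]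
  have hu : ∏ k ∈ (s.erase i₁).erase i₂, theta p (c i / Function.update b i₂ (κ ^ 2 / c i₁) k) =
      ∏ k ∈ (s.erase i₁).erase i₂, theta p (c i / b k) :=
    Finset.prod_congr rfl fun k hk => by
      rw [Function.update_of_ne (Finset.ne_of_mem_erase hk)]
  rw [hu]
  have h3 : theta p (c i / c i₁) ≠ 0 := hdist i hi'.2 i₁ h₁ hi'.1
  have h4 : ∏ k ∈ (s.erase i₁).erase i, theta p (c i / c k) ≠ 0 :=
    Finset.prod_ne_zero_iff.2 fun k hk => hdist i hi'.2 k
      (Finset.mem_of_mem_erase (Finset.mem_of_mem_erase hk)) (Finset.ne_of_mem_erase hk).symm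
  field_simp

/-- Partial fractions for theta functions. -/
theorem theta_partialFractions (hp₁ : ‖p‖ < 1) (hp₀ : p ≠ 0) :
    ∀ (n : ℕ) (s : Finset ι) (c b : ι → ℂ), s.card = n → (∀ i, c i ≠ 0) → (∀ i, b i ≠ 0) →
      (∀ i ∈ s, ∀ j ∈ s, i ≠ j → theta p (c i / c j) ≠ 0) → ∏ i ∈ s, c i = ∏ i ∈ s, b i →
      ∑ i ∈ s, (∏ k ∈ s, theta p (c i / b k)) / ∏ k ∈ s.erase i, theta p (c i / c k) = 0 := by
  intro n
  induction n with
  | zero => intro s c b hs; simp [Finset.card_eq_zero.1 hs]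
  | succ n ih =>
  intro s c b hs hc hb hdist hprod
  -- With κ² = b i₁ b i₂, the factors θ(c_i/b_{i₁}) θ(c_i/b_{i₂}) become θ((c_i/κ) w^{±1}) at w =
  -- κ/b i₁. In w the sum lies in a two-dimensional space, so its vanishing at w = κ/c i₁ and w =
  -- κ/c i₂ is enough, provided that these two points are independent; that is the last hypothesis.
  have key : ∀ b : ι → ℂ, (∀ i, b i ≠ 0) → ∏ i ∈ s, c i = ∏ i ∈ s, b i → ∀ i₁ ∈ s, ∀ i₂ ∈ s,
      i₁ ≠ i₂ → theta p (b i₁ * b i₂ / (c i₁ * c i₂)) ≠ 0 →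
      ∑ i ∈ s, (∏ k ∈ s, theta p (c i / b k)) / ∏ k ∈ s.erase i, theta p (c i / c k) = 0 := by
    intro b hb hprod i₁ h₁ i₂ h₂ h₁₂ hK
    obtain ⟨κ, hκ⟩ := IsAlgClosed.exists_pow_nat_eq (b i₁ * b i₂) two_pos
    have hκ₀ : κ ≠ 0 := by
      rintro rfl
      exact mul_ne_zero (hb i₁) (hb i₂) (by simpa using hκ.symm)
    have hstep : ∀ j₁ ∈ s, ∀ j₂ ∈ s, j₁ ≠ j₂ → κ ^ 2 = b j₁ * b j₂ →
        ∑ i ∈ s, ((∏ k ∈ (s.erase j₁).erase j₂, theta p (c i / b k)) /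
          ∏ k ∈ s.erase i, theta p (c i / c k)) * thetaPM p (c i / κ) (κ / c j₁) = 0 := by
      intro j₁ hj₁ j₂ hj₂ hj hκ
      refine theta_partialFractions_step hp₁ hc hj₁ hj₂ hj hκ₀ hdist
        (ih _ _ _ (by rw [Finset.card_erase_of_mem hj₁, hs]; rfl) hc (fun i => ?_)
          (fun i hi j hj => hdist i (Finset.mem_of_mem_erase hi) j (Finset.mem_of_mem_erase hj)) ?_)
      · rcases eq_or_ne i j₂ with rfl | h
        · simpa using ⟨hκ₀, hc j₁⟩
        · simpa [h] using hb i
      · have hj₂' := Finset.mem_erase.2 ⟨hj.symm, hj₂⟩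
        rw [← Finset.mul_prod_erase _ (Function.update b j₂ _) hj₂', Function.update_self,
          Finset.prod_congr rfl fun k hk => Function.update_of_ne (Finset.ne_of_mem_erase hk) _ _]
        rw [← Finset.mul_prod_erase s c hj₁, ← Finset.mul_prod_erase s b hj₁,
          ← Finset.mul_prod_erase _ b hj₂'] at hprod
        have := hc j₁
        field_simp
        rw [hκ]
        linear_combination hprod
    have r₁ := hstep i₁ h₁ i₂ h₂ h₁₂ hκ
    have r₂ := hstep i₂ h₂ i₁ h₁ h₁₂.symm (by rw [hκ, mul_comm])
    rw [Finset.erase_right_comm] at r₂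
    have hv : thetaPM p (κ / c i₁) (κ / c i₂) ≠ 0 := by
      have e : κ / c i₁ * (κ / c i₂) = b i₁ * b i₂ / (c i₁ * c i₂) := by rw [← hκ]; ring
      have e' : κ / c i₁ / (κ / c i₂) = c i₂ / c i₁ := by field_simp
      rw [thetaPM, e, e']
      exact mul_ne_zero hK (hdist i₂ h₂ i₁ h₁ h₁₂.symm)
    have r := sum_thetaPM_eq_zero_of_two_points hp₁ hp₀ (w := κ / b i₁)
      (fun i => div_ne_zero (hc i) hκ₀) (div_ne_zero hκ₀ (hb i₁)) (div_ne_zero hκ₀ (hc i₁))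
      (div_ne_zero hκ₀ (hc i₂)) hv r₁ r₂
    rw [← r]
    refine Finset.sum_congr rfl fun i _ => ?_
    have e1 : c i / κ * (κ / b i₁) = c i / b i₁ := by field_simp
    have e2 : c i / κ / (κ / b i₁) = c i / b i₂ := by
      have := hb i₁
      have := hb i₂
      rw [div_div_div_eq, ← pow_two, hκ, mul_comm (c i), mul_div_mul_left _ _ (hb i₁)]
    rw [thetaPM, e1, e2, ← Finset.mul_prod_erase s _ h₁,
      ← Finset.mul_prod_erase (s.erase i₁) _ (Finset.mem_erase.2 ⟨h₁₂.symm, h₂⟩)]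
    ring
  rcases n with _ | _ | n
  · obtain ⟨i, rfl⟩ := Finset.card_eq_one.1 hs
    have : c i = b i := by simpa using hprod
    simp [this, div_self (hb i), theta_one hp₁]
  · obtain ⟨i, j, hij, rfl⟩ := Finset.card_eq_two.1 hs
    rw [Finset.prod_pair hij, Finset.prod_pair hij] at hprod
    have h0 := hdist i (by simp) j (by simp) hij
    have hci := hc i
    have hcj := hc j
    have hbi := hb i
    have hbj := hb j
    have e1 : c i / b j = (c j / b i)⁻¹ := by field_simp; linear_combination hprod
    have e2 : c j / b j = (c i / b i)⁻¹ := by field_simp; linear_combination hprod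
    have e3 : c j / c i = (c i / c j)⁻¹ := by field_simp
    have f1 : ({i, j} : Finset ι).erase i = {j} := by
      ext k; simp only [Finset.mem_erase, Finset.mem_insert, Finset.mem_singleton]; grind
    have f2 : ({i, j} : Finset ι).erase j = {i} := by
      ext k; simp only [Finset.mem_erase, Finset.mem_insert, Finset.mem_singleton]; grind
    rw [Finset.sum_pair hij, Finset.prod_pair hij, Finset.prod_pair hij, f1, f2,
      Finset.prod_singleton, Finset.prod_singleton, e1, e2, e3,
      theta_inv hp₁ (div_ne_zero hcj hbi), theta_inv hp₁ (div_ne_zero hci hbi),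
      theta_inv hp₁ (div_ne_zero hci hcj)]
    field_simp
    ring
  · obtain ⟨i₁, i₂, i₃, h₁, h₂, h₃, h₁₂, h₁₃, h₂₃⟩ :=
      Finset.two_lt_card_iff.1 (by omega : 2 < s.card)
    -- With three points available, θ(b i₁ b i₂ / (c i₁ c ·)) cannot vanish at both i₂ and i₃, as c
    -- i₂ / c i₃ would then be a power of p. In the degenerate case b is permuted by the swap of i₂
    -- and i₃, which leaves the sum unchanged.
    by_cases hK : theta p (b i₁ * b i₂ / (c i₁ * c i₂)) = 0
    · have hK' : theta p (b i₁ * b i₂ / (c i₁ * c i₃)) ≠ 0 := by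
        intro hK'
        have n1 : ∀ i, b i₁ * b i₂ / (c i₁ * c i) ≠ 0 := fun i =>
          div_ne_zero (mul_ne_zero (hb _) (hb _)) (mul_ne_zero (hc _) (hc _))
        obtain ⟨k, hk⟩ := (theta_eq_zero_iff hp₁ hp₀ (n1 i₂)).1 hK
        obtain ⟨l, hl⟩ := (theta_eq_zero_iff hp₁ hp₀ (n1 i₃)).1 hK'
        refine hdist i₂ h₂ i₃ h₃ h₂₃
          ((theta_eq_zero_iff hp₁ hp₀ (div_ne_zero (hc _) (hc _))).2 ⟨l - k, ?_⟩)
        rw [zpow_sub₀ hp₀, ← hl, ← hk]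
        have := hc i₁
        have := hc i₂
        have := hc i₃
        have := hb i₁
        have := hb i₂
        field_simp
      have hsw : ∀ F : ι → ℂ, ∏ k ∈ s, F (Equiv.swap i₂ i₃ k) = ∏ k ∈ s, F k := by
        intro F
        refine Finset.prod_bijective (Equiv.swap i₂ i₃) (Equiv.bijective _) (fun k => ?_)
          fun _ _ => rfl
        rcases eq_or_ne k i₂ with rfl | a2
        · simp [h₂, h₃]
        rcases eq_or_ne k i₃ with rfl | a3
        · simp [h₂, h₃]
        rw [Equiv.swap_apply_of_ne_of_ne a2 a3]
      have := key (fun k => b (Equiv.swap i₂ i₃ k)) (fun k => hb _) (by rw [hprod, hsw b])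
        i₁ h₁ i₃ h₃ h₁₃
        (by rwa [Equiv.swap_apply_of_ne_of_ne h₁₂ h₁₃, Equiv.swap_apply_right])
      simpa only [fun i => hsw fun k => theta p (c i / b k)] using this
    · exact key b hb hprod i₁ h₁ i₂ h₂ h₁₂ hK

end PartialFractions


/-! ### Genericity, and the poles of the shift factors. -/

section Kernel

variable {p t : ℂ} {ι : Type*}

/-- The points `X i ^ {±1}` and the roots of `θ(t x²)` are distinct modulo `p ^ ℤ`. -/
structure ThetaGeneric (p t : ℂ) (X : ι → ℂ) : Prop where
  ne_zero : ∀ i, X i ≠ 0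
  sq : ∀ i, theta p (X i ^ 2) ≠ 0
  mul_sq : ∀ i, theta p (t * X i ^ 2) ≠ 0
  div_sq : ∀ i, theta p (t / X i ^ 2) ≠ 0
  mul : ∀ i j, i ≠ j → theta p (X i * X j) ≠ 0
  div : ∀ i j, i ≠ j → theta p (X i / X j) ≠ 0

/-- The factor `x⁻¹ ∏_m θ(a_m x) / θ(x²) ∏_{j ∈ s} θ(t x z_j^{±1}) / θ(x z_j^{±1})`. -/
noncomputable def shiftFactor (p t : ℂ) (a : Fin 6 → ℂ) (s : Finset ι) (z : ι → ℂ) (x : ℂ) : ℂ :=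
  x⁻¹ * (∏ m, theta p (a m * x)) / theta p (x ^ 2) *
    ∏ j ∈ s, thetaPM p (t * x) (z j) / thetaPM p x (z j)

theorem theta_inv_ne_zero (hp₁ : ‖p‖ < 1) {u : ℂ} (hu : u ≠ 0) (h : theta p u ≠ 0) :
    theta p u⁻¹ ≠ 0 := by
  rw [theta_inv hp₁ hu]
  exact div_ne_zero (neg_ne_zero.2 h) hu

theorem theta_div_ne_zero_comm (hp₁ : ‖p‖ < 1) {u v : ℂ} (hu : u ≠ 0) (hv : v ≠ 0)
    (h : theta p (u / v) ≠ 0) : theta p (v / u) ≠ 0 := by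
  rw [← inv_div]
  exact theta_inv_ne_zero hp₁ (div_ne_zero hu hv) h

theorem theta_neg_one_ne_zero (hp₁ : ‖p‖ < 1) (hp₀ : p ≠ 0) : theta p (-1) ≠ 0 := by
  refine theta_ne_zero hp₁ hp₀ (by simp) fun k hk => ?_
  have h1 : ‖p‖ ^ k = 1 := by rw [← norm_zpow, ← hk]; simp
  rcases eq_or_ne k 0 with rfl | h
  · norm_num at hk
  · rcases (zpow_eq_one_iff_of_ne_zero₀ h).1 h1 with h2 | h2
    · exact hp₁.ne h2
    · have := norm_nonneg p
      linarith [h2.1]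

/-- The four roots of `θ(τ² x²; r²)` in a fundamental domain. -/
noncomputable def thetaRoots (r τ : ℂ) : Fin 4 → ℂ := ![τ⁻¹, -τ⁻¹, (r * τ)⁻¹, -(r * τ)⁻¹]

theorem thetaRoots_ne_zero {r τ : ℂ} (hr : r ≠ 0) (hτ : τ ≠ 0) (l : Fin 4) :
    thetaRoots r τ l ≠ 0 := by
  fin_cases l <;> simp [thetaRoots, hr, hτ]

theorem theta_prod_thetaRoots {r τ : ℂ} (hr₁ : ‖r‖ < 1) (hr : r ≠ 0) (hτ : τ ≠ 0) {x : ℂ}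
    (hx : x ≠ 0) :
    ∏ l, theta (r ^ 2) (x / thetaRoots r τ l) = theta (r ^ 2) (τ ^ 2 * x ^ 2) := by
  rw [← mul_pow, theta_sq hr₁ hr (mul_ne_zero hτ hx), Fin.prod_univ_four]
  simp only [thetaRoots, Matrix.cons_val_zero, Matrix.cons_val_one, Matrix.cons_val,
    div_neg, div_inv_eq_mul]
  rw [mul_comm x τ, mul_comm x (r * τ), mul_assoc r, mul_assoc]

/-- At a root w of θ(t x²), with p = r² and t = τ², either tw or p t w equals 1/w. Inversion and the
quasi-period then bring the paired factor back to w at the cost of a constant that does not involve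
z. This is what makes the contributions of the roots collapse into the single coefficient B of the
kernel identity. -/
theorem exists_thetaPM_thetaRoots {r τ : ℂ} (hr₁ : ‖r ^ 2‖ < 1) (hr : r ≠ 0) (hτ : τ ≠ 0)
    (l : Fin 4) : ∃ γ : ℂ, ∀ z ≠ 0, thetaPM (r ^ 2) (τ ^ 2 * thetaRoots r τ l) z =
      γ * thetaPM (r ^ 2) (thetaRoots r τ l) z := by
  have hr2 : r ^ 2 ≠ 0 := pow_ne_zero 2 hr
  have hw := thetaRoots_ne_zero hr hτ l
  have h : τ ^ 2 * thetaRoots r τ l = (thetaRoots r τ l)⁻¹ ∨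
      r ^ 2 * (τ ^ 2 * thetaRoots r τ l) = (thetaRoots r τ l)⁻¹ := by
    fin_cases l
    · left; simp [thetaRoots]; field_simp
    · left; simp [thetaRoots]; field_simp
    · right; simp [thetaRoots]; field_simp
    · right; simp [thetaRoots]; field_simp
  have hne : τ ^ 2 * thetaRoots r τ l ≠ 0 := mul_ne_zero (pow_ne_zero 2 hτ) hw
  rcases h with h | h
  · refine ⟨1 / thetaRoots r τ l ^ 2, fun z hz => ?_⟩
    rw [h, thetaPM_inv_left hr₁ hw hz]
    ring
  · refine ⟨(τ ^ 2 * thetaRoots r τ l) ^ 2 / thetaRoots r τ l ^ 2, fun z hz => ?_⟩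
    have h1 := thetaPM_mul_left hr₁ hr2 hne hz
    rw [h, thetaPM_inv_left hr₁ hw hz] at h1
    generalize thetaPM (r ^ 2) (τ ^ 2 * thetaRoots r τ l) z = A at *
    field_simp at h1 ⊢
    linear_combination -h1

theorem theta_thetaRoots_div_ne_zero {r τ : ℂ} (hr₁ : ‖r‖ < 1) (hr : r ≠ 0) (hτ : τ ≠ 0)
    {l m : Fin 4} (h : l ≠ m) : theta (r ^ 2) (thetaRoots r τ l / thetaRoots r τ m) ≠ 0 := by
  have hr2 : ‖r ^ 2‖ < 1 := by
    rw [norm_pow]; exact pow_lt_one₀ (norm_nonneg _) hr₁ two_ne_zero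
  have h1 := theta_neg_one_ne_zero hr2 (pow_ne_zero 2 hr)
  have hlt : ‖r ^ 2‖ < ‖r‖ := by
    rw [norm_pow, pow_two]; exact mul_lt_of_lt_one_left (norm_pos_iff.2 hr) hr₁
  have h2 : theta (r ^ 2) r ≠ 0 := theta_ne_zero_of_norm hr2 hlt hr₁
  have h3 : theta (r ^ 2) (-r) ≠ 0 := theta_ne_zero_of_norm hr2 (by simpa using hlt) (by simpa)
  have h4 := theta_inv_ne_zero hr2 hr h2
  have h5 := theta_inv_ne_zero hr2 (neg_ne_zero.2 hr) h3
  have e1 : τ⁻¹ / (r * τ)⁻¹ = r := by field_simp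
  have e2 : (r * τ)⁻¹ / τ⁻¹ = r⁻¹ := by field_simp
  have e3 : (r * τ)⁻¹ ≠ 0 := inv_ne_zero (mul_ne_zero hr hτ)
  rw [inv_neg] at h5
  fin_cases l <;> fin_cases m <;> first | exact absurd rfl h | skip
  all_goals
    simp only [thetaRoots, Fin.zero_eta, Fin.mk_one, Fin.reduceFinMk, Matrix.cons_val_zero,
      Matrix.cons_val_one, Matrix.cons_val, div_neg, neg_div, neg_neg, e1, e2,
      div_self (inv_ne_zero hτ), div_self e3]
    assumption

theorem prod_erase_eq_prod_ite [Fintype ι] [DecidableEq ι] (i : ι) (F : ι → ℂ) :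
    ∏ j ∈ Finset.univ.erase i, F j = ∏ j, if j = i then 1 else F j := by
  rw [← Finset.mul_prod_erase Finset.univ (fun j => if j = i then 1 else F j) (Finset.mem_univ i),
    if_pos rfl, one_mul]
  exact Finset.prod_congr rfl fun j hj => (if_neg (Finset.ne_of_mem_erase hj)).symm

/-- The points `X o ^ {±1}` together with the roots of `θ(τ² x²; r²)`. -/
noncomputable def kernelPoles (r τ : ℂ) (X : ι → ℂ) : (ι × Bool) ⊕ Fin 4 → ℂ :=
  Sum.elim (fun k => cond k.2 (X k.1) (X k.1)⁻¹) (thetaRoots r τ)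

theorem kernelPoles_ne_zero {r τ : ℂ} (hr : r ≠ 0) (hτ : τ ≠ 0) {X : ι → ℂ} (hX : ∀ i, X i ≠ 0)
    (i : (ι × Bool) ⊕ Fin 4) : kernelPoles r τ X i ≠ 0 := by
  rcases i with ⟨i, s⟩ | l
  · cases s <;> simp [kernelPoles, hX]
  · exact thetaRoots_ne_zero hr hτ l

/-- `ThetaGeneric` is tailored to this: its first conditions separate the points and their inverses
from each other, while θ(t x^{±2}) ≠ 0 separates them from the roots through the factorization
`theta_prod_thetaRoots`. -/
theorem theta_kernelPoles_div_ne_zero {r τ : ℂ} (hr₁ : ‖r‖ < 1) (hr : r ≠ 0) (hτ : τ ≠ 0)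
    {X : ι → ℂ} (hX : ThetaGeneric (r ^ 2) (τ ^ 2) X) {i j : (ι × Bool) ⊕ Fin 4} (h : i ≠ j) :
    theta (r ^ 2) (kernelPoles r τ X i / kernelPoles r τ X j) ≠ 0 := by
  have hr2 : ‖r ^ 2‖ < 1 := by
    rw [norm_pow]; exact pow_lt_one₀ (norm_nonneg _) hr₁ two_ne_zero
  have key : ∀ x : ℂ, x ≠ 0 → theta (r ^ 2) (τ ^ 2 * x ^ 2) ≠ 0 → ∀ l,
      theta (r ^ 2) (x / thetaRoots r τ l) ≠ 0 := by
    intro x hx h l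
    rw [← theta_prod_thetaRoots hr₁ hr hτ hx] at h
    exact Finset.prod_ne_zero_iff.1 h l (Finset.mem_univ l)
  have key2 : ∀ k l, theta (r ^ 2) (kernelPoles r τ X (Sum.inl k) / thetaRoots r τ l) ≠ 0 := by
    rintro ⟨k, s⟩ l
    have h0 := hX.ne_zero k
    cases s
    · exact key _ (inv_ne_zero h0) (by simpa [div_eq_mul_inv] using hX.div_sq k) l
    · exact key _ h0 (hX.mul_sq k) l
  rcases i with i | l <;> rcases j with j | m
  · obtain ⟨i, s⟩ := i
    obtain ⟨j, s'⟩ := j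
    have hi := hX.ne_zero i
    have hj := hX.ne_zero j
    rcases eq_or_ne i j with rfl | hij
    · have h2 := theta_inv_ne_zero hr2 (pow_ne_zero 2 hi) (hX.sq i)
      have e1 : (X i)⁻¹ / X i = (X i ^ 2)⁻¹ := by field_simp
      have e2 : X i / (X i)⁻¹ = X i ^ 2 := by field_simp
      cases s <;> cases s' <;> first | exact absurd rfl h | skip
      · simpa [kernelPoles, e1] using h2
      · simpa [kernelPoles, e2] using hX.sq i
    · have e1 : (X i)⁻¹ / X j = (X i * X j)⁻¹ := by field_simp
      have e2 : (X i)⁻¹ / (X j)⁻¹ = (X i / X j)⁻¹ := by field_simp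
      have e3 : X i / (X j)⁻¹ = X i * X j := by field_simp
      cases s <;> cases s' <;> simp only [kernelPoles, Sum.elim_inl, cond_true, cond_false, e1, e2,
        e3]
      · exact theta_inv_ne_zero hr2 (div_ne_zero hi hj) (hX.div i j hij)
      · exact theta_inv_ne_zero hr2 (mul_ne_zero hi hj) (hX.mul i j hij)
      · exact hX.mul i j hij
      · exact hX.div i j hij
  · exact key2 i m
  · exact theta_div_ne_zero_comm hr2 (kernelPoles_ne_zero hr hτ hX.ne_zero _)
      (thetaRoots_ne_zero hr hτ l) (key2 j l)
  · exact theta_thetaRoots_div_ne_zero hr₁ hr hτ fun h' => h (by rw [h'])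

end Kernel


/-! ### The kernel identity. -/

section KernelIdentity

variable {ι : Type*} [Fintype ι]

/-- The points `X o` for `o = none` and `o = some k` are `y` and `z k`. -/
def optionCons (y : ℂ) (z : ι → ℂ) (o : Option ι) : ℂ := o.elim y z

/-- The points `t⁻¹ z_k ^ {±1}` together with the `a_m⁻¹`. -/
noncomputable def kernelZeros (t : ℂ) (a : Fin 6 → ℂ) (z : ι → ℂ) :
    (Option ι × Bool) ⊕ Fin 4 → ℂ :=
  Sum.elim (fun k => k.1.elim (cond k.2 (a 0)⁻¹ (a 1)⁻¹)
    fun i => cond k.2 (t⁻¹ * z i) (t⁻¹ * (z i)⁻¹)) ![(a 2)⁻¹, (a 3)⁻¹, (a 4)⁻¹, (a 5)⁻¹]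

theorem prod_theta_kernelZeros (p t : ℂ) (a : Fin 6 → ℂ) (z : ι → ℂ) (x : ℂ) :
    ∏ k, theta p (x / kernelZeros t a z k) =
      (∏ m, theta p (a m * x)) * ∏ k, thetaPM p (t * x) (z k) := by
  have e1 : ∀ i, x / (t⁻¹ * z i) = t * x / z i := fun i => by
    rw [div_mul_eq_div_div, div_inv_eq_mul, mul_comm]
  have e2 : ∀ i, x / (t⁻¹ * (z i)⁻¹) = t * x * z i := fun i => by
    rw [div_mul_eq_div_div, div_inv_eq_mul, div_inv_eq_mul, mul_comm x]
  simp only [Fintype.prod_sum_type, Fintype.prod_prod_type, Fintype.prod_option, Fintype.prod_bool,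
    kernelZeros, Sum.elim_inl, Sum.elim_inr, Option.elim, cond_true, cond_false, e1, e2,
    Fin.prod_univ_four, Fin.prod_univ_six, div_inv_eq_mul, Matrix.cons_val_zero,
    Matrix.cons_val_one, Matrix.cons_val, thetaPM]
  simp only [mul_comm x, Finset.prod_mul_distrib]
  ring

variable [DecidableEq ι]

theorem prod_erase_theta_kernelPoles_some {r τ : ℂ} (hr₁ : ‖r‖ < 1) (hr : r ≠ 0) (hτ : τ ≠ 0)
    {y : ℂ} {z : ι → ℂ} (hz : ∀ i, z i ≠ 0) (k : ι) (s : Bool) :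
    ∏ j ∈ Finset.univ.erase (Sum.inl (some k, s)),
      theta (r ^ 2) (cond s (z k) (z k)⁻¹ / kernelPoles r τ (optionCons y z) j) =
    theta (r ^ 2) (cond s (z k) (z k)⁻¹ ^ 2) *
      (∏ j ∈ Finset.univ.erase k, thetaPM (r ^ 2) (cond s (z k) (z k)⁻¹) (z j)) *
      thetaPM (r ^ 2) (cond s (z k) (z k)⁻¹) y *
      theta (r ^ 2) (τ ^ 2 * cond s (z k) (z k)⁻¹ ^ 2) := by
  have h0 : cond s (z k) (z k)⁻¹ ≠ 0 := by cases s <;> simp [hz]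
  rw [← theta_prod_thetaRoots hr₁ hr hτ h0, prod_erase_eq_prod_ite]
  simp only [Fintype.prod_sum_type, Fintype.prod_prod_type, Fintype.prod_option, Fintype.prod_bool,
    reduceCtorEq, if_false, Sum.inl.injEq, Prod.mk.injEq, false_and, Option.some.injEq,
    kernelPoles, Sum.elim_inl, Sum.elim_inr, optionCons, Option.elim, cond_true, cond_false]
  have hk := hz k
  rw [← Finset.mul_prod_erase _ _ (Finset.mem_univ k)]
  have e : ∀ x : ℂ, (∏ j ∈ Finset.univ.erase k,
      ((if j = k ∧ true = s then 1 else theta (r ^ 2) (x / z j)) *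
        if j = k ∧ false = s then 1 else theta (r ^ 2) (x / (z j)⁻¹))) =
      ∏ j ∈ Finset.univ.erase k, thetaPM (r ^ 2) x (z j) := fun x =>
    Finset.prod_congr rfl fun j hj => by
      simp only [Finset.ne_of_mem_erase hj, false_and, if_false, thetaPM, div_inv_eq_mul]
      rw [mul_comm]
  rw [e]
  have e1 : (z k)⁻¹ / z k = (z k)⁻¹ ^ 2 := by field_simp
  cases s
  · simp [-mul_eq_mul_left_iff, -mul_eq_mul_right_iff, thetaPM, e1]
    ring
  · simp [-mul_eq_mul_left_iff, -mul_eq_mul_right_iff, thetaPM, ← pow_two]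
    ring

theorem prod_erase_theta_kernelPoles_none {r τ : ℂ} (hr₁ : ‖r‖ < 1) (hr : r ≠ 0) (hτ : τ ≠ 0)
    {y : ℂ} (hy : y ≠ 0) (z : ι → ℂ) (s : Bool) :
    ∏ j ∈ Finset.univ.erase (Sum.inl (none, s)),
      theta (r ^ 2) (cond s y y⁻¹ / kernelPoles r τ (optionCons y z) j) =
    theta (r ^ 2) (cond s y y⁻¹ ^ 2) * (∏ j, thetaPM (r ^ 2) (cond s y y⁻¹) (z j)) *
      theta (r ^ 2) (τ ^ 2 * cond s y y⁻¹ ^ 2) := by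
  have h0 : cond s y y⁻¹ ≠ 0 := by cases s <;> simp [hy]
  rw [← theta_prod_thetaRoots hr₁ hr hτ h0, prod_erase_eq_prod_ite]
  simp only [Fintype.prod_sum_type, Fintype.prod_prod_type, Fintype.prod_option, Fintype.prod_bool,
    reduceCtorEq, if_false, Sum.inl.injEq, Prod.mk.injEq, false_and, true_and,
    kernelPoles, Sum.elim_inl, Sum.elim_inr, optionCons, Option.elim, cond_true, cond_false]
  have e1 : y⁻¹ / y = y⁻¹ ^ 2 := by field_simp
  cases s
  · simp [-mul_eq_mul_left_iff, -mul_eq_mul_right_iff, thetaPM, e1, Finset.prod_mul_distrib]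
    ring
  · simp [-mul_eq_mul_left_iff, -mul_eq_mul_right_iff, thetaPM, ← pow_two, Finset.prod_mul_distrib]
    ring

theorem prod_erase_theta_kernelPoles_root {r τ : ℂ} (y : ℂ) (z : ι → ℂ) (l : Fin 4) (x : ℂ) :
    ∏ j ∈ Finset.univ.erase (Sum.inr l), theta (r ^ 2) (x / kernelPoles r τ (optionCons y z) j) =
    thetaPM (r ^ 2) x y * (∏ j, thetaPM (r ^ 2) x (z j)) *
      ∏ j ∈ Finset.univ.erase l, theta (r ^ 2) (x / thetaRoots r τ j) := by
  rw [prod_erase_eq_prod_ite, prod_erase_eq_prod_ite]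
  simp only [Fintype.prod_sum_type, Fintype.prod_prod_type, Fintype.prod_option, Fintype.prod_bool,
    reduceCtorEq, if_false, Sum.inr.injEq,
    kernelPoles, Sum.elim_inl, Sum.elim_inr, optionCons, Option.elim, cond_true, cond_false,
    thetaPM, div_inv_eq_mul, Finset.prod_mul_distrib]
  ring

/-- A sum of shift factors acts on `z ↦ ∏ θ(y z_k^{±1})` as a second order difference operator
in `y`. -/
theorem exists_kernel_identity_sq {r τ : ℂ} (hr₁ : ‖r‖ < 1) (hr : r ≠ 0) (hτ : τ ≠ 0)
    {a : Fin 6 → ℂ} (ha : ∀ m, a m ≠ 0)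
    {n : ℕ} (hbal : (∏ m, a m) * (τ ^ 2) ^ (2 * n) = r ^ 2 * (τ ^ 2) ^ 2) {y : ℂ}
    (hy : y ≠ 0) :
    ∃ A₁ A₂ B : ℂ, ∀ (ι : Type) [Fintype ι] [DecidableEq ι] (z : ι → ℂ),
      Fintype.card ι = n → ThetaGeneric (r ^ 2) (τ ^ 2) (optionCons y z) →
      theta (r ^ 2) (τ ^ 2) * y * ∑ k, (shiftFactor (r ^ 2) (τ ^ 2) a (Finset.univ.erase k) z (z k)
        + shiftFactor (r ^ 2) (τ ^ 2) a (Finset.univ.erase k) z (z k)⁻¹) *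
          ∏ j ∈ Finset.univ.erase k, thetaPM (r ^ 2) y (z j) =
      A₁ * ∏ j, thetaPM (r ^ 2) (τ ^ 2 * y) (z j) + A₂ * ∏ j, thetaPM (r ^ 2) (τ ^ 2 / y) (z j) +
        B * ∏ j, thetaPM (r ^ 2) y (z j) := by
  have hp₁ : ‖r ^ 2‖ < 1 := by
    rw [norm_pow]; exact pow_lt_one₀ (norm_nonneg _) hr₁ two_ne_zero
  have hp₀ : r ^ 2 ≠ 0 := pow_ne_zero 2 hr
  have ht₀ : τ ^ 2 ≠ 0 := pow_ne_zero 2 hτ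
  choose γ hγ using exists_thetaPM_thetaRoots hp₁ hr hτ
  -- The three coefficients are the partial fraction terms at y, at 1/y and at the four roots, freed
  -- of z. The power of y² comes from inverting y in the n paired factors, and the powers of γ from
  -- `exists_thetaPM_thetaRoots`.
  refine ⟨(∏ m, theta (r ^ 2) (a m * y)) / (theta (r ^ 2) (y ^ 2) * theta (r ^ 2) (τ ^ 2 * y ^ 2)),
    (∏ m, theta (r ^ 2) (a m * y⁻¹)) * (y ^ 2) ^ n /
      (theta (r ^ 2) (y⁻¹ ^ 2) * theta (r ^ 2) (τ ^ 2 * y⁻¹ ^ 2)),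
    ∑ l, (∏ m, theta (r ^ 2) (a m * thetaRoots r τ l)) * γ l ^ n /
      (thetaPM (r ^ 2) (thetaRoots r τ l) y *
        ∏ j ∈ Finset.univ.erase l, theta (r ^ 2) (thetaRoots r τ l / thetaRoots r τ j)),
    fun ι _ _ z hn hX => ?_⟩
  subst hn
  have hz : ∀ k, z k ≠ 0 := fun k => hX.ne_zero (some k)
  -- Poles and zeros both number 2n + 6. The pairs of inverse points multiply to 1 and the four
  -- roots to 1/(p t²), so equality of the two products is exactly the balancing hypothesis.
  have hpf := theta_partialFractions hp₁ hp₀ _ Finset.univ (kernelPoles r τ (optionCons y z))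
    (kernelZeros (τ ^ 2) a z) rfl (kernelPoles_ne_zero hr hτ hX.ne_zero)
    (by
      rintro (⟨_ | k, _ | _⟩ | l)
      · simp [kernelZeros, ha]
      · simp [kernelZeros, ha]
      · simp [kernelZeros, hz, hτ]
      · simp [kernelZeros, hz, hτ]
      · fin_cases l <;> simp [kernelZeros, ha])
    (fun i _ j _ h => theta_kernelPoles_div_ne_zero hr₁ hr hτ hX h)
    (by
      have e : ∏ k, (τ ^ 2)⁻¹ * z k * ((τ ^ 2)⁻¹ * (z k)⁻¹) =
          (((τ ^ 2) ^ (2 * Fintype.card ι)))⁻¹ := by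
        rw [pow_mul, ← Finset.card_univ, ← Finset.prod_const, ← Finset.prod_inv_distrib]
        exact Finset.prod_congr rfl fun k _ => by have := hz k; field_simp
      have e' : ∏ k, z k * (z k)⁻¹ = 1 :=
        Finset.prod_eq_one fun k _ => mul_inv_cancel₀ (hz k)
      simp only [Fintype.prod_sum_type, Fintype.prod_prod_type, Fintype.prod_option,
        Fintype.prod_bool, kernelPoles, kernelZeros, Sum.elim_inl, Sum.elim_inr, optionCons,
        Option.elim, cond_true, cond_false, Fin.prod_univ_four, thetaRoots, Matrix.cons_val_zero,
        Matrix.cons_val_one, Matrix.cons_val, e, e']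
      rw [Fin.prod_univ_six] at hbal
      have := fun m => ha m
      have hN : (τ ^ 2) ^ (2 * Fintype.card ι) ≠ 0 := pow_ne_zero _ ht₀
      have e2 : ((τ ^ 2) ^ (2 * Fintype.card ι))⁻¹ =
          a 0 * a 1 * a 2 * a 3 * a 4 * a 5 / (r ^ 2 * (τ ^ 2) ^ 2) := by
        rw [← hbal]
        field_simp [ha 0, ha 1, ha 2, ha 3, ha 4, ha 5]
      rw [e2]
      field_simp [ha 0, ha 1, ha 2, ha 3, ha 4, ha 5])
  simp only [prod_theta_kernelZeros] at hpf
  rw [Fintype.sum_sum_type, Fintype.sum_prod_type, Fintype.sum_option] at hpf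
  simp only [Fintype.sum_bool] at hpf
  have hcs : ∀ k s, kernelPoles r τ (optionCons y z) (Sum.inl (some k, s)) =
    cond s (z k) (z k)⁻¹ := fun _ _ => rfl
  have hcn : ∀ s, kernelPoles r τ (optionCons y z) (Sum.inl (none, s)) = cond s y y⁻¹ :=
    fun _ => rfl
  have hcr : ∀ l, kernelPoles r τ (optionCons y z) (Sum.inr l) = thetaRoots r τ l := fun _ => rfl
  have hPy : ∀ j, thetaPM (r ^ 2) y (z j) ≠ 0 := fun j =>
    mul_ne_zero (hX.mul none (some j) (by simp)) (hX.div none (some j) (by simp))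
  -- At z_k^{±1} the numerator contains θ(t) θ(t z_k^{±2}), whose second factor cancels the roots in
  -- the denominator. Exchanging the arguments of the paired factor of y and z_k^{±1} supplies the
  -- factor y, the sign and the x⁻¹ of `shiftFactor`.
  have hterm : ∀ k s, (∏ m, theta (r ^ 2) (a m * cond s (z k) (z k)⁻¹)) *
      (∏ j, thetaPM (r ^ 2) (τ ^ 2 * cond s (z k) (z k)⁻¹) (z j)) /
      (∏ j ∈ Finset.univ.erase (Sum.inl (some k, s)),
        theta (r ^ 2) (cond s (z k) (z k)⁻¹ / kernelPoles r τ (optionCons y z) j)) *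
      ∏ j, thetaPM (r ^ 2) y (z j) =
      -(theta (r ^ 2) (τ ^ 2) * y *
        (shiftFactor (r ^ 2) (τ ^ 2) a (Finset.univ.erase k) z (cond s (z k) (z k)⁻¹) *
          ∏ j ∈ Finset.univ.erase k, thetaPM (r ^ 2) y (z j))) := by
    intro k s
    rw [prod_erase_theta_kernelPoles_some hr₁ hr hτ hz]
    have h1 : thetaPM (r ^ 2) y (z k) = thetaPM (r ^ 2) y (cond s (z k) (z k)⁻¹) := by
      cases s <;> simp [thetaPM_inv_right]
    have h2 : thetaPM (r ^ 2) (τ ^ 2 * cond s (z k) (z k)⁻¹) (z k) =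
        theta (r ^ 2) (τ ^ 2) * theta (r ^ 2) (τ ^ 2 * cond s (z k) (z k)⁻¹ ^ 2) := by
      have := hz k
      have e1 : τ ^ 2 * (z k)⁻¹ / z k = τ ^ 2 * (z k)⁻¹ ^ 2 := by field_simp
      have e2 : τ ^ 2 * (z k)⁻¹ * z k = τ ^ 2 := by field_simp
      have e3 : τ ^ 2 * z k / z k = τ ^ 2 := by field_simp
      cases s
      · simp only [thetaPM, cond_false, e1, e2]
      · simp only [thetaPM, cond_true, e3, mul_assoc, ← pow_two]; ring
    have h3 : theta (r ^ 2) (τ ^ 2 * cond s (z k) (z k)⁻¹ ^ 2) ≠ 0 := by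
      cases s
      · simpa [div_eq_mul_inv, optionCons] using hX.div_sq (some k)
      · exact hX.mul_sq (some k)
    have hx : cond s (z k) (z k)⁻¹ ≠ 0 := by cases s <;> simp [hz]
    have hy' := hPy k
    rw [← Finset.mul_prod_erase _ (fun j => thetaPM (r ^ 2) y (z j)) (Finset.mem_univ k),
      ← Finset.mul_prod_erase _ (fun j => thetaPM (r ^ 2) (τ ^ 2 * _) (z j)) (Finset.mem_univ k),
      h2, h1]
    rw [h1, thetaPM_comm hp₁ hy hx] at hy'
    rw [thetaPM_comm hp₁ hy hx, shiftFactor, Finset.prod_div_distrib]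
    have hy'' := right_ne_zero_of_mul hy'
    generalize theta (r ^ 2) (τ ^ 2 * cond s (z k) (z k)⁻¹ ^ 2) = T at *
    generalize thetaPM (r ^ 2) (cond s (z k) (z k)⁻¹) y = Y at *
    generalize ∏ m, theta (r ^ 2) (a m * cond s (z k) (z k)⁻¹) = M at *
    generalize cond s (z k) (z k)⁻¹ = x at *
    field_simp
  have hN : ∏ j, thetaPM (r ^ 2) y (z j) ≠ 0 := Finset.prod_ne_zero_iff.2 fun j _ => hPy j
  have hinv : ∏ j, thetaPM (r ^ 2) y⁻¹ (z j) =
      (∏ j, thetaPM (r ^ 2) y (z j)) / (y ^ 2) ^ Fintype.card ι := by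
    simp only [thetaPM_inv_left hp₁ hy (hz _), Finset.prod_div_distrib, Finset.prod_const,
      Finset.card_univ]
  have hroots : ∀ l, ∏ j, thetaPM (r ^ 2) (τ ^ 2 * thetaRoots r τ l) (z j) =
      γ l ^ Fintype.card ι * ∏ j, thetaPM (r ^ 2) (thetaRoots r τ l) (z j) := by
    intro l
    simp only [hγ l _ (hz _), Finset.prod_mul_distrib, Finset.prod_const, Finset.card_univ]
  have hroots0 : ∀ l, ∏ j, thetaPM (r ^ 2) (thetaRoots r τ l) (z j) ≠ 0 := by
    intro l
    refine Finset.prod_ne_zero_iff.2 fun j _ => ?_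
    have h1 := theta_kernelPoles_div_ne_zero hr₁ hr hτ hX (i := Sum.inr l)
      (j := Sum.inl (some j, true)) (by simp)
    have h2 := theta_kernelPoles_div_ne_zero hr₁ hr hτ hX (i := Sum.inr l)
      (j := Sum.inl (some j, false)) (by simp)
    rw [hcr, hcs] at h1 h2
    rw [cond_false, div_inv_eq_mul] at h2
    exact mul_ne_zero h2 h1
  -- Multiplying by ∏ θ(y z_j^{±1}) clears the denominators that involve y in the terms at z_k^{±1},
  -- and removes those that involve z in the terms at y^{±1}.
  have hpf2 := congrArg (· * ∏ j, thetaPM (r ^ 2) y (z j)) hpf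
  simp only [hcs, hcn, hcr, zero_mul, add_mul, Finset.sum_mul, hterm,
    prod_erase_theta_kernelPoles_none hr₁ hr hτ hy, prod_erase_theta_kernelPoles_root,
    hroots] at hpf2
  simp only [cond_true, cond_false, hinv] at hpf2
  rw [Finset.mul_sum, Finset.sum_mul, ← sub_eq_zero, ← neg_eq_zero, ← hpf2]
  have hs : ∀ l, (∏ m, theta (r ^ 2) (a m * thetaRoots r τ l)) *
      (γ l ^ Fintype.card ι * ∏ j, thetaPM (r ^ 2) (thetaRoots r τ l) (z j)) /
      (thetaPM (r ^ 2) (thetaRoots r τ l) y * (∏ j, thetaPM (r ^ 2) (thetaRoots r τ l) (z j)) *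
        ∏ j ∈ Finset.univ.erase l, theta (r ^ 2) (thetaRoots r τ l / thetaRoots r τ j)) =
      (∏ m, theta (r ^ 2) (a m * thetaRoots r τ l)) * γ l ^ Fintype.card ι /
      (thetaPM (r ^ 2) (thetaRoots r τ l) y *
        ∏ j ∈ Finset.univ.erase l, theta (r ^ 2) (thetaRoots r τ l / thetaRoots r τ j)) := by
    intro l
    have := hroots0 l
    generalize ∏ m, theta (r ^ 2) (a m * thetaRoots r τ l) = M at *
    field_simp
  simp only [hs]
  have hd : ∀ k, theta (r ^ 2) (τ ^ 2) * y *
      ((shiftFactor (r ^ 2) (τ ^ 2) a (Finset.univ.erase k) z (z k) +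
        shiftFactor (r ^ 2) (τ ^ 2) a (Finset.univ.erase k) z (z k)⁻¹) *
          ∏ j ∈ Finset.univ.erase k, thetaPM (r ^ 2) y (z j)) =
      -(-(theta (r ^ 2) (τ ^ 2) * y *
        (shiftFactor (r ^ 2) (τ ^ 2) a (Finset.univ.erase k) z (z k) *
          ∏ j ∈ Finset.univ.erase k, thetaPM (r ^ 2) y (z j))) +
      -(theta (r ^ 2) (τ ^ 2) * y *
        (shiftFactor (r ^ 2) (τ ^ 2) a (Finset.univ.erase k) z (z k)⁻¹ *
          ∏ j ∈ Finset.univ.erase k, thetaPM (r ^ 2) y (z j)))) := fun k => by ring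
  simp only [hd, Finset.sum_neg_distrib]
  have e5 : τ ^ 2 * y⁻¹ = τ ^ 2 / y := by rw [div_eq_mul_inv]
  have hsq : y ^ 2 ≠ 0 := pow_ne_zero 2 hy
  have hpow : (y ^ 2) ^ Fintype.card ι ≠ 0 := pow_ne_zero _ hsq
  rw [e5]
  have f1 : ∀ u v P : ℂ, P ≠ 0 → ∀ M Q : ℂ, M * Q / (u * P * v) * P = M / (u * v) * Q := by
    intro u v P hP M Q
    field_simp
  have f2 : ∀ u v P Y : ℂ, P ≠ 0 → Y ≠ 0 → ∀ M Q : ℂ,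
      M * Q / (u * (P / Y) * v) * P = M * Y / (u * v) * Q := by
    intro u v P Y hP hY M Q
    field_simp
  rw [f1 _ _ _ hN, f2 _ _ _ _ hN hpow]
  ring

/-- Square roots of p and t serve only to name the four roots. The coefficients are chosen before
the index type and the point z, since the same ones must serve on the torus, indexed by `Fin n`, and
at the nodes, indexed by `Fin r ⊕ Fin m`. -/
theorem exists_kernel_identity {p t : ℂ} (hp₁ : ‖p‖ < 1) (hp₀ : p ≠ 0) (ht : t ≠ 0)
    {a : Fin 6 → ℂ} (ha : ∀ m, a m ≠ 0)
    {n : ℕ} (hbal : (∏ m, a m) * t ^ (2 * n) = p * t ^ 2) {y : ℂ} (hy : y ≠ 0) :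
    ∃ A₁ A₂ B : ℂ, ∀ (ι : Type) [Fintype ι] [DecidableEq ι] (z : ι → ℂ),
      Fintype.card ι = n → ThetaGeneric p t (optionCons y z) →
      theta p t * y * ∑ k, (shiftFactor p t a (Finset.univ.erase k) z (z k)
        + shiftFactor p t a (Finset.univ.erase k) z (z k)⁻¹) *
          ∏ j ∈ Finset.univ.erase k, thetaPM p y (z j) =
      A₁ * ∏ j, thetaPM p (t * y) (z j) + A₂ * ∏ j, thetaPM p (t / y) (z j) +
        B * ∏ j, thetaPM p y (z j) := by
  obtain ⟨r, rfl⟩ := IsAlgClosed.exists_pow_nat_eq p two_pos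
  obtain ⟨τ, rfl⟩ := IsAlgClosed.exists_pow_nat_eq t two_pos
  have hr₁ : ‖r‖ < 1 := by
    rw [norm_pow] at hp₁; exact (pow_lt_one_iff_of_nonneg (norm_nonneg _) two_ne_zero).1 hp₁
  exact exists_kernel_identity_sq hr₁ (by simpa using hp₀) (by simpa using ht) ha hbal hy

end KernelIdentity


/-! ### Interpolation at nodes. -/

section Nodes

variable {p t α β : ℂ}

/-- The value of `z ↦ ∏ θ(y z_i^{±1})` at the node
`(α, α t, …, α t^{r-1}, β, β t, …, β t^{m-1})`. -/
noncomputable def nodeProd (p t α β y : ℂ) (r m : ℕ) : ℂ :=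
  (∏ i ∈ Finset.range r, thetaPM p y (α * t ^ i)) * ∏ i ∈ Finset.range m, thetaPM p y (β * t ^ i)

theorem nodeProd_succ_left (p t α β y : ℂ) (r m : ℕ) :
    nodeProd p t α β y (r + 1) m = thetaPM p y α * nodeProd p t (α * t) β y r m := by
  simp only [nodeProd, Finset.prod_range_succ', pow_zero, mul_one, pow_succ', ← mul_assoc]
  ring

theorem nodeProd_succ_right (p t α β y : ℂ) (r m : ℕ) :
    nodeProd p t α β y r (m + 1) = thetaPM p y β * nodeProd p t α (β * t) y r m := by
  simp only [nodeProd, Finset.prod_range_succ', pow_zero, mul_one, pow_succ', ← mul_assoc]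
  ring

/-- A linear combination of the functions `z ↦ ∏ θ(y z_i^{±1})` which vanishes at all nodes
vanishes identically. -/
theorem sum_prod_thetaPM_eq_zero (hp₁ : ‖p‖ < 1) (hp₀ : p ≠ 0) (ht : t ≠ 0) {σ : Type*}
    (s : Finset σ) {y : σ → ℂ} (hy : ∀ k ∈ s, y k ≠ 0) (n : ℕ) :
    ∀ (l : σ → ℂ) (α β : ℂ), α ≠ 0 → β ≠ 0 →
      (∀ i j, i + j < n → thetaPM p (α * t ^ i) (β * t ^ j) ≠ 0) →
      (∀ r m, r + m = n → ∑ k ∈ s, l k * nodeProd p t α β (y k) r m = 0) →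
      ∀ z : Fin n → ℂ, (∀ i, z i ≠ 0) → ∑ k ∈ s, l k * ∏ i, thetaPM p (y k) (z i) = 0 := by
  induction n with
  | zero =>
    intro l α β _ _ _ h z _
    simpa [nodeProd] using h 0 0 rfl
  | succ n ih =>
    -- The factor of z 0 is a combination of the factors at α and at β. Absorbing either of these
    -- into the coefficients leaves the statement for n, with the first point of one progression
    -- removed: α becomes αt or β becomes βt.
    intro l α β hα hβ hne h z hz
    have h1 := ih (fun k => l k * thetaPM p (y k) α) (α * t) β (mul_ne_zero hα ht) hβ
      (fun i j hij => by
        have := hne (i + 1) j (by omega)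
        rwa [pow_succ', ← mul_assoc] at this)
      (fun r m hrm => by
        have := h (r + 1) m (by omega)
        simpa only [nodeProd_succ_left, mul_assoc] using this)
      (fun i => z i.succ) fun i => hz _
    have h2 := ih (fun k => l k * thetaPM p (y k) β) α (β * t) hα (mul_ne_zero hβ ht)
      (fun i j hij => by
        have := hne i (j + 1) (by omega)
        rwa [pow_succ', ← mul_assoc β] at this)
      (fun r m hrm => by
        have := h r (m + 1) (by omega)
        simpa only [nodeProd_succ_right, mul_assoc] using this)
      (fun i => z i.succ) fun i => hz _
    have hab : thetaPM p α β ≠ 0 := by simpa using hne 0 0 (by omega)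
    calc ∑ k ∈ s, l k * ∏ i, thetaPM p (y k) (z i)
        = ∑ k ∈ s, (α / z 0 * thetaPM p (z 0) β / thetaPM p α β *
            (l k * thetaPM p (y k) α * ∏ i : Fin n, thetaPM p (y k) (z i.succ)) -
          α / z 0 * thetaPM p (z 0) α / thetaPM p α β *
            (l k * thetaPM p (y k) β * ∏ i : Fin n, thetaPM p (y k) (z i.succ))) := by
          refine Finset.sum_congr rfl fun k hk => ?_
          rw [Fin.prod_univ_succ, thetaPM_eq_interpolation hp₁ hp₀ (hy k hk) (hz 0) hα hβ hab]
          ring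
      _ = 0 := by
          rw [Finset.sum_sub_distrib, ← Finset.mul_sum, ← Finset.mul_sum, h1, h2]; simp

/-- A functional on the span of the functions `z ↦ ∏ θ(y z_i^{±1})` is a combination of the
evaluations at the nodes. -/
theorem exists_node_expansion (hp₁ : ‖p‖ < 1) (hp₀ : p ≠ 0) (ht : t ≠ 0) (hα : α ≠ 0)
    (hβ : β ≠ 0) {n : ℕ} (hne : ∀ i j, i + j < n → thetaPM p (α * t ^ i) (β * t ^ j) ≠ 0)
    {ℓ : ℂ → ℂ} (hℓ : ∀ (s : Finset {y : ℂ // y ≠ 0}) (l : {y : ℂ // y ≠ 0} → ℂ),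
      (∀ z : Fin n → ℂ, (∀ i, z i ≠ 0) → ∑ y ∈ s, l y * ∏ i, thetaPM p y (z i) = 0) →
      ∑ y ∈ s, l y * ℓ y = 0) :
    ∃ L : ℕ → ℂ, ∀ y ≠ 0, ℓ y = ∑ r ∈ Finset.range (n + 1), L r * nodeProd p t α β y r (n - r) := by
  let ev : ({y : ℂ // y ≠ 0} →₀ ℂ) →ₗ[ℂ] (Fin (n + 1) → ℂ) :=
    Finsupp.linearCombination ℂ fun y r => nodeProd p t α β y r (n - r)
  let φ : Module.Dual ℂ ({y : ℂ // y ≠ 0} →₀ ℂ) := Finsupp.linearCombination ℂ fun y => ℓ y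
  -- The functional vanishes on the kernel of the evaluation map, hence it factors through that map;
  -- the coordinates of the factor are the coefficients L.
  have hφ : φ ∈ LinearMap.range ev.dualMap := by
    rw [LinearMap.range_dualMap_eq_dualAnnihilator_ker, Submodule.mem_dualAnnihilator]
    intro f hf
    have hf' : ∀ r : Fin (n + 1), ∑ y ∈ f.support, f y * nodeProd p t α β y r (n - r) = 0 := by
      intro r
      have := congrFun (LinearMap.mem_ker.1 hf) r
      simpa [ev, Finsupp.linearCombination_apply, Finsupp.sum] using this
    have := hℓ f.support f (sum_prod_thetaPM_eq_zero hp₁ hp₀ ht _ (fun k _ => k.2) n f α β hα hβ hne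
      fun r m hrm => by
        have := hf' ⟨r, by omega⟩
        rwa [show n - r = m by omega] at this)
    simpa [φ, Finsupp.linearCombination_apply, Finsupp.sum] using this
  obtain ⟨g, hg⟩ := hφ
  refine ⟨fun r => if h : r < n + 1 then g (Pi.single ⟨r, h⟩ 1) else 0, fun y hy => ?_⟩
  have h1 := congrArg (fun ψ => ψ (Finsupp.single ⟨y, hy⟩ 1)) hg
  simp only [LinearMap.dualMap_apply, ev, φ, Finsupp.linearCombination_single, one_smul] at h1
  rw [← h1, LinearMap.pi_apply_eq_sum_univ g, Finset.sum_range]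
  refine Finset.sum_congr rfl fun r _ => ?_
  beta_reduce
  rw [dif_pos r.2, smul_eq_mul, mul_comm]
  congr 2
  ext k
  simp [Pi.single_apply, eq_comm]

end Nodes


/-! ### Shift factors at nodes, and genericity of the nodes. -/

section NodeRecursion

variable {p t α β : ℂ} {a : Fin 6 → ℂ}

/-- The node `(α, α t, …, α t^{r-1}, β, β t, …, β t^{m-1})`. -/
def node (t α β : ℂ) (r m : ℕ) : Fin r ⊕ Fin m → ℂ :=
  Sum.elim (fun i => α * t ^ (i : ℕ)) fun j => β * t ^ (j : ℕ)

/-- The shift factor at `x` with the remaining variables at a node. -/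
noncomputable def nodeFactor (p t : ℂ) (a : Fin 6 → ℂ) (α β : ℂ) (r m : ℕ) (x : ℂ) : ℂ :=
  x⁻¹ * (∏ k, theta p (a k * x)) / theta p (x ^ 2) *
    ((∏ i ∈ Finset.range r, thetaPM p (t * x) (α * t ^ i) / thetaPM p x (α * t ^ i)) *
      ∏ i ∈ Finset.range m, thetaPM p (t * x) (β * t ^ i) / thetaPM p x (β * t ^ i))

theorem shiftFactor_eq_zero_of_mem {ι : Type*} {s : Finset ι} {z : ι → ℂ} {x : ℂ} {j : ι}
    (hj : j ∈ s) (h : thetaPM p (t * x) (z j) = 0) : shiftFactor p t a s z x = 0 := by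
  rw [shiftFactor, Finset.prod_eq_zero hj (by rw [h, zero_div]), mul_zero]

theorem shiftFactor_eq_zero_of_eq_inv (hp₁ : ‖p‖ < 1) {ι : Type*} {s : Finset ι} {z : ι → ℂ}
    {m : Fin 6} (hm : a m ≠ 0) : shiftFactor p t a s z (a m)⁻¹ = 0 := by
  rw [shiftFactor, Finset.prod_eq_zero (Finset.mem_univ m)
    (by rw [mul_inv_cancel₀ hm, theta_one hp₁]), mul_zero, zero_div, zero_mul]

theorem prod_erase_inl_last {r m : ℕ} (f : Fin (r + 1) ⊕ Fin m → ℂ) :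
    ∏ j ∈ Finset.univ.erase (Sum.inl (Fin.last r)), f j =
      (∏ i : Fin r, f (Sum.inl i.castSucc)) * ∏ j : Fin m, f (Sum.inr j) := by
  rw [prod_erase_eq_prod_ite, Fintype.prod_sum_type, Fin.prod_univ_castSucc]
  simp [Fin.castSucc_ne_last]

theorem prod_erase_inr_last {r m : ℕ} (f : Fin r ⊕ Fin (m + 1) → ℂ) :
    ∏ j ∈ Finset.univ.erase (Sum.inr (Fin.last m)), f j =
      (∏ i : Fin r, f (Sum.inl i)) * ∏ j : Fin m, f (Sum.inr j.castSucc) := by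
  rw [prod_erase_eq_prod_ite, Fintype.prod_sum_type, Fin.prod_univ_castSucc]
  simp [Fin.castSucc_ne_last]

theorem thetaPM_shift_eq_zero (hp₁ : ‖p‖ < 1) (ht : t ≠ 0) (hα : α ≠ 0) (i : ℕ) :
    thetaPM p (t * (α * t ^ i)) (α * t ^ (i + 1)) = 0 := by
  have e : t * (α * t ^ i) / (α * t ^ (i + 1)) = 1 := by field_simp; ring
  rw [thetaPM, e, theta_one hp₁, mul_zero]

theorem thetaPM_shift_inv_eq_zero (hp₁ : ‖p‖ < 1) (ht : t ≠ 0) (hα : α ≠ 0) (i : ℕ) :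
    thetaPM p (t * (α * t ^ (i + 1))⁻¹) (α * t ^ i) = 0 := by
  have e : t * (α * t ^ (i + 1))⁻¹ * (α * t ^ i) = 1 := by field_simp; ring
  rw [thetaPM, e, theta_one hp₁, zero_mul]

/-- At the inverse of the first point, x = 1/α, the factor θ(a_{i₁} x) vanishes because a_{i₁} = α.
At the inverse of a later point the preceding point of the block gives the factor θ(1) = 0. -/
theorem shiftFactor_node_inv_inl (hp₁ : ‖p‖ < 1) (ht : t ≠ 0) {i₁ : Fin 6} (h₁ : a i₁ = α)
    (hα : α ≠ 0) {r m : ℕ} (i : Fin r) :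
    shiftFactor p t a (Finset.univ.erase (Sum.inl i)) (node t α β r m) (α * t ^ (i : ℕ))⁻¹ = 0 := by
  obtain ⟨i, hi⟩ := i
  rcases i with _ | i
  · simp only [pow_zero, mul_one, ← h₁]
    exact shiftFactor_eq_zero_of_eq_inv hp₁ (by rwa [h₁])
  · exact shiftFactor_eq_zero_of_mem (j := Sum.inl ⟨i, by omega⟩) (by simp)
      (thetaPM_shift_inv_eq_zero hp₁ ht hα i)

theorem shiftFactor_node_inv_inr (hp₁ : ‖p‖ < 1) (ht : t ≠ 0) {i₂ : Fin 6} (h₂ : a i₂ = β)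
    (hβ : β ≠ 0) {r m : ℕ} (i : Fin m) :
    shiftFactor p t a (Finset.univ.erase (Sum.inr i)) (node t α β r m) (β * t ^ (i : ℕ))⁻¹ = 0 := by
  obtain ⟨i, hi⟩ := i
  rcases i with _ | i
  · simp only [pow_zero, mul_one, ← h₂]
    exact shiftFactor_eq_zero_of_eq_inv hp₁ (by rwa [h₂])
  · exact shiftFactor_eq_zero_of_mem (j := Sum.inr ⟨i, by omega⟩) (by simp)
      (thetaPM_shift_inv_eq_zero hp₁ ht hβ i)

/-- At a node only the last points of the two blocks contribute to the sum of shift factors. -/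
theorem sum_shiftFactor_node (hp₁ : ‖p‖ < 1) (ht : t ≠ 0) {i₁ i₂ : Fin 6} (h₁ : a i₁ = α)
    (h₂ : a i₂ = β) (hα : α ≠ 0) (hβ : β ≠ 0) (y : ℂ) (r m : ℕ) :
    ∑ k, (shiftFactor p t a (Finset.univ.erase k) (node t α β r m) (node t α β r m k) +
        shiftFactor p t a (Finset.univ.erase k) (node t α β r m) (node t α β r m k)⁻¹) *
          ∏ j ∈ Finset.univ.erase k, thetaPM p y (node t α β r m j) =
      (if r = 0 then 0 else
        nodeFactor p t a α β (r - 1) m (α * t ^ (r - 1)) * nodeProd p t α β y (r - 1) m) +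
      if m = 0 then 0 else
        nodeFactor p t a α β r (m - 1) (β * t ^ (m - 1)) * nodeProd p t α β y r (m - 1) := by
  rw [Fintype.sum_sum_type]
  congr 1
  · rcases r with _ | r
    · simp
    · rw [Fin.sum_univ_castSucc, Finset.sum_eq_zero, zero_add, if_neg (Nat.succ_ne_zero r)]
      · have e : node t α β (r + 1) m (Sum.inl (Fin.last r)) = α * t ^ r := by simp [node]
        rw [e]
        have h0 := shiftFactor_node_inv_inl (β := β) (m := m) hp₁ ht h₁ hα (Fin.last r)
        rw [Fin.val_last] at h0
        rw [h0, add_zero, shiftFactor, nodeFactor, nodeProd, prod_erase_inl_last,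
          prod_erase_inl_last]
        simp [node, Finset.prod_range]
      · intro i _
        have e : node t α β (r + 1) m (Sum.inl i.castSucc) = α * t ^ (i : ℕ) := by simp [node]
        have h0 := shiftFactor_node_inv_inl (β := β) (m := m) hp₁ ht h₁ hα i.castSucc
        rw [Fin.val_castSucc] at h0
        -- A point that is not the last of its block is multiplied by t into its successor, which
        -- kills its shift factor.
        rw [e, h0, shiftFactor_eq_zero_of_mem (j := Sum.inl i.succ)
          (by simpa using (Fin.castSucc_lt_succ (i := i)).ne')]
        · simp
        · simpa [node] using thetaPM_shift_eq_zero hp₁ ht hα i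
  · rcases m with _ | m
    · simp
    · rw [Fin.sum_univ_castSucc, Finset.sum_eq_zero, zero_add, if_neg (Nat.succ_ne_zero m)]
      · have e : node t α β r (m + 1) (Sum.inr (Fin.last m)) = β * t ^ m := by simp [node]
        rw [e]
        have h0 := shiftFactor_node_inv_inr (α := α) (r := r) hp₁ ht h₂ hβ (Fin.last m)
        rw [Fin.val_last] at h0
        rw [h0, add_zero, shiftFactor, nodeFactor, nodeProd, prod_erase_inr_last,
          prod_erase_inr_last]
        simp [node, Finset.prod_range]
      · intro i _
        have e : node t α β r (m + 1) (Sum.inr i.castSucc) = β * t ^ (i : ℕ) := by simp [node]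
        have h0 := shiftFactor_node_inv_inr (α := α) (r := r) hp₁ ht h₂ hβ i.castSucc
        rw [Fin.val_castSucc] at h0
        rw [e, h0, shiftFactor_eq_zero_of_mem (j := Sum.inr i.succ)
          (by simpa using (Fin.castSucc_lt_succ (i := i)).ne')]
        · simp
        · simpa [node] using thetaPM_shift_eq_zero hp₁ ht hβ i

/-- Genericity of the parameters `α`, `β` of the nodes. -/
structure NodeGeneric (p t α β : ℂ) (n : ℕ) : Prop where
  left : ∀ k : ℤ, theta p (α ^ 2 * t ^ k) ≠ 0
  right : ∀ k : ℤ, theta p (β ^ 2 * t ^ k) ≠ 0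
  ratio : ∀ k : ℤ, theta p (α / β * t ^ k) ≠ 0
  prod : ∀ k : ℕ, k < n → theta p (α * β * t ^ k) ≠ 0
  pow : ∀ k : ℕ, 0 < k → k ≤ n → theta p (t ^ k) ≠ 0

theorem thetaGeneric_optionCons {ι : Type*} (hp₁ : ‖p‖ < 1) {y : ℂ} {z : ι → ℂ} (hy : y ≠ 0)
    (h1 : theta p (y ^ 2) ≠ 0) (h2 : theta p (t * y ^ 2) ≠ 0) (h3 : theta p (t / y ^ 2) ≠ 0)
    (hz : ThetaGeneric p t z) (h4 : ∀ i, theta p (y * z i) ≠ 0)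
    (h5 : ∀ i, theta p (y / z i) ≠ 0) : ThetaGeneric p t (optionCons y z) := by
  refine ⟨?_, ?_, ?_, ?_, ?_, ?_⟩
  · rintro (_ | i); exacts [hy, hz.ne_zero i]
  · rintro (_ | i); exacts [h1, hz.sq i]
  · rintro (_ | i); exacts [h2, hz.mul_sq i]
  · rintro (_ | i); exacts [h3, hz.div_sq i]
  · rintro (_ | i) (_ | j) hij
    · exact absurd rfl hij
    · exact h4 j
    · simpa only [optionCons, Option.elim, mul_comm] using h4 i
    · exact hz.mul i j fun h => hij (by rw [h])
  · rintro (_ | i) (_ | j) hij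
    · exact absurd rfl hij
    · exact h5 j
    · exact theta_div_ne_zero_comm hp₁ hy (hz.ne_zero i) (h5 i)
    · exact hz.div i j fun h => hij (by rw [h])

theorem thetaGeneric_node (hp₁ : ‖p‖ < 1) (ht : t ≠ 0) (hα : α ≠ 0) (hβ : β ≠ 0) {n : ℕ}
    (h : NodeGeneric p t α β n) {r m : ℕ} (hrm : r + m = n) :
    ThetaGeneric p t (node t α β r m) := by
  have hpow : ∀ i j : ℕ, i < j → j ≤ n → theta p (t ^ i / t ^ j) ≠ 0 := by
    intro i j hij hj
    have e : t ^ i / t ^ j = (t ^ (j - i))⁻¹ := by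
      rw [pow_sub₀ _ ht hij.le]; field_simp
    rw [e]
    exact theta_inv_ne_zero hp₁ (pow_ne_zero _ ht) (h.pow _ (by omega) (by omega))
  have hsq : ∀ γ : ℂ, γ ≠ 0 → (∀ k : ℤ, theta p (γ ^ 2 * t ^ k) ≠ 0) → ∀ i : ℕ,
      theta p ((γ * t ^ i) ^ 2) ≠ 0 ∧ theta p (t * (γ * t ^ i) ^ 2) ≠ 0 ∧
      theta p (t / (γ * t ^ i) ^ 2) ≠ 0 ∧ ∀ j : ℕ, theta p (γ * t ^ i * (γ * t ^ j)) ≠ 0 := by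
    intro γ hγ hk i
    refine ⟨?_, ?_, ?_, fun j => ?_⟩
    · convert hk (2 * i) using 2; rw [zpow_mul', zpow_natCast]; norm_cast; ring
    · convert hk (2 * i + 1) using 2
      rw [zpow_add₀ ht, zpow_mul', zpow_natCast]; norm_cast; ring
    · convert theta_inv_ne_zero hp₁ (mul_ne_zero (pow_ne_zero 2 hγ) (zpow_ne_zero _ ht))
        (hk (2 * i - 1)) using 2
      rw [zpow_sub₀ ht, zpow_mul', zpow_natCast]; norm_cast; field_simp
    · convert hk (i + j) using 2
      rw [zpow_add₀ ht]; norm_cast; ring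
  refine ⟨?_, ?_, ?_, ?_, ?_, ?_⟩
  · rintro (i | i) <;> simp [node, hα, hβ, ht]
  · rintro (i | i)
    exacts [(hsq α hα h.left i).1, (hsq β hβ h.right i).1]
  · rintro (i | i)
    exacts [(hsq α hα h.left i).2.1, (hsq β hβ h.right i).2.1]
  · rintro (i | i)
    exacts [(hsq α hα h.left i).2.2.1, (hsq β hβ h.right i).2.2.1]
  · have key : ∀ (i : Fin r) (j : Fin m),
        theta p (α * t ^ (i : ℕ) * (β * t ^ (j : ℕ))) ≠ 0 := by
      intro i j
      convert h.prod (i + j) (by omega) using 2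
      ring
    rintro (i | i) (j | j) hij
    · exact (hsq α hα h.left i).2.2.2 j
    · exact key i j
    · simpa only [node, Sum.elim_inl, Sum.elim_inr, mul_comm] using key j i
    · exact (hsq β hβ h.right i).2.2.2 j
  · have key : ∀ (i : Fin r) (j : Fin m),
        theta p (α * t ^ (i : ℕ) / (β * t ^ (j : ℕ))) ≠ 0 := by
      intro i j
      convert h.ratio (i - j) using 2
      rw [zpow_sub₀ ht]; norm_cast; field_simp
    have key2 : ∀ γ : ℂ, γ ≠ 0 → ∀ i j : ℕ, i ≠ j → i ≤ n → j ≤ n →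
        theta p (γ * t ^ i / (γ * t ^ j)) ≠ 0 := by
      intro γ hγ i j hij hi hj
      rw [mul_div_mul_left _ _ hγ]
      rcases hij.lt_or_gt with h' | h'
      · exact hpow i j h' hj
      · exact theta_div_ne_zero_comm hp₁ (pow_ne_zero _ ht) (pow_ne_zero _ ht) (hpow j i h' hi)
    rintro (i | i) (j | j) hij
    · exact key2 α hα i j (fun h => hij (by rw [Fin.ext h])) (by omega) (by omega)
    · exact key i j
    · exact theta_div_ne_zero_comm hp₁ (mul_ne_zero hα (pow_ne_zero _ ht))
        (mul_ne_zero hβ (pow_ne_zero _ ht)) (key j i)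
    · exact key2 β hβ i j (fun h => hij (by rw [Fin.ext h])) (by omega) (by omega)

theorem countable_zpow_eq {k : ℤ} (hk : k ≠ 0) (w : ℂ) : {y : ℂ | y ^ k = w}.Countable := by
  rcases Int.natAbs_eq k with h | h
  · have h0 : 0 < k.natAbs := by omega
    refine (Set.Finite.subset (Polynomial.nthRoots k.natAbs w).toFinset.finite_toSet ?_).countable
    intro y hy
    rw [Set.mem_ofPred_eq, h, zpow_natCast] at hy
    simpa [Polynomial.mem_nthRoots h0] using hy
  · have h0 : 0 < k.natAbs := by omega
    refine (Set.Finite.subset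
      (Polynomial.nthRoots k.natAbs w⁻¹).toFinset.finite_toSet ?_).countable
    intro y hy
    rw [Set.mem_ofPred_eq, h, zpow_neg, zpow_natCast] at hy
    simp [Polynomial.mem_nthRoots h0, ← hy]

/-- The zeros of θ are the powers of p, and each gives finitely many y. All exceptional sets below
are countable unions of such sets, so genericity can be removed by continuity. -/
theorem countable_theta_zpow_eq_zero (hp₁ : ‖p‖ < 1) (hp₀ : p ≠ 0) {c : ℂ} (hc : c ≠ 0) {k : ℤ}
    (hk : k ≠ 0) : {y : ℂ | y ≠ 0 ∧ theta p (c * y ^ k) = 0}.Countable := by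
  refine (Set.countable_iUnion fun j : ℤ => countable_zpow_eq hk (p ^ j / c)).mono ?_
  rintro y ⟨hy0, hy⟩
  obtain ⟨j, hj⟩ := (theta_eq_zero_iff hp₁ hp₀ (mul_ne_zero hc (zpow_ne_zero k hy0))).1 hy
  exact Set.mem_iUnion.2 ⟨j, by rw [Set.mem_ofPred_eq, ← hj]; field_simp⟩

end NodeRecursion


/-! ### The two-term recursion for the node coefficients. -/

section Recursion

theorem eq_zero_of_eventually_of_countable {f : ℂ → ℂ} {C : Set ℂ} {y₀ : ℂ}
    (hf : ContinuousAt f y₀) (hC : C.Countable) (h : ∀ᶠ y in 𝓝 y₀, y ∉ C → f y = 0) :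
    f y₀ = 0 := by
  by_contra hne
  obtain ⟨y, hy, hyC⟩ := (hC.dense_compl ℂ).inter_nhds_nonempty (x := y₀)
    (h.and (hf.eventually_ne hne))
  exact hyC.2 (hyC.1 hy)

variable {p t α β : ℂ} {a : Fin 6 → ℂ}

theorem prod_thetaPM_node (p t α β y : ℂ) (r m : ℕ) :
    ∏ j, thetaPM p y (node t α β r m j) = nodeProd p t α β y r m := by
  simp [Fintype.prod_sum_type, node, nodeProd, Finset.prod_range]

theorem continuousAt_nodeProd (hp₁ : ‖p‖ < 1) (ht : t ≠ 0) (hα : α ≠ 0) (hβ : β ≠ 0) {y : ℂ}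
    (hy : y ≠ 0) (r m : ℕ) : ContinuousAt (fun y => nodeProd p t α β y r m) y := by
  have h : ∀ z ≠ 0, ContinuousAt (fun y => thetaPM p y z) y := fun z hz =>
    (differentiableAt_thetaPM hp₁ hy hz).continuousAt
  exact (tendsto_finsetProd _ fun i _ => h _ (mul_ne_zero hα (pow_ne_zero i ht))).mul
    (tendsto_finsetProd _ fun i _ => h _ (mul_ne_zero hβ (pow_ne_zero i ht)))

/-- The functions `y ↦ nodeProd y s (n - 1 - s)` are linearly independent. -/
theorem nodeProd_linearIndependent (hp₁ : ‖p‖ < 1) (ht : t ≠ 0) (hα : α ≠ 0) (hβ : β ≠ 0)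
    {n : ℕ} (h : NodeGeneric p t α β n) {X : ℕ → ℂ}
    (hX : ∀ k < n, ∑ s ∈ Finset.range n, nodeProd p t α β (α * t ^ k) s (n - 1 - s) * X s = 0) :
    ∀ k < n, X k = 0 := by
  intro k
  induction k using Nat.strong_induction_on with
  | _ k ih =>
    intro hk
    have h1 := hX k hk
    have hαk : α * t ^ k ≠ 0 := mul_ne_zero hα (pow_ne_zero _ ht)
    -- The system is triangular: at y = α t^k every term with s > k contains θ(1) = 0, those with s
    -- < k vanish by induction, and the diagonal entry is nonzero by genericity.
    rw [Finset.sum_eq_single k] at h1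
    · refine (mul_eq_zero.1 h1).resolve_left ?_
      refine mul_ne_zero (Finset.prod_ne_zero_iff.2 fun i hi => ?_)
        (Finset.prod_ne_zero_iff.2 fun i hi => ?_)
      · have hi := Finset.mem_range.1 hi
        refine mul_ne_zero ?_ ?_
        · convert h.left (k + i) using 2
          rw [zpow_add₀ ht]; norm_cast; ring
        · convert h.pow (k - i) (by omega) (by omega) using 2
          rw [pow_sub₀ _ ht hi.le]; field_simp
      · have hi := Finset.mem_range.1 hi
        refine mul_ne_zero ?_ ?_
        · convert h.prod (k + i) (by omega) using 2
          ring
        · convert h.ratio (k - i) using 2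
          rw [zpow_sub₀ ht]; norm_cast; field_simp
    · intro s hs hsk
      have hs := Finset.mem_range.1 hs
      rcases hsk.lt_or_gt with hlt | hlt
      · rw [ih s hlt hs, mul_zero]
      · rw [nodeProd, Finset.prod_eq_zero (Finset.mem_range.2 hlt) (thetaPM_self hp₁ hαk)]
        simp
    · intro hk'
      exact absurd (Finset.mem_range.2 hk) hk'

/-- The node expansion of ℓ is inserted into the difference equation. At each node the kernel
identity turns the difference operator into at most two products with one variable fewer, and linear
independence of these products in y isolates each coefficient. The hypothesis on A₁, A₂ and B only
asks that one triple serve both statements; their values play no role. -/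
theorem node_recursion (hp₁ : ‖p‖ < 1) (hp₀ : p ≠ 0) (ht : t ≠ 0) {i₁ i₂ : Fin 6}
    (h₁ : a i₁ = α) (h₂ : a i₂ = β) (hα : α ≠ 0) (hβ : β ≠ 0) {n : ℕ} (hn : 0 < n)
    (hgen : NodeGeneric p t α β n) (hann : ∀ k < n, ‖p‖ < ‖α * t ^ k‖ ∧ ‖α * t ^ k‖ < 1)
    {ℓ : ℂ → ℂ} {L : ℕ → ℂ}
    (hL : ∀ y ≠ 0, ℓ y = ∑ r ∈ Finset.range (n + 1), L r * nodeProd p t α β y r (n - r))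
    (hdiff : ∀ y, ‖p‖ < ‖y‖ → ‖y‖ < 1 → theta p (y ^ 2) ≠ 0 → theta p (t * y ^ 2) ≠ 0 →
      theta p (t / y ^ 2) ≠ 0 → ∃ A₁ A₂ B : ℂ, A₁ * ℓ (t * y) + A₂ * ℓ (t / y) + B * ℓ y = 0 ∧
        ∀ (ι : Type) [Fintype ι] [DecidableEq ι] (z : ι → ℂ), Fintype.card ι = n →
          ThetaGeneric p t (optionCons y z) →
          theta p t * y * ∑ k, (shiftFactor p t a (Finset.univ.erase k) z (z k)
            + shiftFactor p t a (Finset.univ.erase k) z (z k)⁻¹) *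
              ∏ j ∈ Finset.univ.erase k, thetaPM p y (z j) =
          A₁ * ∏ j, thetaPM p (t * y) (z j) + A₂ * ∏ j, thetaPM p (t / y) (z j) +
            B * ∏ j, thetaPM p y (z j)) :
    ∀ s < n, L (s + 1) * nodeFactor p t a α β s (n - 1 - s) (α * t ^ s) +
      L s * nodeFactor p t a α β s (n - 1 - s) (β * t ^ (n - 1 - s)) = 0 := by
  have hαt : ∀ k : ℕ, α * t ^ k ≠ 0 := fun k => mul_ne_zero hα (pow_ne_zero _ ht)
  have hβt : ∀ k : ℕ, β * t ^ k ≠ 0 := fun k => mul_ne_zero hβ (pow_ne_zero _ ht)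
  have hnode : ∀ r m (i : Fin r ⊕ Fin m), ∃ γ, (node t α β r m i = γ ∧ γ ≠ 0) ∧
      ((∃ k : ℕ, γ = α * t ^ k) ∨ ∃ k : ℕ, γ = β * t ^ k) := by
    rintro r m (i | i)
    · exact ⟨_, ⟨rfl, hαt i⟩, Or.inl ⟨i, rfl⟩⟩
    · exact ⟨_, ⟨rfl, hβt i⟩, Or.inr ⟨i, rfl⟩⟩
  let f : ℂ → ℂ := fun y => ∑ s ∈ Finset.range n, nodeProd p t α β y s (n - 1 - s) *
    (L (s + 1) * nodeFactor p t a α β s (n - 1 - s) (α * t ^ s) +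
      L s * nodeFactor p t a α β s (n - 1 - s) (β * t ^ (n - 1 - s)))
  let bad : ℂ → ℤ → Set ℂ := fun c k => {y | y ≠ 0 ∧ theta p (c * y ^ k) = 0}
  -- The excluded y are those for which y together with a node fails to be generic.
  let C : Set ℂ := (bad 1 2 ∪ bad t 2 ∪ bad t (-2)) ∪ ((⋃ k : ℕ, bad (α * t ^ k) 1) ∪
    (⋃ k : ℕ, bad (β * t ^ k) 1) ∪ (⋃ k : ℕ, bad (α * t ^ k)⁻¹ 1) ∪
    (⋃ k : ℕ, bad (β * t ^ k)⁻¹ 1))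
  have hC : C.Countable := by
    have hb : ∀ c ≠ 0, ∀ k ≠ 0, (bad c k).Countable := fun c hc k hk =>
      countable_theta_zpow_eq_zero hp₁ hp₀ hc hk
    refine (((hb 1 one_ne_zero 2 (by norm_num)).union (hb t ht 2 (by norm_num))).union
      (hb t ht (-2) (by norm_num))).union ((((?_ : Set.Countable _).union ?_).union ?_).union ?_)
    · exact Set.countable_iUnion fun k => hb _ (hαt k) 1 one_ne_zero
    · exact Set.countable_iUnion fun k => hb _ (hβt k) 1 one_ne_zero
    · exact Set.countable_iUnion fun k => hb _ (inv_ne_zero (hαt k)) 1 one_ne_zero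
    · exact Set.countable_iUnion fun k => hb _ (inv_ne_zero (hβt k)) 1 one_ne_zero
  have hf0 : ∀ y, ‖p‖ < ‖y‖ → ‖y‖ < 1 → y ∉ C → f y = 0 := by
    intro y hy1 hy2 hyC
    have hy : y ≠ 0 := norm_pos_iff.1 ((norm_nonneg p).trans_lt hy1)
    simp only [C, bad, Set.mem_union, Set.mem_iUnion, Set.mem_ofPred_eq, not_or, not_exists,
      not_and, one_mul, zpow_one, zpow_neg, ← div_eq_mul_inv] at hyC
    obtain ⟨⟨⟨g1, g2⟩, g3⟩, ⟨⟨⟨g4, g5⟩, g6⟩, g7⟩⟩ := hyC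
    have g1 : theta p (y ^ 2) ≠ 0 := by exact_mod_cast g1 hy
    have g2 : theta p (t * y ^ 2) ≠ 0 := by exact_mod_cast g2 hy
    have g3 : theta p (t / y ^ 2) ≠ 0 := by exact_mod_cast g3 hy
    obtain ⟨A₁, A₂, B, hrel, hid⟩ := hdiff y hy1 hy2 g1 g2 g3
    have hTy : theta p t * y ≠ 0 :=
      mul_ne_zero (by simpa using hgen.pow 1 one_pos hn) hy
    have hnodes : ∀ r ∈ Finset.range (n + 1), A₁ * nodeProd p t α β (t * y) r (n - r) +
        A₂ * nodeProd p t α β (t / y) r (n - r) + B * nodeProd p t α β y r (n - r) =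
        theta p t * y * ((if r = 0 then 0 else
        nodeFactor p t a α β (r - 1) (n - r) (α * t ^ (r - 1)) * nodeProd p t α β y (r - 1) (n - r))
        + if n - r = 0 then 0 else nodeFactor p t a α β r (n - r - 1) (β * t ^ (n - r - 1)) *
          nodeProd p t α β y r (n - r - 1)) := by
      intro r hr
      have hr := Finset.mem_range.1 hr
      rw [← sum_shiftFactor_node hp₁ ht h₁ h₂ hα hβ, hid _ _ (by simp; omega),
        prod_thetaPM_node, prod_thetaPM_node, prod_thetaPM_node]
      refine thetaGeneric_optionCons hp₁ hy g1 g2 g3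
        (thetaGeneric_node hp₁ ht hα hβ hgen (by omega)) ?_ ?_
      · intro i
        obtain ⟨γ, ⟨hγ, -⟩, ⟨k, rfl⟩ | ⟨k, rfl⟩⟩ := hnode r (n - r) i
        · rw [hγ, mul_comm]; exact g4 k hy
        · rw [hγ, mul_comm]; exact g5 k hy
      · intro i
        obtain ⟨γ, ⟨hγ, -⟩, ⟨k, rfl⟩ | ⟨k, rfl⟩⟩ := hnode r (n - r) i
        · rw [hγ, div_eq_inv_mul]; exact g6 k hy
        · rw [hγ, div_eq_inv_mul]; exact g7 k hy
    rw [hL _ (mul_ne_zero ht hy), hL _ (div_ne_zero ht hy), hL _ hy, Finset.mul_sum,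
      Finset.mul_sum, Finset.mul_sum, ← Finset.sum_add_distrib, ← Finset.sum_add_distrib] at hrel
    have hrel2 : theta p t * y * ∑ r ∈ Finset.range (n + 1), L r * ((if r = 0 then 0 else
        nodeFactor p t a α β (r - 1) (n - r) (α * t ^ (r - 1)) * nodeProd p t α β y (r - 1) (n - r))
        + if n - r = 0 then 0 else nodeFactor p t a α β r (n - r - 1) (β * t ^ (n - r - 1)) *
          nodeProd p t α β y r (n - r - 1)) = 0 := by
      refine Eq.trans ?_ hrel
      rw [Finset.mul_sum]
      refine Finset.sum_congr rfl fun r hr => ?_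
      linear_combination -L r * hnodes r hr
    have hrel3 := (mul_eq_zero.1 hrel2).resolve_left hTy
    simp only [mul_add, Finset.sum_add_distrib] at hrel3
    -- The product of type (s, n - 1 - s) arises from r = s + 1 by dropping the last point of the
    -- first block and from r = s by dropping the last point of the second. The first part has no
    -- term at r = 0 and the second none at r = n, so both sums run over s < n.
    rw [Finset.sum_range_succ', Finset.sum_range_succ (fun r => L r * if n - r = 0 then _ else _)]
      at hrel3
    simp only [if_true, mul_zero, add_zero, Nat.sub_self, Nat.succ_ne_zero, if_false,
      Nat.add_sub_cancel, ← Finset.sum_add_distrib] at hrel3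
    simp only [f]
    rw [← hrel3]
    refine Finset.sum_congr rfl fun s hs => ?_
    have hs := Finset.mem_range.1 hs
    rw [if_neg (by omega), show n - (s + 1) = n - 1 - s by omega, show n - s - 1 = n - 1 - s by omega]
    ring
  have hf : ∀ y, ‖p‖ < ‖y‖ → ‖y‖ < 1 → f y = 0 := by
    intro y hy1 hy2
    have hy : y ≠ 0 := norm_pos_iff.1 ((norm_nonneg p).trans_lt hy1)
    refine eq_zero_of_eventually_of_countable ?_ hC ?_
    · exact tendsto_finsetSum _ fun s _ =>
        (continuousAt_nodeProd hp₁ ht hα hβ hy s _).mul continuousAt_const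
    · have h1 : ∀ᶠ x in 𝓝 y, ‖p‖ < ‖x‖ := continuous_norm.continuousAt.eventually_const_lt hy1
      have h2 : ∀ᶠ x in 𝓝 y, ‖x‖ < 1 := continuous_norm.continuousAt.eventually_lt_const hy2
      filter_upwards [h1, h2] with x hx1 hx2 using hf0 x hx1 hx2
  -- Independence is tested at y = α t^k, which must lie in the annulus where the difference
  -- equation is available.
  exact nodeProd_linearIndependent hp₁ ht hα hβ hgen fun k hk => hf _ (hann k hk).1 (hann k hk).2

end Recursion


/-! ### Solving the recursion by telescoping. -/

section Ratio

variable {p t α β : ℂ} {a : Fin 6 → ℂ}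

theorem prod_range_succ_div (f : ℕ → ℂ) (n : ℕ) (h : ∀ i ≤ n, f i ≠ 0) :
    ∏ i ∈ Finset.range n, f (i + 1) / f i = f n / f 0 := by
  induction n with
  | zero => simp [h 0 le_rfl]
  | succ n ih =>
    rw [Finset.prod_range_succ, ih fun i hi => h i (by omega)]
    have := h n (by omega)
    field_simp

theorem prod_range_div_succ (f : ℕ → ℂ) (n : ℕ) (h : ∀ i ≤ n, f i ≠ 0) :
    ∏ i ∈ Finset.range n, f i / f (i + 1) = f 0 / f n := by
  rw [← inv_div (f n), ← prod_range_succ_div f n h, ← Finset.prod_inv_distrib]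
  exact Finset.prod_congr rfl fun i _ => (inv_div _ _).symm

/-- In step j the numerator θ(t x γ t^j) is the next denominator θ(x γ t^{j+1}), and the factors
with x/γ telescope in the opposite direction. -/
theorem prod_thetaPM_shift_div (ht : t ≠ 0) {x γ : ℂ} (hγ : γ ≠ 0) (m : ℕ)
    (h1 : ∀ j ≤ m, theta p (x * γ * t ^ j) ≠ 0)
    (h2 : ∀ j ≤ m, theta p (x / γ * t ^ (1 - (j : ℤ))) ≠ 0) :
    ∏ j ∈ Finset.range m, thetaPM p (t * x) (γ * t ^ j) / thetaPM p x (γ * t ^ j) =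
      theta p (x * γ * t ^ m) / theta p (x * γ) *
        (theta p (x / γ * t) / theta p (x / γ * t ^ (1 - (m : ℤ)))) := by
  have e1 := prod_range_succ_div (fun j => theta p (x * γ * t ^ j)) m h1
  have e2 := prod_range_div_succ (fun j => theta p (x / γ * t ^ (1 - (j : ℤ)))) m h2
  simp only [pow_zero, mul_one, Nat.cast_zero, sub_zero, zpow_one] at e1 e2
  rw [← e1, ← e2, ← Finset.prod_mul_distrib]
  refine Finset.prod_congr rfl fun j _ => ?_
  have f1 : t * x * (γ * t ^ j) = x * γ * t ^ (j + 1) := by ring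
  have f2 : t * x / (γ * t ^ j) = x / γ * t ^ (1 - (j : ℤ)) := by
    rw [zpow_sub₀ ht]; norm_cast; field_simp
  have f3 : x / (γ * t ^ j) = x / γ * t ^ (1 - ((j + 1 : ℕ) : ℤ)) := by
    rw [show 1 - ((j + 1 : ℕ) : ℤ) = -(j : ℤ) by push_cast; ring, zpow_neg]; norm_cast; field_simp
  rw [thetaPM, thetaPM, f1, f2, f3, ← mul_assoc x γ, mul_div_mul_comm]

theorem NodeGeneric.symm (hp₁ : ‖p‖ < 1) (ht : t ≠ 0) (hα : α ≠ 0) (hβ : β ≠ 0) {n : ℕ}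
    (h : NodeGeneric p t α β n) : NodeGeneric p t β α n := by
  refine ⟨h.right, h.left, fun k => ?_, fun k hk => ?_, h.pow⟩
  · have := theta_inv_ne_zero hp₁ (mul_ne_zero (div_ne_zero hα hβ) (zpow_ne_zero _ ht))
      (h.ratio (-k))
    convert this using 2
    rw [zpow_neg]; field_simp
  · rw [mul_comm β]; exact h.prod k hk

theorem nodeFactor_comm (p t : ℂ) (a : Fin 6 → ℂ) (α β : ℂ) (r m : ℕ) (x : ℂ) :
    nodeFactor p t a α β r m x = nodeFactor p t a β α m r x := by
  rw [nodeFactor, nodeFactor, mul_comm (∏ i ∈ Finset.range r, _)]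

/-- Both blocks telescope. The first cancels θ(αx) against θ(x²) up to a quotient of thetas at
powers of t, and the second cancels θ(βx). Only the four parameters other than α and β remain in the
product. -/
theorem nodeFactor_eq (ht : t ≠ 0) {i₁ i₂ : Fin 6} (h₁₂ : i₁ ≠ i₂) (h₁ : a i₁ = α)
    (h₂ : a i₂ = β) (hα : α ≠ 0) (hβ : β ≠ 0) {n : ℕ} (hgen : NodeGeneric p t α β n) {s m : ℕ}
    (hsm : s + m + 1 = n) :
    nodeFactor p t a α β s m (α * t ^ s) = (α * t ^ s)⁻¹ *
      (∏ k ∈ (Finset.univ.erase i₁).erase i₂, theta p (a k * (α * t ^ s))) *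
      (theta p (t ^ (s + 1)) / theta p t) * theta p (α * β * t ^ (n - 1)) *
      (theta p (α / β * t ^ ((s : ℤ) + 1)) / theta p (α / β * t ^ ((s : ℤ) + 1 - m))) := by
  have hl : ∀ k : ℕ, theta p (α ^ 2 * t ^ k) ≠ 0 := fun k => by exact_mod_cast hgen.left k
  have e1 : ∀ j : ℕ, α * t ^ s * α * t ^ j = α ^ 2 * t ^ (s + j) := fun j => by ring
  have e2 : ∀ j : ℤ, α * t ^ s / α * t ^ j = t ^ ((s : ℤ) + j) := fun j => by
    rw [zpow_add₀ ht]; norm_cast; field_simp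
  have e3 : ∀ j : ℕ, α * t ^ s * β * t ^ j = α * β * t ^ (s + j) := fun j => by ring
  have e4 : ∀ j : ℤ, α * t ^ s / β * t ^ j = α / β * t ^ ((s : ℤ) + j) := fun j => by
    rw [zpow_add₀ ht]; norm_cast; field_simp
  have b1 := prod_thetaPM_shift_div (p := p) ht (x := α * t ^ s) hα s
    (fun j _ => by rw [e1]; exact hl _)
    (fun j hj => by
      rw [e2, show (s : ℤ) + (1 - j) = ((s + 1 - j : ℕ) : ℤ) by omega, zpow_natCast]
      exact hgen.pow _ (by omega) (by omega))
  have b2 := prod_thetaPM_shift_div (p := p) ht (x := α * t ^ s) hβ m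
    (fun j _ => by rw [e3]; exact hgen.prod _ (by omega))
    (fun j hj => by rw [e4]; exact hgen.ratio _)
  have c1 : α * t ^ s * α = α ^ 2 * t ^ s := by ring
  have c2 : α * t ^ s / α * t = t ^ (s + 1) := by field_simp; ring
  have c3 : α * t ^ s * β = α * β * t ^ s := by ring
  have c4 : α * t ^ s / β * t = α / β * t ^ ((s : ℤ) + 1) := by
    rw [zpow_add₀ ht]; norm_cast; field_simp
  rw [e1, e2, c1, c2, show (s : ℤ) + (1 - s) = 1 by ring, zpow_one] at b1
  rw [e3, e4, c3, c4, show (s : ℤ) + (1 - m) = s + 1 - m by ring, show s + m = n - 1 by omega] at b2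
  rw [nodeFactor, b1, b2, ← Finset.mul_prod_erase _ _ (Finset.mem_univ i₁),
    ← Finset.mul_prod_erase _ _ (Finset.mem_erase.2 ⟨h₁₂.symm, Finset.mem_univ i₂⟩), h₁, h₂,
    show α * (α * t ^ s) = α ^ 2 * t ^ s by ring, show β * (α * t ^ s) = α * β * t ^ s by ring,
    show (α * t ^ s) ^ 2 = α ^ 2 * t ^ (s + s) by ring]
  have d1 := hl s
  have d2 := hl (s + s)
  have d3 := hgen.prod s (by omega)
  generalize ∏ k ∈ (Finset.univ.erase i₁).erase i₂, theta p (a k * (α * t ^ s)) = S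
  generalize theta p (α * β * t ^ s) = Q at *
  generalize theta p (α ^ 2 * t ^ s) = Q1 at *
  generalize theta p (α ^ 2 * t ^ (s + s)) = Q2 at *
  field_simp

/-- Multiplying the recursion over all s links the pure α node, with coefficient L n, to the pure β
node, with coefficient L 0. The thetas at powers of t occur on both sides, and those at (α/β) t^k
cancel after the normalizing values of `nodeProd` are included, so only the thetas of the other four
parameters are left. -/
theorem node_ratio (hp₁ : ‖p‖ < 1) (ht : t ≠ 0) {i₁ i₂ : Fin 6} (h₁₂ : i₁ ≠ i₂) (h₁ : a i₁ = α)
    (h₂ : a i₂ = β) (hα : α ≠ 0) (hβ : β ≠ 0) {n : ℕ} (hgen : NodeGeneric p t α β n)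
    {L : ℕ → ℂ}
    (hL : ∀ s < n, L (s + 1) * nodeFactor p t a α β s (n - 1 - s) (α * t ^ s) +
      L s * nodeFactor p t a α β s (n - 1 - s) (β * t ^ (n - 1 - s)) = 0) :
    L n * nodeProd p t α β β n 0 *
        ∏ s ∈ Finset.range n, ∏ k ∈ (Finset.univ.erase i₁).erase i₂, theta p (a k * (α * t ^ s)) =
      L 0 * nodeProd p t α β α 0 n *
        ∏ s ∈ Finset.range n, ∏ k ∈ (Finset.univ.erase i₁).erase i₂,
          theta p (a k * (β * t ^ s)) := by
  set A : ℕ → ℂ := fun s => ∏ k ∈ (Finset.univ.erase i₁).erase i₂, theta p (a k * (α * t ^ s))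
    with hA
  set B : ℕ → ℂ := fun s => ∏ k ∈ (Finset.univ.erase i₁).erase i₂, theta p (a k * (β * t ^ s))
    with hB
  set T : ℤ → ℂ := fun k => theta p (α / β * t ^ k) with hT
  have hT0 : ∀ k, T k ≠ 0 := hgen.ratio
  have hαt : ∀ k : ℕ, α * t ^ k ≠ 0 := fun k => mul_ne_zero hα (pow_ne_zero _ ht)
  have hβt : ∀ k : ℕ, β * t ^ k ≠ 0 := fun k => mul_ne_zero hβ (pow_ne_zero _ ht)
  have hinv : ∀ k : ℤ, theta p (β / α * t ^ k) = -T (-k) / (α / β * t ^ (-k)) := by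
    intro k
    have := theta_inv hp₁ (mul_ne_zero (div_ne_zero hα hβ) (zpow_ne_zero (-k) ht))
    rw [hT, ← this]
    congr 1
    rw [zpow_neg]; field_simp
  set X : ℕ → ℂ := fun s => A s * theta p (t ^ (s + 1)) * T (s + 1) /
    (α * t ^ s * T (2 * ((s + 1 : ℕ) : ℤ) - n)) with hX
  set Y : ℕ → ℂ := fun s => -(B (n - 1 - s) * theta p (t ^ (n - 1 - s + 1)) *
    T (-((n - 1 - s : ℕ) + 1)) * t ^ s) / (β * t ^ (n - 1 - s) * T (2 * s - n)) with hY
  have hXY : ∀ s < n, L (s + 1) * X s = L s * Y s := by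
    intro s hs
    have e := hL s hs
    obtain ⟨m, hm⟩ : ∃ m, n = s + m + 1 := ⟨n - 1 - s, by omega⟩
    have hm' : n - 1 - s = m := by omega
    rw [hm', nodeFactor_eq ht h₁₂ h₁ h₂ hα hβ hgen hm.symm, nodeFactor_comm,
      nodeFactor_eq ht h₁₂.symm h₂ h₁ hβ hα (hgen.symm hp₁ ht hα hβ)
      (by omega : m + s + 1 = n), Finset.erase_right_comm (a := i₂) (b := i₁), hinv, hinv] at e
    have q1 : theta p t ≠ 0 := by simpa using hgen.pow 1 one_pos (by omega)
    have q2 : theta p (α * β * t ^ (n - 1)) ≠ 0 := hgen.prod _ (by omega)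
    have q3 : (s : ℤ) + 1 - m = 2 * ((s + 1 : ℕ) : ℤ) - n := by omega
    have q4 : -((m : ℤ) + 1 - s) = 2 * s - n := by omega
    have q5 : t ^ (-((m : ℤ) + 1)) = t ^ (2 * (s : ℤ) - n) / t ^ s := by
      rw [← zpow_natCast, ← zpow_sub₀ ht]; congr 1; omega
    have r1 := hT0 (2 * ((s + 1 : ℕ) : ℤ) - n)
    have r2 := hT0 (2 * (s : ℤ) - n)
    have r3 := hαt s
    have r4 := hβt m
    have r5 : t ^ (2 * (s : ℤ) - n) ≠ 0 := zpow_ne_zero _ ht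
    rw [q3, q4, q5, mul_comm β α] at e
    change L (s + 1) * ((α * t ^ s)⁻¹ * A s * (theta p (t ^ (s + 1)) / theta p t) *
      theta p (α * β * t ^ (n - 1)) * (T (s + 1) / T (2 * ((s + 1 : ℕ) : ℤ) - n))) +
      L s * ((β * t ^ m)⁻¹ * B m * (theta p (t ^ (m + 1)) / theta p t) *
      theta p (α * β * t ^ (n - 1)) * _) = 0 at e
    simp only [hX, hY, hm']
    generalize t ^ (2 * (s : ℤ) - n) = u at *
    generalize T (2 * ((s + 1 : ℕ) : ℤ) - n) = T1 at *
    generalize T (2 * (s : ℤ) - n) = T2 at *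
    generalize theta p (α * β * t ^ (n - 1)) = Q at *
    generalize theta p t = E at *
    generalize T (-((m : ℤ) + 1)) = T3 at *
    generalize T ((s : ℤ) + 1) = T4 at *
    field_simp at e ⊢
    have e' := (mul_eq_zero.1 (by simpa using e)).resolve_left q2
    linear_combination e'
  have hprod : ∀ k ≤ n, L k * ∏ s ∈ Finset.range k, X s = L 0 * ∏ s ∈ Finset.range k, Y s := by
    intro k
    induction k with
    | zero => simp
    | succ k ih =>
      intro hk
      rw [Finset.prod_range_succ, Finset.prod_range_succ]
      linear_combination Y k * ih (by omega) + (∏ s ∈ Finset.range k, X s) * hXY k (by omega)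
  have hfin := hprod n le_rfl
  -- In Y the second progression is traversed backwards; reflecting s to n - 1 - s makes its factors
  -- comparable with those of X.
  have hPY : ∏ s ∈ Finset.range n, Y s = (-1) ^ n * (∏ s ∈ Finset.range n, B s) *
      (∏ s ∈ Finset.range n, theta p (t ^ (s + 1))) * (∏ s ∈ Finset.range n, T (-(s + 1))) *
      (∏ s ∈ Finset.range n, t ^ s) / ((∏ s ∈ Finset.range n, β * t ^ s) *
        ∏ s ∈ Finset.range n, T (2 * s - n)) := by
    rw [← Finset.prod_range_reflect B, ← Finset.prod_range_reflect (fun s => theta p (t ^ (s + 1))),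
      ← Finset.prod_range_reflect (fun s : ℕ => T (-(s + 1))),
      ← Finset.prod_range_reflect (fun s => β * t ^ s)]
    have : ((-1 : ℂ)) ^ n = ∏ s ∈ Finset.range n, (-1 : ℂ) := by simp
    rw [this]
    simp only [← Finset.prod_mul_distrib, ← Finset.prod_div_distrib]
    refine Finset.prod_congr rfl fun s _ => ?_
    simp only [hY]
    ring
  have hPX : ∏ s ∈ Finset.range n, X s = (∏ s ∈ Finset.range n, A s) *
      (∏ s ∈ Finset.range n, theta p (t ^ (s + 1))) * (∏ s ∈ Finset.range n, T (s + 1)) /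
      ((∏ s ∈ Finset.range n, α * t ^ s) *
        ∏ s ∈ Finset.range n, T (2 * ((s + 1 : ℕ) : ℤ) - n)) := by
    simp only [hX, Finset.prod_mul_distrib, Finset.prod_div_distrib]
  have hNβ : nodeProd p t α β β n 0 = (-1) ^ n * (∏ s ∈ Finset.range n, theta p (α * β * t ^ s)) *
      (∏ s ∈ Finset.range n, T s) / ((α / β) ^ n * ∏ s ∈ Finset.range n, t ^ s) := by
    have c1 : ((-1 : ℂ)) ^ n = ∏ s ∈ Finset.range n, (-1 : ℂ) := by simp
    have c2 : (α / β) ^ n = ∏ s ∈ Finset.range n, α / β := by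
      rw [Finset.prod_const, Finset.card_range]
    rw [nodeProd, Finset.prod_range_zero, mul_one, c1, c2]
    simp only [← Finset.prod_mul_distrib, ← Finset.prod_div_distrib]
    refine Finset.prod_congr rfl fun s _ => ?_
    have e1 : β / (α * t ^ s) = β / α * t ^ (-(s : ℤ)) := by
      rw [zpow_neg]; norm_cast; field_simp
    rw [thetaPM, e1, hinv, neg_neg, zpow_natCast, show β * (α * t ^ s) = α * β * t ^ s by ring]
    ring
  have hNα : nodeProd p t α β α 0 n = (∏ s ∈ Finset.range n, theta p (α * β * t ^ s)) *
      ∏ s ∈ Finset.range n, T (-s) := by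
    rw [nodeProd, Finset.prod_range_zero, one_mul, ← Finset.prod_mul_distrib]
    refine Finset.prod_congr rfl fun s _ => ?_
    have e1 : α / (β * t ^ s) = α / β * t ^ (-(s : ℤ)) := by
      rw [zpow_neg]; norm_cast; field_simp
    rw [thetaPM, e1, ← mul_assoc]
  -- The three pairs of products over T differ by a shift of the running index, hence only by
  -- boundary terms.
  have t1 : (∏ s ∈ Finset.range n, T (s + 1)) * T 0 = (∏ s ∈ Finset.range n, T s) * T n := by
    have h := Finset.prod_range_succ (fun s : ℕ => T s) n
    rw [Finset.prod_range_succ'] at h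
    exact_mod_cast h
  have t2 : (∏ s ∈ Finset.range n, T (-(s + 1))) * T 0 =
      (∏ s ∈ Finset.range n, T (-s)) * T (-n) := by
    have h := Finset.prod_range_succ (fun s : ℕ => T (-(s : ℤ))) n
    rw [Finset.prod_range_succ'] at h
    simpa using h
  have t3 : (∏ s ∈ Finset.range n, T (2 * ((s + 1 : ℕ) : ℤ) - n)) * T (-n) =
      (∏ s ∈ Finset.range n, T (2 * s - n)) * T n := by
    have h := Finset.prod_range_succ (fun s : ℕ => T (2 * s - n)) n
    rw [Finset.prod_range_succ', show (2 * (n : ℤ) - n) = n by ring] at h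
    simpa using h
  have t4 : ∏ s ∈ Finset.range n, α * t ^ s = α ^ n * ∏ s ∈ Finset.range n, t ^ s := by
    rw [Finset.prod_mul_distrib]; simp
  have t5 : ∏ s ∈ Finset.range n, β * t ^ s = β ^ n * ∏ s ∈ Finset.range n, t ^ s := by
    rw [Finset.prod_mul_distrib]; simp
  have n1 : ∏ s ∈ Finset.range n, t ^ s ≠ 0 :=
    Finset.prod_ne_zero_iff.2 fun s _ => pow_ne_zero _ ht
  have n2 : ∏ s ∈ Finset.range n, theta p (t ^ (s + 1)) ≠ 0 :=
    Finset.prod_ne_zero_iff.2 fun s hs => hgen.pow _ (by omega)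
      (by have := Finset.mem_range.1 hs; omega)
  have n3 : ∏ s ∈ Finset.range n, T (s + 1) ≠ 0 := Finset.prod_ne_zero_iff.2 fun s _ => hT0 _
  have n4 : ∏ s ∈ Finset.range n, T (2 * ((s + 1 : ℕ) : ℤ) - n) ≠ 0 :=
    Finset.prod_ne_zero_iff.2 fun s _ => hT0 _
  have n5 : ∏ s ∈ Finset.range n, T (2 * s - n) ≠ 0 :=
    Finset.prod_ne_zero_iff.2 fun s _ => hT0 _
  have n6 := hT0 0
  have n7 := hT0 n
  have n8 := hT0 (-n)
  have n9 : ((-1 : ℂ) ^ n) * (-1) ^ n = 1 := by rw [← mul_pow]; simp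
  rw [hPX, hPY, t4, t5] at hfin
  rw [hNα, hNβ]
  generalize ∏ s ∈ Finset.range n, A s = PA at *
  generalize ∏ s ∈ Finset.range n, B s = PB at *
  generalize ∏ s ∈ Finset.range n, t ^ s = Pt at *
  generalize ∏ s ∈ Finset.range n, theta p (t ^ (s + 1)) = PE at *
  generalize ∏ s ∈ Finset.range n, T (s + 1) = P1 at *
  generalize ∏ s ∈ Finset.range n, T (-(s + 1)) = P2 at *
  generalize ∏ s ∈ Finset.range n, T (2 * ((s + 1 : ℕ) : ℤ) - n) = P3 at *
  generalize ∏ s ∈ Finset.range n, T (2 * s - n) = P4 at *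
  generalize ∏ s ∈ Finset.range n, T s = P5 at *
  generalize ∏ s ∈ Finset.range n, T (-s) = P6 at *
  generalize ∏ s ∈ Finset.range n, theta p (α * β * t ^ s) = W at *
  generalize T 0 = T0 at *
  generalize T n = T1 at *
  generalize T (-n) = T2 at *
  generalize (-1 : ℂ) ^ n = e at *
  have hP5 : P5 = P1 * T0 / T1 := by field_simp; exact t1.symm
  have hP6 : P6 = P2 * T0 / T2 := by field_simp; exact t2.symm
  have hP4 : P4 = P3 * T2 / T1 := by field_simp; exact t3.symm
  subst hP5 hP6 hP4
  rw [div_pow]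
  have hαn : α ^ n ≠ 0 := pow_ne_zero _ hα
  have hβn : β ^ n ≠ 0 := pow_ne_zero _ hβ
  generalize α ^ n = αn at *
  generalize β ^ n = βn at *
  field_simp at hfin ⊢
  linear_combination (e * W) * hfin + (αn * Pt * L 0 * W * PB * P2 * T1) * n9

end Ratio


/-! ### Means over the torus. -/

section TorusMean

open MeasureTheory

/-- The integral of `g` over the unit torus with respect to the angles. -/
noncomputable def torusMean {n : ℕ} (g : (Fin n → ℂ) → ℂ) : ℂ :=
  ∫ θ in Set.Icc (0 : Fin n → ℝ) fun _ => 2 * π, g (torusMap 0 1 θ)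

theorem torusMap_eq_circleMap {n : ℕ} (θ : Fin n → ℝ) (i : Fin n) :
    torusMap 0 1 θ i = circleMap 0 1 (θ i) := by
  simp [torusMap, circleMap]

theorem norm_torusMap {n : ℕ} (θ : Fin n → ℝ) (i : Fin n) : ‖torusMap 0 1 θ i‖ = 1 := by
  rw [torusMap_eq_circleMap]; simp

theorem continuous_torusMap {n : ℕ} : Continuous (torusMap (0 : Fin n → ℂ) 1) := by
  unfold torusMap; fun_prop

theorem torusIntegral_div_prod {n : ℕ} (g : (Fin n → ℂ) → ℂ) :
    (1 / (2 * (π : ℂ) * Complex.I) ^ n) *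
      torusIntegral (fun z => g z / ∏ i, z i) (0 : Fin n → ℂ) (1 : Fin n → ℝ) =
    (1 / (2 * (π : ℂ)) ^ n) * torusMean g := by
  have h : torusIntegral (fun z => g z / ∏ i, z i) (0 : Fin n → ℂ) (1 : Fin n → ℝ) =
      Complex.I ^ n * torusMean g := by
    rw [torusIntegral, torusMean, ← integral_const_mul]
    refine integral_congr_ae (Eventually.of_forall fun θ => ?_)
    have h0 : ∏ i, torusMap 0 1 θ i ≠ 0 := Finset.prod_ne_zero_iff.2 fun i _ =>
      norm_ne_zero_iff.1 (by rw [norm_torusMap]; exact one_ne_zero)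
    have h1 : (∏ i : Fin n, ((1 : Fin n → ℝ) i : ℂ) * Complex.exp (θ i * Complex.I) * Complex.I) =
        (∏ i, torusMap 0 1 θ i) * Complex.I ^ n := by
      rw [Finset.prod_mul_distrib]
      simp [torusMap]
    simp only [h1, smul_eq_mul]
    field_simp
  rw [h, mul_pow]
  have := Complex.I_ne_zero
  field_simp

theorem torusIntegrable_of_continuous {n : ℕ} {g : (Fin n → ℂ) → ℂ}
    (hg : Continuous fun θ : Fin n → ℝ => g (torusMap 0 1 θ)) : TorusIntegrable g 0 1 :=
  hg.continuousOn.integrableOn_compact isCompact_Icc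

theorem torusMean_finset_sum {n : ℕ} {ι : Type*} (s : Finset ι) {g : ι → (Fin n → ℂ) → ℂ}
    (hg : ∀ i ∈ s, Continuous fun θ : Fin n → ℝ => g i (torusMap 0 1 θ)) :
    torusMean (fun z => ∑ i ∈ s, g i z) = ∑ i ∈ s, torusMean (g i) :=
  integral_finsetSum s fun i hi => torusIntegrable_of_continuous (hg i hi)

theorem torusMean_add {n : ℕ} {f g : (Fin n → ℂ) → ℂ} (hf : TorusIntegrable f 0 1)
    (hg : TorusIntegrable g 0 1) :
    torusMean (fun z => f z + g z) = torusMean f + torusMean g := integral_add hf hg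

theorem TorusIntegrable.const_mul {n : ℕ} {f : (Fin n → ℂ) → ℂ} (hf : TorusIntegrable f 0 1)
    (c : ℂ) : TorusIntegrable (fun z => c * f z) 0 1 := Integrable.const_mul hf c

theorem torusMean_const_mul {n : ℕ} (c : ℂ) (g : (Fin n → ℂ) → ℂ) :
    torusMean (fun z => c * g z) = c * torusMean g := integral_const_mul _ _

theorem torusMean_congr {n : ℕ} {f g : (Fin n → ℂ) → ℂ} (h : ∀ z, (∀ i, ‖z i‖ = 1) → f z = g z) :
    torusMean f = torusMean g :=
  integral_congr_ae (Eventually.of_forall fun θ => h _ (norm_torusMap θ))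

/-- Fubini with the k-th angle integrated first. -/
theorem torusMean_eq_zero {n : ℕ} {g : (Fin n → ℂ) → ℂ}
    (hg : Continuous fun θ : Fin n → ℝ => g (torusMap 0 1 θ)) (k : Fin n)
    (h : ∀ z, (∀ i, ‖z i‖ = 1) → angleIntegral (fun x => g (Function.update z k x)) 1 = 0) :
    torusMean g = 0 := by
  obtain ⟨m, rfl⟩ : ∃ m, n = m + 1 := ⟨n - 1, by have := k.2; omega⟩
  set e : ℝ × (Fin m → ℝ) ≃ᵐ (Fin (m + 1) → ℝ) :=
    (MeasurableEquiv.piFinSuccAbove (fun _ => ℝ) k).symm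
  have hem : MeasurePreserving e :=
    (volume_preserving_piFinSuccAbove (fun _ : Fin (m + 1) => ℝ) k).symm _
  have heπ : (e ⁻¹' Set.Icc 0 fun _ => 2 * π) =
      Set.Icc 0 (2 * π) ×ˢ Set.Icc (0 : Fin m → ℝ) fun _ => 2 * π :=
    ((Fin.insertNthOrderIso (fun _ => ℝ) k).preimage_Icc _ _).trans (Set.Icc_prod_eq _ _)
  have hint : IntegrableOn (fun θ => g (torusMap 0 1 (e θ)))
      (Set.Icc 0 (2 * π) ×ˢ Set.Icc (0 : Fin m → ℝ) fun _ => 2 * π) volume := by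
    have := torusIntegrable_of_continuous hg
    rwa [TorusIntegrable, ← hem.integrableOn_comp_preimage e.measurableEmbedding, heπ] at this
  have hae : ∀ x y, e (x, y) = k.insertNth x y := fun x y => rfl
  rw [torusMean, ← hem.map_eq, setIntegral_map_equiv, heπ, Measure.volume_eq_prod]
  rw [IntegrableOn, Measure.volume_eq_prod, ← Measure.prod_restrict] at hint
  rw [← Measure.prod_restrict, integral_prod_symm _ hint]
  refine integral_eq_zero_of_ae (Eventually.of_forall fun y => ?_)
  have hz := h (torusMap 0 1 (k.insertNth 0 y)) (norm_torusMap _)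
  rw [angleIntegral, intervalIntegral.integral_of_le Real.two_pi_pos.le,
    Measure.restrict_congr_set Ioc_ae_eq_Icc] at hz
  refine Eq.trans ?_ hz
  refine integral_congr_ae (Eventually.of_forall fun x => ?_)
  simp only [hae]
  congr 1
  rw [funext_iff, k.forall_iff_succAbove]
  constructor
  · simp [torusMap_eq_circleMap]
  · intro i
    simp [torusMap_eq_circleMap, Fin.succAbove_ne]

end TorusMean


/-! ### Factorization of the integrand with respect to one variable. -/

/-- The one-variable factor of `Ψ`. -/
noncomputable def psiOne (p q : ℂ) (c : Fin 6 → ℂ) (x : ℂ) : ℂ :=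
  (∏ m, eGammaPM p q (c m) x) / eGammaPM p q 1 (x ^ 2)

/-- The two-variable factor of `Ψ`. -/
noncomputable def psiPair (p q t x w : ℂ) : ℂ :=
  (eGammaPM p q (t * x) w * eGammaPM p q (t * x⁻¹) w) / (eGammaPM p q x w * eGammaPM p q x⁻¹ w)

theorem Psi_eq_prod (n : ℕ) (p q t : ℂ) (c : Fin 6 → ℂ) (z : Fin n → ℂ) :
    Psi n p q t c z =
      (∏ i, psiOne p q c (z i)) * ∏ j, ∏ k ∈ Finset.Ioi j, psiPair p q t (z j) (z k) := rfl

theorem psiPair_comm (p q t x w : ℂ) : psiPair p q t x w = psiPair p q t w x := by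
  simp only [psiPair, eGammaPM]
  rw [show t * x * w = t * w * x by ring, show t * x * w⁻¹ = t * w⁻¹ * x by ring,
    show t * x⁻¹ * w = t * w * x⁻¹ by ring, show t * x⁻¹ * w⁻¹ = t * w⁻¹ * x⁻¹ by ring,
    mul_comm x w, mul_comm x w⁻¹, mul_comm x⁻¹ w, mul_comm x⁻¹ w⁻¹]
  congr 1 <;> ring

theorem psiOne_inv (p q : ℂ) (c : Fin 6 → ℂ) (x : ℂ) : psiOne p q c x⁻¹ = psiOne p q c x := by
  simp only [psiOne, eGammaPM, inv_inv, inv_pow]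
  rw [mul_comm (eGamma p q (1 * (x ^ 2)⁻¹))]
  congr 1
  exact Finset.prod_congr rfl fun m _ => mul_comm _ _

theorem psiPair_inv_left (p q t x w : ℂ) : psiPair p q t x⁻¹ w = psiPair p q t x w := by
  simp only [psiPair, inv_inv]
  rw [mul_comm (eGammaPM p q (t * x⁻¹) w), mul_comm (eGammaPM p q x⁻¹ w)]

/-- Symmetry of f allows the pairs containing k to be collected regardless of whether k is the
smaller or the larger index. -/
theorem prod_prod_Ioi_eq {n : ℕ} (f : Fin n → Fin n → ℂ) (hf : ∀ i j, f i j = f j i) (k : Fin n) :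
    ∏ j, ∏ l ∈ Finset.Ioi j, f j l = (∏ j ∈ Finset.univ.erase k, f k j) *
      ∏ j ∈ Finset.univ.erase k, ∏ l ∈ (Finset.Ioi j).erase k, f j l := by
  have h : ∀ (j : Fin n) (s : Finset (Fin n)), (∏ l ∈ Finset.univ.filter (j < ·) ∩ s, f j l) =
      ∏ l ∈ s, if j < l then f j l else 1 := by
    intro j s
    rw [← Finset.prod_filter]
    congr 1; ext; simp [and_comm]
  have h1 : ∀ j, ∏ l ∈ Finset.Ioi j, f j l = ∏ l, if j < l then f j l else 1 := by
    intro j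
    rw [← h]; congr 1; ext; simp
  have h2 : ∀ j, ∏ l ∈ (Finset.Ioi j).erase k, f j l =
      ∏ l ∈ Finset.univ.erase k, if j < l then f j l else 1 := by
    intro j
    rw [← h]; congr 1; ext; simp [and_comm]
  simp only [h1, h2]
  rw [← Finset.mul_prod_erase _ _ (Finset.mem_univ k),
    ← Finset.mul_prod_erase _ _ (Finset.mem_univ k), if_neg (lt_irrefl k), one_mul,
    ← Finset.prod_mul_distrib, ← Finset.prod_mul_distrib]
  refine Finset.prod_congr rfl fun j hj => ?_
  rw [← Finset.mul_prod_erase _ _ (Finset.mem_univ k), ← mul_assoc]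
  congr 1
  rcases lt_or_gt_of_ne (Finset.ne_of_mem_erase hj) with h | h
  · rw [if_pos h, if_neg h.not_gt, one_mul, hf]
  · rw [if_pos h, if_neg h.not_gt, mul_one]

/-- The factors of `Ψ` that do not involve the variable `z k`. -/
noncomputable def psiRest {n : ℕ} (p q t : ℂ) (c : Fin 6 → ℂ) (k : Fin n) (z : Fin n → ℂ) : ℂ :=
  (∏ i ∈ Finset.univ.erase k, psiOne p q c (z i)) *
    ∏ j ∈ Finset.univ.erase k, ∏ l ∈ (Finset.Ioi j).erase k, psiPair p q t (z j) (z l)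

theorem Psi_eq_mul_psiRest {n : ℕ} (p q t : ℂ) (c : Fin 6 → ℂ) (k : Fin n) (z : Fin n → ℂ) :
    Psi n p q t c z = psiOne p q c (z k) *
      (∏ j ∈ Finset.univ.erase k, psiPair p q t (z k) (z j)) * psiRest p q t c k z := by
  rw [Psi_eq_prod, prod_prod_Ioi_eq _ (fun i j => psiPair_comm p q t (z i) (z j)) k,
    ← Finset.mul_prod_erase _ _ (Finset.mem_univ k), psiRest]
  ring

theorem psiRest_update {n : ℕ} (p q t : ℂ) (c : Fin 6 → ℂ) (k : Fin n) (z : Fin n → ℂ) (x : ℂ) :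
    psiRest p q t c k (Function.update z k x) = psiRest p q t c k z := by
  rw [psiRest, psiRest]
  congr 1
  · exact Finset.prod_congr rfl fun i hi => by
      rw [Function.update_of_ne (Finset.ne_of_mem_erase hi)]
  · refine Finset.prod_congr rfl fun i hi => Finset.prod_congr rfl fun j hj => ?_
    rw [Function.update_of_ne (Finset.ne_of_mem_erase hi),
      Function.update_of_ne (Finset.ne_of_mem_erase hj)]

/-- The product of `psiOne` with the one-variable part of the shift factor. -/
noncomputable def kernelOne (p q : ℂ) (c : Fin 6 → ℂ) (x : ℂ) : ℂ :=
  x⁻¹ * (∏ m, eGamma p q (q * (c m * x)) * eGamma p q (c m * x⁻¹)) * theta q (x ^ 2)⁻¹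

/-- The product of `psiPair` with the two-variable part of the shift factor. -/
noncomputable def kernelPair (p q t x w : ℂ) : ℂ :=
  eGamma p q (q * (t * x * w)) * eGamma p q (q * (t * x * w⁻¹)) *
    (eGamma p q (t * x⁻¹ * w) * eGamma p q (t * x⁻¹ * w⁻¹)) *
    (theta q (x * w)⁻¹ * theta q (x * w⁻¹)⁻¹)

/-! ### Holomorphy and antisymmetry of the shifted integrand. -/

section Kernel

variable {p q t : ℂ} {c : Fin 6 → ℂ}

theorem differentiableAt_eGamma_comp (hp₁ : ‖p‖ < 1) (hq₁ : ‖q‖ < 1) {f : ℂ → ℂ} {x : ℂ}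
    (hf : DifferentiableAt ℂ f x) (h0 : f x ≠ 0) (h1 : ‖f x‖ < 1) :
    DifferentiableAt ℂ (fun x => eGamma p q (f x)) x :=
  (differentiableAt_eGamma hp₁ hq₁ h0 h1).comp x hf

theorem differentiableAt_theta_comp (hp₁ : ‖p‖ < 1) {f : ℂ → ℂ} {x : ℂ}
    (hf : DifferentiableAt ℂ f x) (h0 : f x ≠ 0) :
    DifferentiableAt ℂ (fun x => theta p (f x)) x :=
  (differentiableAt_theta hp₁ h0).comp x hf

theorem continuous_eGamma_comp (hp₁ : ‖p‖ < 1) (hq₁ : ‖q‖ < 1) {X : Type*} [TopologicalSpace X]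
    {f : X → ℂ} (hf : Continuous f) (h0 : ∀ x, f x ≠ 0) (h1 : ∀ x, ‖f x‖ < 1) :
    Continuous fun x => eGamma p q (f x) :=
  continuous_iff_continuousAt.2 fun x =>
    (differentiableAt_eGamma hp₁ hq₁ (h0 x) (h1 x)).continuousAt.comp hf.continuousAt

theorem continuous_theta_comp (hp₁ : ‖p‖ < 1) {X : Type*} [TopologicalSpace X]
    {f : X → ℂ} (hf : Continuous f) (h0 : ∀ x, f x ≠ 0) : Continuous fun x => theta p (f x) :=
  continuous_iff_continuousAt.2 fun x =>
    (differentiableAt_theta hp₁ (h0 x)).continuousAt.comp hf.continuousAt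

theorem psiOne_eq (hp₁ : ‖p‖ < 1) (hq₁ : ‖q‖ < 1) {x : ℂ} (hx : ‖x‖ = 1) :
    psiOne p q c x = (∏ m, eGamma p q (c m * x) * eGamma p q (c m * x⁻¹)) *
      (theta p (x ^ 2) * theta q (x ^ 2)⁻¹) := by
  rw [psiOne, div_eq_mul_inv, ← inv_eGamma_mul_eGamma_inv hp₁ hq₁ (by rw [norm_pow, hx, one_pow])]
  simp only [eGammaPM, one_mul]

theorem psiPair_eq (hp₁ : ‖p‖ < 1) (hq₁ : ‖q‖ < 1) {x w : ℂ} (hx : ‖x‖ = 1) (hw : ‖w‖ = 1) :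
    psiPair p q t x w = eGamma p q (t * x * w) * eGamma p q (t * x * w⁻¹) *
      (eGamma p q (t * x⁻¹ * w) * eGamma p q (t * x⁻¹ * w⁻¹)) *
      (theta p (x * w) * theta q (x * w)⁻¹ * (theta p (x * w⁻¹) * theta q (x * w⁻¹)⁻¹)) := by
  rw [psiPair, div_eq_mul_inv, ← inv_eGamma_mul_eGamma_inv hp₁ hq₁ (u := x * w) (by simp [hx, hw]),
    ← inv_eGamma_mul_eGamma_inv hp₁ hq₁ (u := x * w⁻¹) (by simp [hx, hw]), ← mul_inv]
  simp only [eGammaPM, mul_inv, inv_inv]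
  ring

/-- Each θ(c_m x) raises the argument of a gamma function by q, and the denominator θ(x²;p) is
cancelled by the weight 1/Γ(x^{±2}). The right-hand side has no singularity on the unit circle, so
it extends the left-hand side across the zeros of θ(x²;p). -/
theorem psiOne_mul_eq_kernelOne (hp₁ : ‖p‖ < 1) (hq₁ : ‖q‖ < 1) (hq₀ : q ≠ 0)
    (hc : ∀ m, c m ≠ 0) (hc₁ : ∀ m, ‖c m‖ < 1) {x : ℂ} (hx : ‖x‖ = 1)
    (h : theta p (x ^ 2) ≠ 0) :
    psiOne p q c x * (x⁻¹ * (∏ m, theta p (c m * x)) / theta p (x ^ 2)) = kernelOne p q c x := by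
  have hx0 : x ≠ 0 := norm_ne_zero_iff.1 (by rw [hx]; exact one_ne_zero)
  have e : ∏ m, eGamma p q (q * (c m * x)) * eGamma p q (c m * x⁻¹) =
      (∏ m, eGamma p q (c m * x) * eGamma p q (c m * x⁻¹)) * ∏ m, theta p (c m * x) := by
    rw [← Finset.prod_mul_distrib]
    refine Finset.prod_congr rfl fun m _ => ?_
    rw [eGamma_mul hp₁ hq₁ hq₀ (mul_ne_zero (hc m) hx0) (by rw [norm_mul, hx, mul_one]; exact hc₁ m)]
    ring
  rw [psiOne_eq hp₁ hq₁ hx, kernelOne, e]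
  generalize ∏ m, eGamma p q (c m * x) * eGamma p q (c m * x⁻¹) = A
  generalize ∏ m, theta p (c m * x) = B
  generalize theta q (x ^ 2)⁻¹ = D
  field_simp

theorem psiPair_mul_eq_kernelPair (hp₁ : ‖p‖ < 1) (hq₁ : ‖q‖ < 1) (hq₀ : q ≠ 0)
    (ht : t ≠ 0) (ht₁ : ‖t‖ < 1) {x w : ℂ} (hx : ‖x‖ = 1) (hw : ‖w‖ = 1)
    (h : thetaPM p x w ≠ 0) :
    psiPair p q t x w * (thetaPM p (t * x) w / thetaPM p x w) = kernelPair p q t x w := by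
  have hx0 : x ≠ 0 := norm_ne_zero_iff.1 (by rw [hx]; exact one_ne_zero)
  have hw0 : w ≠ 0 := norm_ne_zero_iff.1 (by rw [hw]; exact one_ne_zero)
  rw [thetaPM, div_eq_mul_inv x w] at h
  obtain ⟨h1, h2⟩ := mul_ne_zero_iff.1 h
  rw [psiPair_eq hp₁ hq₁ hx hw, kernelPair,
    eGamma_mul hp₁ hq₁ hq₀ (mul_ne_zero (mul_ne_zero ht hx0) hw0) (by simp [hx, hw, ht₁]),
    eGamma_mul hp₁ hq₁ hq₀ (mul_ne_zero (mul_ne_zero ht hx0) (inv_ne_zero hw0))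
      (by simp [hx, hw, ht₁]), thetaPM, thetaPM, div_eq_mul_inv x w, div_eq_mul_inv (t * x) w]
  generalize theta p (x * w) = A at *
  generalize theta p (x * w⁻¹) = B at *
  field_simp

theorem theta_inv_mul_self (hq₁ : ‖q‖ < 1) (hq₀ : q ≠ 0) {u : ℂ} (hu : u ≠ 0) :
    theta q (q * u) = theta q u⁻¹ := by
  rw [theta_mul_self hq₁ hq₀ hu, theta_inv hq₁ hu]

/-- The substitution x ↦ 1/(qx) exchanges the two gamma functions attached to each c_m. The sign
comes from the quasi-period of θ(·;q) in the last factor, whose multiplier also turns the prefactor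
qx into -1/x. -/
theorem kernelOne_shift (hq₁ : ‖q‖ < 1) (hq₀ : q ≠ 0) {x : ℂ} (hx : x ≠ 0) :
    kernelOne p q c (q * x)⁻¹ = -kernelOne p q c x := by
  have e1 : ((q * x)⁻¹ ^ 2)⁻¹ = q * (q * x ^ 2) := by field_simp
  have hx2 : x ^ 2 ≠ 0 := pow_ne_zero 2 hx
  have e2 : ∏ m, eGamma p q (q * (c m * (q * x)⁻¹)) * eGamma p q (c m * (q * x)) =
      ∏ m, eGamma p q (q * (c m * x)) * eGamma p q (c m * x⁻¹) := by
    refine Finset.prod_congr rfl fun m _ => ?_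
    rw [mul_comm, show c m * (q * x) = q * (c m * x) by ring,
      show q * (c m * (q * x)⁻¹) = c m * x⁻¹ by field_simp]
  rw [kernelOne, kernelOne, inv_inv, e1, theta_mul_self hq₁ hq₀ (mul_ne_zero hq₀ hx2),
    theta_inv_mul_self hq₁ hq₀ hx2, e2]
  field_simp

theorem kernelPair_shift (hq₁ : ‖q‖ < 1) (hq₀ : q ≠ 0) {x w : ℂ} (hx : x ≠ 0) (hw : w ≠ 0) :
    kernelPair p q t (q * x)⁻¹ w = kernelPair p q t x w := by
  rw [kernelPair, kernelPair, inv_inv,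
    show ((q * x)⁻¹ * w)⁻¹ = q * (x * w⁻¹) by field_simp,
    show ((q * x)⁻¹ * w⁻¹)⁻¹ = q * (x * w) by field_simp,
    theta_inv_mul_self hq₁ hq₀ (mul_ne_zero hx hw),
    theta_inv_mul_self hq₁ hq₀ (mul_ne_zero hx (inv_ne_zero hw)),
    show q * (t * (q * x)⁻¹ * w) = t * x⁻¹ * w by field_simp,
    show q * (t * (q * x)⁻¹ * w⁻¹) = t * x⁻¹ * w⁻¹ by field_simp,
    show t * (q * x) * w = q * (t * x * w) by ring,
    show t * (q * x) * w⁻¹ = q * (t * x * w⁻¹) by ring]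
  ring

theorem differentiableAt_kernelOne_inv (hp₁ : ‖p‖ < 1) (hq₁ : ‖q‖ < 1) (hq₀ : q ≠ 0)
    (hc : ∀ m, c m ≠ 0) (hc₁ : ∀ m, ‖c m‖ < 1) {x : ℂ} (h1 : ‖q‖ ≤ ‖x‖) (h2 : ‖x‖ ≤ 1) :
    DifferentiableAt ℂ (fun x => kernelOne p q c x⁻¹) x := by
  have hx0 : x ≠ 0 := norm_pos_iff.1 ((norm_pos_iff.2 hq₀).trans_le h1)
  have hxn := norm_pos_iff.2 hx0
  have d : DifferentiableAt ℂ (fun x : ℂ => x⁻¹) x := differentiableAt_inv hx0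
  simp only [kernelOne, inv_inv, inv_pow]
  refine ((by fun_prop : DifferentiableAt ℂ (fun x : ℂ => x) x).mul
    (DifferentiableAt.fun_finsetProd fun m _ => ?_)).mul
    (differentiableAt_theta_comp hq₁ (by fun_prop) (pow_ne_zero 2 hx0))
  refine DifferentiableAt.mul
    (differentiableAt_eGamma_comp hp₁ hq₁ (by fun_prop) ?_ ?_)
    (differentiableAt_eGamma_comp hp₁ hq₁ (by fun_prop) ?_ ?_)
  · exact mul_ne_zero hq₀ (mul_ne_zero (hc m) (inv_ne_zero hx0))
  · rw [norm_mul, norm_mul, norm_inv, mul_left_comm]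
    have : ‖q‖ * ‖x‖⁻¹ ≤ 1 := by rw [← div_eq_mul_inv]; exact (div_le_one hxn).2 h1
    exact (mul_le_of_le_one_right (norm_nonneg _) this).trans_lt (hc₁ m)
  · exact mul_ne_zero (hc m) hx0
  · rw [norm_mul]
    exact (mul_le_of_le_one_right (norm_nonneg _) h2).trans_lt (hc₁ m)

theorem differentiableAt_kernelPair_inv (hp₁ : ‖p‖ < 1) (hq₁ : ‖q‖ < 1) (hq₀ : q ≠ 0)
    (ht : t ≠ 0) (ht₁ : ‖t‖ < 1) {x w : ℂ} (hw : ‖w‖ = 1) (h1 : ‖q‖ ≤ ‖x‖) (h2 : ‖x‖ ≤ 1) :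
    DifferentiableAt ℂ (fun x => kernelPair p q t x⁻¹ w) x := by
  have hx0 : x ≠ 0 := norm_pos_iff.1 ((norm_pos_iff.2 hq₀).trans_le h1)
  have hw0 : w ≠ 0 := norm_ne_zero_iff.1 (by rw [hw]; exact one_ne_zero)
  have hxn := norm_pos_iff.2 hx0
  have d : DifferentiableAt ℂ (fun x : ℂ => x⁻¹) x := differentiableAt_inv hx0
  have b : ‖q‖ * ‖x‖⁻¹ ≤ 1 := by rw [← div_eq_mul_inv]; exact (div_le_one hxn).2 h1
  have key1 : ∀ v : ℂ, ‖v‖ = 1 →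
      DifferentiableAt ℂ (fun x => eGamma p q (q * (t * x⁻¹ * v))) x := by
    intro v hv
    have hv0 : v ≠ 0 := norm_ne_zero_iff.1 (by rw [hv]; exact one_ne_zero)
    refine differentiableAt_eGamma_comp hp₁ hq₁ (by fun_prop) ?_ ?_
    · exact mul_ne_zero hq₀ (mul_ne_zero (mul_ne_zero ht (inv_ne_zero hx0)) hv0)
    · rw [norm_mul, norm_mul, norm_mul, norm_inv, hv, mul_one, mul_left_comm]
      exact (mul_le_of_le_one_right (norm_nonneg _) b).trans_lt ht₁
  have key2 : ∀ v : ℂ, ‖v‖ = 1 → DifferentiableAt ℂ (fun x => eGamma p q (t * x * v)) x := by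
    intro v hv
    have hv0 : v ≠ 0 := norm_ne_zero_iff.1 (by rw [hv]; exact one_ne_zero)
    refine differentiableAt_eGamma_comp hp₁ hq₁ (by fun_prop) ?_ ?_
    · exact mul_ne_zero (mul_ne_zero ht hx0) hv0
    · rw [norm_mul, norm_mul, hv, mul_one]
      exact (mul_le_of_le_one_right (norm_nonneg _) h2).trans_lt ht₁
  have hwi : ‖w⁻¹‖ = 1 := by rw [norm_inv, hw, inv_one]
  have key3 : ∀ v : ℂ, ‖v‖ = 1 → DifferentiableAt ℂ (fun x => theta q (x⁻¹ * v)⁻¹) x := by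
    intro v hv
    have hv0 : v ≠ 0 := norm_ne_zero_iff.1 (by rw [hv]; exact one_ne_zero)
    simp only [mul_inv, inv_inv]
    exact differentiableAt_theta_comp hq₁ (by fun_prop) (mul_ne_zero hx0 (inv_ne_zero hv0))
  simp only [kernelPair, inv_inv]
  exact (((key1 w hw).mul (key1 _ hwi)).mul ((key2 w hw).mul (key2 _ hwi))).mul
    ((key3 w hw).mul (key3 _ hwi))

/-- After inversion of x the integrand is holomorphic for ‖q‖ ≤ ‖x‖ ≤ 1, so its integrals over the
two boundary circles agree. Rescaling the inner circle and using antisymmetry shows that they are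
also negatives of each other. -/
theorem angleIntegral_kernel_eq_zero (hp₁ : ‖p‖ < 1) (hq₁ : ‖q‖ < 1) (hq₀ : q ≠ 0)
    (ht : t ≠ 0) (ht₁ : ‖t‖ < 1) (hc : ∀ m, c m ≠ 0) (hc₁ : ∀ m, ‖c m‖ < 1) {ι : Type*}
    (s : Finset ι) (w : ι → ℂ) (hw : ∀ j, ‖w j‖ = 1) :
    angleIntegral (fun x => kernelOne p q c x * ∏ j ∈ s, kernelPair p q t x (w j)) 1 = 0 ∧
    angleIntegral (fun x => kernelOne p q c x⁻¹ * ∏ j ∈ s, kernelPair p q t x⁻¹ (w j)) 1 = 0 := by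
  set g : ℂ → ℂ := fun x => kernelOne p q c x⁻¹ * ∏ j ∈ s, kernelPair p q t x⁻¹ (w j) with hg
  have e1 : (fun x => kernelOne p q c x * ∏ j ∈ s, kernelPair p q t x (w j)) = fun x => g x⁻¹ := by
    funext x; simp only [hg, inv_inv]
  have e2 : angleIntegral g 1 = 0 := by
    have a1 : angleIntegral g 1 = angleIntegral g (‖q‖ * 1) := by
      refine angleIntegral_eq_of_differentiableOn (by simpa using hq₀) (by simpa using hq₁.le) ?_
      intro x h1 h2
      rw [mul_one] at h1
      exact (differentiableAt_kernelOne_inv hp₁ hq₁ hq₀ hc hc₁ h1 h2).mul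
        (DifferentiableAt.fun_finsetProd fun j _ =>
          differentiableAt_kernelPair_inv hp₁ hq₁ hq₀ ht ht₁ (hw j) h1 h2)
    rw [← angleIntegral_comp_mul] at a1
    have a2 : angleIntegral (fun x => g (q * x)) 1 = -angleIntegral (fun x => g x⁻¹) 1 := by
      rw [angleIntegral, angleIntegral, ← intervalIntegral.integral_neg]
      refine intervalIntegral.integral_congr fun θ _ => ?_
      have hx0 : circleMap 0 1 θ ≠ 0 := circleMap_ne_center one_ne_zero
      simp only [hg, inv_inv]
      rw [kernelOne_shift hq₁ hq₀ hx0, neg_mul]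
      congr 2
      exact Finset.prod_congr rfl fun j _ => kernelPair_shift hq₁ hq₀ hx0
        (norm_ne_zero_iff.1 (by rw [hw]; exact one_ne_zero))
    rw [angleIntegral_comp_inv] at a2
    rw [a2] at a1
    linear_combination a1 / 2
  exact ⟨by rw [e1, angleIntegral_comp_inv, e2], e2⟩

end Kernel


/-! ### The difference equation for the theta moments. -/

section TorusRelation

variable {p q t : ℂ}

theorem ne_zero_of_norm_eq_one {x : ℂ} (hx : ‖x‖ = 1) : x ≠ 0 :=
  norm_ne_zero_iff.1 (by rw [hx]; exact one_ne_zero)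

section Continuity

variable {X : Type*} [TopologicalSpace X] {c : X → Fin 6 → ℂ} {f g : X → ℂ}

theorem continuous_psiOne (hp₁ : ‖p‖ < 1) (hq₁ : ‖q‖ < 1) (hc : Continuous c)
    (hc₀ : ∀ s m, c s m ≠ 0) (hc₁ : ∀ s m, ‖c s m‖ < 1) (hf : Continuous f)
    (hf₁ : ∀ s, ‖f s‖ = 1) : Continuous fun s => psiOne p q (c s) (f s) := by
  have hf₀ : ∀ s, f s ≠ 0 := fun s => ne_zero_of_norm_eq_one (hf₁ s)
  have hc' : ∀ m, Continuous fun s => c s m := fun m => (continuous_apply m).comp hc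
  simp only [psiOne_eq hp₁ hq₁ (hf₁ _)]
  refine (continuous_finsetProd _ fun m _ => ?_).mul ?_
  · refine (continuous_eGamma_comp hp₁ hq₁ ((hc' m).mul hf)
      (fun s => mul_ne_zero (hc₀ s m) (hf₀ s)) (fun s => ?_)).mul
      (continuous_eGamma_comp hp₁ hq₁ ((hc' m).mul (hf.inv₀ hf₀))
      (fun s => mul_ne_zero (hc₀ s m) (inv_ne_zero (hf₀ s))) (fun s => ?_))
    · change ‖c s m * f s‖ < 1
      rw [norm_mul, hf₁, mul_one]; exact hc₁ s m
    · rw [norm_mul, norm_inv, hf₁, inv_one, mul_one]; exact hc₁ s m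
  · exact (continuous_theta_comp hp₁ (hf.pow 2) fun s => pow_ne_zero 2 (hf₀ s)).mul
      (continuous_theta_comp hq₁ ((hf.pow 2).inv₀ fun s => pow_ne_zero 2 (hf₀ s))
        fun s => inv_ne_zero (pow_ne_zero 2 (hf₀ s)))

theorem continuous_psiPair (hp₁ : ‖p‖ < 1) (hq₁ : ‖q‖ < 1) (ht : t ≠ 0) (ht₁ : ‖t‖ < 1)
    (hf : Continuous f) (hf₁ : ∀ s, ‖f s‖ = 1) (hg : Continuous g) (hg₁ : ∀ s, ‖g s‖ = 1) :
    Continuous fun s => psiPair p q t (f s) (g s) := by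
  have hf₀ : ∀ s, f s ≠ 0 := fun s => ne_zero_of_norm_eq_one (hf₁ s)
  have hg₀ : ∀ s, g s ≠ 0 := fun s => ne_zero_of_norm_eq_one (hg₁ s)
  have hfi := hf.inv₀ hf₀
  have hgi := hg.inv₀ hg₀
  have hfi₁ : ∀ s, ‖(f s)⁻¹‖ = 1 := fun s => by rw [norm_inv, hf₁, inv_one]
  have hgi₁ : ∀ s, ‖(g s)⁻¹‖ = 1 := fun s => by rw [norm_inv, hg₁, inv_one]
  have hG : ∀ u v : X → ℂ, Continuous u → Continuous v → (∀ s, ‖u s‖ = 1) → (∀ s, ‖v s‖ = 1) →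
      Continuous fun s => eGamma p q (t * u s * v s) := fun u v hu hv hu₁ hv₁ =>
    continuous_eGamma_comp hp₁ hq₁ ((continuous_const.mul hu).mul hv)
      (fun s => mul_ne_zero (mul_ne_zero ht (ne_zero_of_norm_eq_one (hu₁ s)))
        (ne_zero_of_norm_eq_one (hv₁ s)))
      (fun s => by rw [norm_mul, norm_mul, hu₁, hv₁, mul_one, mul_one]; exact ht₁)
  have hT : ∀ u v : X → ℂ, Continuous u → Continuous v → (∀ s, ‖u s‖ = 1) → (∀ s, ‖v s‖ = 1) →
      Continuous fun s => theta p (u s * v s) * theta q (u s * v s)⁻¹ := by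
    intro u v hu hv hu₁ hv₁
    have h0 : ∀ s, u s * v s ≠ 0 := fun s => mul_ne_zero (ne_zero_of_norm_eq_one (hu₁ s))
        (ne_zero_of_norm_eq_one (hv₁ s))
    exact (continuous_theta_comp hp₁ (hu.mul hv) h0).mul
      (continuous_theta_comp hq₁ ((hu.mul hv).inv₀ h0) fun s => inv_ne_zero (h0 s))
  simp only [psiPair_eq hp₁ hq₁ (hf₁ _) (hg₁ _)]
  exact (((hG _ _ hf hg hf₁ hg₁).mul (hG _ _ hf hgi hf₁ hgi₁)).mul
    ((hG _ _ hfi hg hfi₁ hg₁).mul (hG _ _ hfi hgi hfi₁ hgi₁))).mul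
    ((hT _ _ hf hg hf₁ hg₁).mul (hT _ _ hf hgi hf₁ hgi₁))

theorem continuous_Psi (hp₁ : ‖p‖ < 1) (hq₁ : ‖q‖ < 1) (ht : t ≠ 0) (ht₁ : ‖t‖ < 1)
    (hc : Continuous c) (hc₀ : ∀ s m, c s m ≠ 0) (hc₁ : ∀ s m, ‖c s m‖ < 1) {n : ℕ}
    {z : X → Fin n → ℂ} (hz : Continuous z) (hz₁ : ∀ s i, ‖z s i‖ = 1) :
    Continuous fun s => Psi n p q t (c s) (z s) := by
  have hz' : ∀ i, Continuous fun s => z s i := fun i => (continuous_apply i).comp hz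
  simp only [Psi_eq_prod]
  exact (continuous_finsetProd _ fun i _ =>
    continuous_psiOne hp₁ hq₁ hc hc₀ hc₁ (hz' i) fun s => hz₁ s i).mul
    (continuous_finsetProd _ fun i _ => continuous_finsetProd _ fun j _ =>
      continuous_psiPair hp₁ hq₁ ht ht₁ (hz' i) (fun s => hz₁ s i) (hz' j) fun s => hz₁ s j)

theorem continuous_psiRest (hp₁ : ‖p‖ < 1) (hq₁ : ‖q‖ < 1) (ht : t ≠ 0) (ht₁ : ‖t‖ < 1)
    (hc : Continuous c) (hc₀ : ∀ s m, c s m ≠ 0) (hc₁ : ∀ s m, ‖c s m‖ < 1) {n : ℕ}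
    {z : X → Fin n → ℂ} (hz : Continuous z) (hz₁ : ∀ s i, ‖z s i‖ = 1) (k : Fin n) :
    Continuous fun s => psiRest p q t (c s) k (z s) := by
  have hz' : ∀ i, Continuous fun s => z s i := fun i => (continuous_apply i).comp hz
  simp only [psiRest]
  exact (continuous_finsetProd _ fun i _ =>
    continuous_psiOne hp₁ hq₁ hc hc₀ hc₁ (hz' i) fun s => hz₁ s i).mul
    (continuous_finsetProd _ fun i _ => continuous_finsetProd _ fun j _ =>
      continuous_psiPair hp₁ hq₁ ht ht₁ (hz' i) (fun s => hz₁ s i) (hz' j) fun s => hz₁ s j)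

theorem continuous_kernelOne (hp₁ : ‖p‖ < 1) (hq₁ : ‖q‖ < 1) (hq₀ : q ≠ 0) (hc : Continuous c)
    (hc₀ : ∀ s m, c s m ≠ 0) (hc₁ : ∀ s m, ‖c s m‖ < 1) (hf : Continuous f)
    (hf₁ : ∀ s, ‖f s‖ = 1) : Continuous fun s => kernelOne p q (c s) (f s) := by
  have hf₀ : ∀ s, f s ≠ 0 := fun s => ne_zero_of_norm_eq_one (hf₁ s)
  have hc' : ∀ m, Continuous fun s => c s m := fun m => (continuous_apply m).comp hc
  simp only [kernelOne]
  refine ((hf.inv₀ hf₀).mul (continuous_finsetProd _ fun m _ => ?_)).mul ?_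
  · refine (continuous_eGamma_comp hp₁ hq₁ (continuous_const.mul ((hc' m).mul hf))
      (fun s => mul_ne_zero hq₀ (mul_ne_zero (hc₀ s m) (hf₀ s))) (fun s => ?_)).mul
      (continuous_eGamma_comp hp₁ hq₁ ((hc' m).mul (hf.inv₀ hf₀))
      (fun s => mul_ne_zero (hc₀ s m) (inv_ne_zero (hf₀ s))) (fun s => ?_))
    · change ‖q * (c s m * f s)‖ < 1
      rw [norm_mul, norm_mul, hf₁, mul_one]
      exact mul_lt_one_of_nonneg_of_lt_one_left (norm_nonneg _) hq₁ (hc₁ s m).le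
    · rw [norm_mul, norm_inv, hf₁, inv_one, mul_one]; exact hc₁ s m
  · exact (continuous_theta_comp hq₁ ((hf.pow 2).inv₀ fun s => pow_ne_zero 2 (hf₀ s))
        fun s => inv_ne_zero (pow_ne_zero 2 (hf₀ s)))

theorem continuous_kernelPair (hp₁ : ‖p‖ < 1) (hq₁ : ‖q‖ < 1) (hq₀ : q ≠ 0) (ht : t ≠ 0)
    (ht₁ : ‖t‖ < 1) (hf : Continuous f) (hf₁ : ∀ s, ‖f s‖ = 1) (hg : Continuous g)
    (hg₁ : ∀ s, ‖g s‖ = 1) : Continuous fun s => kernelPair p q t (f s) (g s) := by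
  have hf₀ : ∀ s, f s ≠ 0 := fun s => ne_zero_of_norm_eq_one (hf₁ s)
  have hg₀ : ∀ s, g s ≠ 0 := fun s => ne_zero_of_norm_eq_one (hg₁ s)
  have hfi := hf.inv₀ hf₀
  have hgi := hg.inv₀ hg₀
  have hfi₁ : ∀ s, ‖(f s)⁻¹‖ = 1 := fun s => by rw [norm_inv, hf₁, inv_one]
  have hgi₁ : ∀ s, ‖(g s)⁻¹‖ = 1 := fun s => by rw [norm_inv, hg₁, inv_one]
  have h0 : ∀ u v : X → ℂ, (∀ s, ‖u s‖ = 1) → (∀ s, ‖v s‖ = 1) → ∀ s, t * u s * v s ≠ 0 :=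
    fun u v hu₁ hv₁ s => mul_ne_zero (mul_ne_zero ht (ne_zero_of_norm_eq_one (hu₁ s)))
        (ne_zero_of_norm_eq_one (hv₁ s))
  have h1 : ∀ u v : X → ℂ, (∀ s, ‖u s‖ = 1) → (∀ s, ‖v s‖ = 1) → ∀ s, ‖t * u s * v s‖ < 1 :=
    fun u v hu₁ hv₁ s => by rw [norm_mul, norm_mul, hu₁, hv₁, mul_one, mul_one]; exact ht₁
  have hG : ∀ u v : X → ℂ, Continuous u → Continuous v → (∀ s, ‖u s‖ = 1) → (∀ s, ‖v s‖ = 1) →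
      Continuous fun s => eGamma p q (t * u s * v s) := fun u v hu hv hu₁ hv₁ =>
    continuous_eGamma_comp hp₁ hq₁ ((continuous_const.mul hu).mul hv) (h0 u v hu₁ hv₁)
      (h1 u v hu₁ hv₁)
  have hG' : ∀ u v : X → ℂ, Continuous u → Continuous v → (∀ s, ‖u s‖ = 1) → (∀ s, ‖v s‖ = 1) →
      Continuous fun s => eGamma p q (q * (t * u s * v s)) := fun u v hu hv hu₁ hv₁ =>
    continuous_eGamma_comp hp₁ hq₁ (continuous_const.mul ((continuous_const.mul hu).mul hv))
      (fun s => mul_ne_zero hq₀ (h0 u v hu₁ hv₁ s))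
      (fun s => by
        rw [norm_mul]
        exact mul_lt_one_of_nonneg_of_lt_one_left (norm_nonneg _) hq₁ (h1 u v hu₁ hv₁ s).le)
  have hT : ∀ u v : X → ℂ, Continuous u → Continuous v → (∀ s, ‖u s‖ = 1) → (∀ s, ‖v s‖ = 1) →
      Continuous fun s => theta q (u s * v s)⁻¹ := by
    intro u v hu hv hu₁ hv₁
    have h0 : ∀ s, u s * v s ≠ 0 := fun s => mul_ne_zero (ne_zero_of_norm_eq_one (hu₁ s))
        (ne_zero_of_norm_eq_one (hv₁ s))
    exact continuous_theta_comp hq₁ ((hu.mul hv).inv₀ h0) fun s => inv_ne_zero (h0 s)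
  simp only [kernelPair]
  exact (((hG' _ _ hf hg hf₁ hg₁).mul (hG' _ _ hf hgi hf₁ hgi₁)).mul
    ((hG _ _ hfi hg hfi₁ hg₁).mul (hG _ _ hfi hgi hfi₁ hgi₁))).mul
    ((hT _ _ hf hg hf₁ hg₁).mul (hT _ _ hf hgi hf₁ hgi₁))

theorem continuous_prod_thetaPM (hp₁ : ‖p‖ < 1) {y : ℂ} (hy : y ≠ 0) {n : ℕ}
    {z : X → Fin n → ℂ} (hz : Continuous z) (hz₁ : ∀ s i, ‖z s i‖ = 1) (S : Finset (Fin n)) :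
    Continuous fun s => ∏ j ∈ S, thetaPM p y (z s j) := by
  have hz' : ∀ i, Continuous fun s => z s i := fun i => (continuous_apply i).comp hz
  have hz₀ : ∀ s i, z s i ≠ 0 := fun s i => ne_zero_of_norm_eq_one (hz₁ s i)
  refine continuous_finsetProd _ fun i _ => ?_
  exact (continuous_theta_comp hp₁ (continuous_const.mul (hz' i)) fun s =>
    mul_ne_zero hy (hz₀ s i)).mul (continuous_theta_comp hp₁
      (continuous_const.div (hz' i) fun s => hz₀ s i) fun s => div_ne_zero hy (hz₀ s i))

end Continuity

/-- The product of `Ψ` with the left-hand side of the kernel identity. -/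
noncomputable def kernelSum {n : ℕ} (p q t : ℂ) (c : Fin 6 → ℂ) (y : ℂ) (z : Fin n → ℂ) : ℂ :=
  ∑ k, (kernelOne p q c (z k) * (∏ j ∈ Finset.univ.erase k, kernelPair p q t (z k) (z j)) +
    kernelOne p q c (z k)⁻¹ * ∏ j ∈ Finset.univ.erase k, kernelPair p q t (z k)⁻¹ (z j)) *
      (psiRest p q t c k z * ∏ j ∈ Finset.univ.erase k, thetaPM p y (z j))

variable {c : Fin 6 → ℂ} {n : ℕ}

theorem Psi_mul_shiftFactor (hp₁ : ‖p‖ < 1) (hq₁ : ‖q‖ < 1) (hq₀ : q ≠ 0)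
    (ht : t ≠ 0) (ht₁ : ‖t‖ < 1) (hc : ∀ m, c m ≠ 0) (hc₁ : ∀ m, ‖c m‖ < 1) {z : Fin n → ℂ}
    (hz : ∀ i, ‖z i‖ = 1) (k : Fin n) {x : ℂ} (hx : x = z k ∨ x = (z k)⁻¹)
    (h1 : theta p (x ^ 2) ≠ 0) (h2 : ∀ j ∈ Finset.univ.erase k, thetaPM p x (z j) ≠ 0) :
    Psi n p q t c z * shiftFactor p t c (Finset.univ.erase k) z x =
      kernelOne p q c x * (∏ j ∈ Finset.univ.erase k, kernelPair p q t x (z j)) *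
        psiRest p q t c k z := by
  have hxn : ‖x‖ = 1 := by rcases hx with rfl | rfl <;> simp [hz]
  have e1 : psiOne p q c (z k) = psiOne p q c x := by
    rcases hx with rfl | rfl; exacts [rfl, (psiOne_inv _ _ _ _).symm]
  have e2 : ∀ w, psiPair p q t (z k) w = psiPair p q t x w := by
    intro w; rcases hx with rfl | rfl; exacts [rfl, (psiPair_inv_left _ _ _ _ _).symm]
  rw [Psi_eq_mul_psiRest p q t c k, shiftFactor, e1,
    ← psiOne_mul_eq_kernelOne hp₁ hq₁ hq₀ hc hc₁ hxn h1,
    Finset.prod_congr rfl fun j hj =>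
      (psiPair_mul_eq_kernelPair hp₁ hq₁ hq₀ ht ht₁ hxn (hz j) (h2 j hj)).symm,
    Finset.prod_mul_distrib]
  simp only [e2]
  ring

theorem kernelSum_eq_of_generic (hp₁ : ‖p‖ < 1) (hq₁ : ‖q‖ < 1) (hq₀ : q ≠ 0)
    (ht : t ≠ 0) (ht₁ : ‖t‖ < 1) (hc : ∀ m, c m ≠ 0) (hc₁ : ∀ m, ‖c m‖ < 1) (y : ℂ)
    {z : Fin n → ℂ} (hz : ∀ i, ‖z i‖ = 1) (hgen : ThetaGeneric p t z) :
    kernelSum p q t c y z = Psi n p q t c z *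
      ∑ k, (shiftFactor p t c (Finset.univ.erase k) z (z k)
        + shiftFactor p t c (Finset.univ.erase k) z (z k)⁻¹) *
          ∏ j ∈ Finset.univ.erase k, thetaPM p y (z j) := by
  rw [kernelSum, Finset.mul_sum]
  refine Finset.sum_congr rfl fun k _ => ?_
  have h2 : ∀ j ∈ Finset.univ.erase k, thetaPM p (z k) (z j) ≠ 0 := fun j hj =>
    mul_ne_zero (hgen.mul _ _ (Finset.ne_of_mem_erase hj).symm)
      (hgen.div _ _ (Finset.ne_of_mem_erase hj).symm)
  have e1 := Psi_mul_shiftFactor hp₁ hq₁ hq₀ ht ht₁ hc hc₁ hz k (Or.inl rfl) (hgen.sq k) h2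
  have e2 := Psi_mul_shiftFactor hp₁ hq₁ hq₀ ht ht₁ hc hc₁ hz k (Or.inr rfl)
    (by rw [inv_pow]; exact theta_inv_ne_zero hp₁ (pow_ne_zero 2 (hgen.ne_zero k)) (hgen.sq k))
    (fun j hj => by
      rw [thetaPM_inv_left hp₁ (hgen.ne_zero k) (hgen.ne_zero j)]
      exact div_ne_zero (h2 j hj) (pow_ne_zero 2 (hgen.ne_zero k)))
  linear_combination (-(∏ j ∈ Finset.univ.erase k, thetaPM p y (z j))) * (e1 + e2)

/-- The coordinates are rotated at the different speeds 1, 2, …, n. Every degenerate relation then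
carries a nonzero exponent, namely 2(i+1), i+j+2 or i-j with i ≠ j, and excludes only countably many
s. The conditions involving t hold automatically on the torus since ‖p‖ < ‖t‖ < 1. -/
theorem exists_dense_thetaGeneric (hp₁ : ‖p‖ < 1) (hp₀ : p ≠ 0) (ht : ‖p‖ < ‖t‖) (ht₁ : ‖t‖ < 1)
    (z : Fin n → ℂ) (hz : ∀ i, ‖z i‖ = 1) :
    Dense {s : ℝ | ThetaGeneric p t fun j =>
      z j * Complex.exp (s * Complex.I) ^ ((j : ℕ) + 1)} := by
  let bad : ℂ → ℤ → Set ℂ := fun c k => {y | y ≠ 0 ∧ theta p (c * y ^ k) = 0}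
  let C : Set ℂ := (⋃ i, bad (z i ^ 2) (2 * ((i : ℕ) + 1))) ∪
    ((⋃ i, ⋃ j, bad (z i * z j) ((i : ℕ) + j + 2)) ∪
      ⋃ i, ⋃ j, ⋃ _ : i ≠ j, bad (z i / z j) ((i : ℕ) - j))
  have hz₀ : ∀ i, z i ≠ 0 := fun i => ne_zero_of_norm_eq_one (hz i)
  have hb : ∀ c ≠ 0, ∀ k ≠ 0, (bad c k).Countable := fun c hc k hk =>
    countable_theta_zpow_eq_zero hp₁ hp₀ hc hk
  have hC : C.Countable := by
    refine (Set.countable_iUnion fun i => hb _ (pow_ne_zero 2 (hz₀ i)) _ (by omega)).union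
      ((Set.countable_iUnion fun i => Set.countable_iUnion fun j =>
        hb _ (mul_ne_zero (hz₀ i) (hz₀ j)) _ (by omega)).union
      (Set.countable_iUnion fun i => Set.countable_iUnion fun j => Set.countable_iUnion fun h =>
        hb _ (div_ne_zero (hz₀ i) (hz₀ j)) _ (fun h' => h (Fin.ext (by omega)))))
  have hC' : ((fun s : ℝ => Complex.exp (s * Complex.I)) ⁻¹' C).Countable :=
    hC.preimage_cexp.preimage_of_injOn (f := fun s : ℝ => (s : ℂ) * Complex.I)
      (fun a _ b _ h => by simpa using h)
  refine (hC'.dense_compl ℝ).mono fun s hs => ?_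
  have hs' : Complex.exp (s * Complex.I) ∉ C := hs
  have he : ‖Complex.exp (s * Complex.I)‖ = 1 := Complex.norm_exp_ofReal_mul_I s
  have he0 := Complex.exp_ne_zero (s * Complex.I)
  rw [Set.mem_ofPred_eq]
  generalize Complex.exp (s * Complex.I) = e at *
  simp only [C, bad, Set.mem_union, Set.mem_iUnion, Set.mem_ofPred_eq, not_or, not_exists,
    not_and] at hs'
  obtain ⟨g1, g2, g3⟩ := hs'
  have hn : ∀ i : Fin n, ‖z i * e ^ ((i : ℕ) + 1)‖ = 1 := fun i => by
    rw [norm_mul, norm_pow, he, hz, one_pow, one_mul]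
  refine ⟨fun i => ne_zero_of_norm_eq_one (hn i), fun i => ?_, fun i => ?_, fun i => ?_,
    fun i j _ => ?_, fun i j hij => ?_⟩
  · convert g1 i he0 using 2
    rw [mul_pow, ← pow_mul]; norm_cast; rw [mul_comm 2]
  · exact theta_ne_zero_of_norm hp₁ (by rw [norm_mul, norm_pow, hn, one_pow, mul_one]; exact ht)
      (by rw [norm_mul, norm_pow, hn, one_pow, mul_one]; exact ht₁)
  · exact theta_ne_zero_of_norm hp₁ (by rw [norm_div, norm_pow, hn, one_pow, div_one]; exact ht)
      (by rw [norm_div, norm_pow, hn, one_pow, div_one]; exact ht₁)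
  · convert g2 i j he0 using 2
    rw [mul_mul_mul_comm, ← pow_add]; norm_cast; ring_nf
  · convert g3 i j hij he0 using 2
    rw [zpow_sub₀ he0, zpow_natCast, zpow_natCast]
    field_simp
    ring

/-- Both sides are continuous along the rotated points, and they agree at the dense set of generic
ones by the kernel identity; the value at s = 0 is the claim. The regular form `kernelSum` makes
this possible, since the shift factors themselves have poles on the torus. -/
theorem kernelSum_eq (hp₁ : ‖p‖ < 1) (hp₀ : p ≠ 0) (hq₁ : ‖q‖ < 1) (hq₀ : q ≠ 0)
    (ht : ‖p‖ < ‖t‖) (ht₁ : ‖t‖ < 1) (hc : ∀ m, c m ≠ 0) (hc₁ : ∀ m, ‖c m‖ < 1) {y : ℂ}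
    (hy : ‖p‖ < ‖y‖) (hy₁ : ‖y‖ < 1) (h1 : theta p (y ^ 2) ≠ 0) (h2 : theta p (t * y ^ 2) ≠ 0)
    (h3 : theta p (t / y ^ 2) ≠ 0) {A₁ A₂ B : ℂ}
    (hid : ∀ z : Fin n → ℂ, ThetaGeneric p t (optionCons y z) →
          theta p t * y * ∑ k, (shiftFactor p t c (Finset.univ.erase k) z (z k)
            + shiftFactor p t c (Finset.univ.erase k) z (z k)⁻¹) *
              ∏ j ∈ Finset.univ.erase k, thetaPM p y (z j) =
          A₁ * ∏ j, thetaPM p (t * y) (z j) + A₂ * ∏ j, thetaPM p (t / y) (z j) +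
            B * ∏ j, thetaPM p y (z j)) {z : Fin n → ℂ} (hz : ∀ i, ‖z i‖ = 1) :
    theta p t * y * kernelSum p q t c y z = A₁ * ((∏ j, thetaPM p (t * y) (z j)) * Psi n p q t c z)
      + A₂ * ((∏ j, thetaPM p (t / y) (z j)) * Psi n p q t c z)
      + B * ((∏ j, thetaPM p y (z j)) * Psi n p q t c z) := by
  have ht₀ : t ≠ 0 := norm_pos_iff.1 ((norm_nonneg p).trans_lt ht)
  have hy₀ : y ≠ 0 := norm_pos_iff.1 ((norm_nonneg p).trans_lt hy)
  let Z : ℝ → Fin n → ℂ := fun s j => z j * Complex.exp (s * Complex.I) ^ ((j : ℕ) + 1)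
  have hZc : Continuous Z := by fun_prop
  have hZ₁ : ∀ s i, ‖Z s i‖ = 1 := fun s i => by
    simp only [Z]
    rw [norm_mul, norm_pow, Complex.norm_exp_ofReal_mul_I, hz, one_pow, one_mul]
  have hZi : ∀ i, Continuous fun s => Z s i := fun i => (continuous_apply i).comp hZc
  have hZii : ∀ i, Continuous fun s => (Z s i)⁻¹ := fun i =>
    (hZi i).inv₀ fun s => ne_zero_of_norm_eq_one (hZ₁ s i)
  have hZii₁ : ∀ i s, ‖(Z s i)⁻¹‖ = 1 := fun i s => by rw [norm_inv, hZ₁, inv_one]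
  have hPsi := continuous_Psi hp₁ hq₁ ht₀ ht₁ (continuous_const (y := c)) (fun _ => hc)
    (fun _ => hc₁) hZc hZ₁
  have hcL : Continuous fun s => theta p t * y * kernelSum p q t c y (Z s) := by
    refine continuous_const.mul (continuous_finsetSum _ fun k _ => ?_)
    exact (((continuous_kernelOne hp₁ hq₁ hq₀ (continuous_const (y := c)) (fun _ => hc)
      (fun _ => hc₁) (hZi k) (hZ₁ · k)).mul (continuous_finsetProd _ fun j _ =>
        continuous_kernelPair hp₁ hq₁ hq₀ ht₀ ht₁ (hZi k) (hZ₁ · k) (hZi j) (hZ₁ · j))).add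
      ((continuous_kernelOne hp₁ hq₁ hq₀ (continuous_const (y := c)) (fun _ => hc)
      (fun _ => hc₁) (hZii k) (hZii₁ k)).mul (continuous_finsetProd _ fun j _ =>
        continuous_kernelPair hp₁ hq₁ hq₀ ht₀ ht₁ (hZii k) (hZii₁ k) (hZi j) (hZ₁ · j)))).mul
      ((continuous_psiRest hp₁ hq₁ ht₀ ht₁ (continuous_const (y := c)) (fun _ => hc)
      (fun _ => hc₁) hZc hZ₁ k).mul (continuous_prod_thetaPM hp₁ hy₀ hZc hZ₁ _))
  have hcP : ∀ w ≠ 0, Continuous fun s => (∏ j, thetaPM p w (Z s j)) * Psi n p q t c (Z s) :=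
    fun w hw => (continuous_prod_thetaPM hp₁ hw hZc hZ₁ _).mul hPsi
  have hcR : Continuous fun s =>
      A₁ * ((∏ j, thetaPM p (t * y) (Z s j)) * Psi n p q t c (Z s)) +
      A₂ * ((∏ j, thetaPM p (t / y) (Z s j)) * Psi n p q t c (Z s)) +
      B * ((∏ j, thetaPM p y (Z s j)) * Psi n p q t c (Z s)) := ((continuous_const (y := A₁)).mul (hcP _ (mul_ne_zero ht₀ hy₀))).add
    ((continuous_const (y := A₂)).mul (hcP _ (div_ne_zero ht₀ hy₀))) |>.add
    ((continuous_const (y := B)).mul (hcP _ hy₀))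
  have key := congrFun (hcL.ext_on (exists_dense_thetaGeneric hp₁ hp₀ ht ht₁ z hz) hcR
    fun s (hs : ThetaGeneric p t (Z s)) => ?_) 0
  · have e : Z 0 = z := by funext j; simp [Z]
    simpa only [e] using key
  · have hg : ThetaGeneric p t (optionCons y (Z s)) :=
      thetaGeneric_optionCons hp₁ hy₀ h1 h2 h3 hs
        (fun i => theta_ne_zero_of_norm hp₁ (by rw [norm_mul, hZ₁, mul_one]; exact hy)
          (by rw [norm_mul, hZ₁, mul_one]; exact hy₁))
        (fun i => theta_ne_zero_of_norm hp₁ (by rw [norm_div, hZ₁, div_one]; exact hy)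
          (by rw [norm_div, hZ₁, div_one]; exact hy₁))
    simp only [kernelSum_eq_of_generic hp₁ hq₁ hq₀ ht₀ ht₁ hc hc₁ y (hZ₁ s) hs]
    linear_combination Psi n p q t c (Z s) * hid (Z s) hg

/-- In the k-th summand all factors outside the kernel are independent of z k, so integration in
that variable alone gives zero. -/
theorem torusMean_kernelSum (hp₁ : ‖p‖ < 1) (hq₁ : ‖q‖ < 1) (hq₀ : q ≠ 0)
    (ht : t ≠ 0) (ht₁ : ‖t‖ < 1) (hc : ∀ m, c m ≠ 0) (hc₁ : ∀ m, ‖c m‖ < 1) {y : ℂ}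
    (hy : y ≠ 0) : torusMean (kernelSum (n := n) p q t c y) = 0 := by
  have hZc := continuous_torusMap (n := n)
  have hZ₁ := norm_torusMap (n := n)
  have hZi : ∀ i, Continuous fun θ : Fin n → ℝ => torusMap 0 1 θ i := fun i =>
    (continuous_apply i).comp hZc
  have hZii : ∀ i, Continuous fun θ : Fin n → ℝ => (torusMap 0 1 θ i)⁻¹ := fun i =>
    (hZi i).inv₀ fun s => ne_zero_of_norm_eq_one (hZ₁ s i)
  have hZii₁ : ∀ i (θ : Fin n → ℝ), ‖(torusMap 0 1 θ i)⁻¹‖ = 1 := fun i s => by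
    rw [norm_inv, hZ₁, inv_one]
  have hR : ∀ k, Continuous fun θ : Fin n → ℝ => psiRest p q t c k (torusMap 0 1 θ) *
      ∏ j ∈ Finset.univ.erase k, thetaPM p y (torusMap 0 1 θ j) := fun k =>
    (continuous_psiRest hp₁ hq₁ ht ht₁ (continuous_const (y := c)) (fun _ => hc)
      (fun _ => hc₁) hZc hZ₁ k).mul (continuous_prod_thetaPM hp₁ hy hZc hZ₁ _)
  have h1 : ∀ k, Continuous fun θ : Fin n → ℝ => kernelOne p q c (torusMap 0 1 θ k) *
      ∏ j ∈ Finset.univ.erase k, kernelPair p q t (torusMap 0 1 θ k) (torusMap 0 1 θ j) :=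
    fun k => (continuous_kernelOne hp₁ hq₁ hq₀ (continuous_const (y := c)) (fun _ => hc)
      (fun _ => hc₁) (hZi k) (hZ₁ · k)).mul (continuous_finsetProd _ fun j _ =>
        continuous_kernelPair hp₁ hq₁ hq₀ ht ht₁ (hZi k) (hZ₁ · k) (hZi j) (hZ₁ · j))
  have h2 : ∀ k, Continuous fun θ : Fin n → ℝ => kernelOne p q c (torusMap 0 1 θ k)⁻¹ *
      ∏ j ∈ Finset.univ.erase k, kernelPair p q t (torusMap 0 1 θ k)⁻¹ (torusMap 0 1 θ j) :=
    fun k => (continuous_kernelOne hp₁ hq₁ hq₀ (continuous_const (y := c)) (fun _ => hc)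
      (fun _ => hc₁) (hZii k) (hZii₁ k)).mul (continuous_finsetProd _ fun j _ =>
        continuous_kernelPair hp₁ hq₁ hq₀ ht ht₁ (hZii k) (hZii₁ k) (hZi j) (hZ₁ · j))
  rw [show kernelSum (n := n) p q t c y = fun z => kernelSum p q t c y z from rfl]
  simp only [kernelSum]
  rw [torusMean_finset_sum _ fun k _ => ((h1 k).add (h2 k)).mul (hR k)]
  refine Finset.sum_eq_zero fun k _ => torusMean_eq_zero (((h1 k).add (h2 k)).mul (hR k)) k ?_
  intro z hz
  obtain ⟨i1, i2⟩ := angleIntegral_kernel_eq_zero hp₁ hq₁ hq₀ ht ht₁ hc hc₁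
    (Finset.univ.erase k) z hz
  have hx := continuous_circleMap 0 1
  have hx₁ : ∀ θ, ‖circleMap 0 1 θ‖ = 1 := fun θ => by simp
  have hxi := hx.inv₀ fun θ => ne_zero_of_norm_eq_one (hx₁ θ)
  have hxi₁ : ∀ θ, ‖(circleMap 0 1 θ)⁻¹‖ = 1 := fun θ => by rw [norm_inv, hx₁, inv_one]
  have c1 : Continuous fun θ => kernelOne p q c (circleMap 0 1 θ) *
      ∏ j ∈ Finset.univ.erase k, kernelPair p q t (circleMap 0 1 θ) (z j) :=
    (continuous_kernelOne hp₁ hq₁ hq₀ (continuous_const (y := c)) (fun _ => hc)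
      (fun _ => hc₁) hx hx₁).mul (continuous_finsetProd _ fun j _ =>
        continuous_kernelPair hp₁ hq₁ hq₀ ht ht₁ hx hx₁ continuous_const fun _ => hz j)
  have c2 : Continuous fun θ => kernelOne p q c (circleMap 0 1 θ)⁻¹ *
      ∏ j ∈ Finset.univ.erase k, kernelPair p q t (circleMap 0 1 θ)⁻¹ (z j) :=
    (continuous_kernelOne hp₁ hq₁ hq₀ (continuous_const (y := c)) (fun _ => hc)
      (fun _ => hc₁) hxi hxi₁).mul (continuous_finsetProd _ fun j _ =>
        continuous_kernelPair hp₁ hq₁ hq₀ ht ht₁ hxi hxi₁ continuous_const fun _ => hz j)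
  have e : ∀ x, (∏ j ∈ Finset.univ.erase k, thetaPM p y (Function.update z k x j)) =
      ∏ j ∈ Finset.univ.erase k, thetaPM p y (z j) := fun x =>
    Finset.prod_congr rfl fun j hj => by rw [Function.update_of_ne (Finset.ne_of_mem_erase hj)]
  have e' : ∀ x w, (∏ j ∈ Finset.univ.erase k, kernelPair p q t w (Function.update z k x j)) =
      ∏ j ∈ Finset.univ.erase k, kernelPair p q t w (z j) := fun x w =>
    Finset.prod_congr rfl fun j hj => by rw [Function.update_of_ne (Finset.ne_of_mem_erase hj)]
  rw [angleIntegral] at i1 i2 ⊢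
  simp only [Function.update_self, psiRest_update, e, e']
  rw [intervalIntegral.integral_mul_const, intervalIntegral.integral_add
    (c1.intervalIntegrable _ _) (c2.intervalIntegrable _ _), i1, i2, add_zero, zero_mul]

/-- The integral of `Ψ` against `∏ θ(y z_i^{±1})`. -/
noncomputable def thetaMoment (n : ℕ) (p q t : ℂ) (c : Fin 6 → ℂ) (y : ℂ) : ℂ :=
  torusMean fun z : Fin n → ℂ => (∏ j, thetaPM p y (z j)) * Psi n p q t c z

/-- Multiplied by Ψ and integrated, the kernel identity loses its left-hand side. The identity is
carried along with the integrated relation so that both refer to the same coefficients. -/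
theorem thetaMoment_relation (hp₁ : ‖p‖ < 1) (hp₀ : p ≠ 0) (hq₁ : ‖q‖ < 1) (hq₀ : q ≠ 0)
    (ht : ‖p‖ < ‖t‖) (ht₁ : ‖t‖ < 1) (hc : ∀ m, c m ≠ 0) (hc₁ : ∀ m, ‖c m‖ < 1)
    (hbal : (∏ m, c m) * t ^ (2 * n) = p * t ^ 2) {y : ℂ}
    (hy : ‖p‖ < ‖y‖) (hy₁ : ‖y‖ < 1) (h1 : theta p (y ^ 2) ≠ 0) (h2 : theta p (t * y ^ 2) ≠ 0)
    (h3 : theta p (t / y ^ 2) ≠ 0) :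
    ∃ A₁ A₂ B : ℂ, A₁ * thetaMoment n p q t c (t * y) + A₂ * thetaMoment n p q t c (t / y) +
        B * thetaMoment n p q t c y = 0 ∧
      ∀ (ι : Type) [Fintype ι] [DecidableEq ι] (z : ι → ℂ), Fintype.card ι = n →
          ThetaGeneric p t (optionCons y z) →
          theta p t * y * ∑ k, (shiftFactor p t c (Finset.univ.erase k) z (z k)
            + shiftFactor p t c (Finset.univ.erase k) z (z k)⁻¹) *
              ∏ j ∈ Finset.univ.erase k, thetaPM p y (z j) =
          A₁ * ∏ j, thetaPM p (t * y) (z j) + A₂ * ∏ j, thetaPM p (t / y) (z j) +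
            B * ∏ j, thetaPM p y (z j) := by
  have ht₀ : t ≠ 0 := norm_pos_iff.1 ((norm_nonneg p).trans_lt ht)
  have hy₀ : y ≠ 0 := norm_pos_iff.1 ((norm_nonneg p).trans_lt hy)
  obtain ⟨A₁, A₂, B, h⟩ := exists_kernel_identity hp₁ hp₀ ht₀ hc hbal hy₀
  refine ⟨A₁, A₂, B, ?_, h⟩
  have hk := torusMean_const_mul (theta p t * y) (kernelSum (n := n) p q t c y)
  rw [torusMean_kernelSum hp₁ hq₁ hq₀ ht₀ ht₁ hc hc₁ hy₀, mul_zero] at hk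
  have hcP : ∀ w ≠ 0, Continuous fun θ : Fin n → ℝ =>
      (∏ j, thetaPM p w (torusMap 0 1 θ j)) * Psi n p q t c (torusMap 0 1 θ) :=
    fun w hw => (continuous_prod_thetaPM hp₁ hw continuous_torusMap norm_torusMap _).mul
      (continuous_Psi hp₁ hq₁ ht₀ ht₁ (continuous_const (y := c)) (fun _ => hc)
    (fun _ => hc₁) continuous_torusMap norm_torusMap)
  rw [torusMean_congr fun z hz => kernelSum_eq hp₁ hp₀ hq₁ hq₀ ht ht₁ hc hc₁ hy hy₁ h1 h2 h3
    (fun z => h (Fin n) z (Fintype.card_fin n)) hz] at hk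
  have i1 := torusIntegrable_of_continuous
    (g := fun z => (∏ j, thetaPM p (t * y) (z j)) * Psi n p q t c z) (hcP _ (mul_ne_zero ht₀ hy₀))
  have i2 := torusIntegrable_of_continuous
    (g := fun z => (∏ j, thetaPM p (t / y) (z j)) * Psi n p q t c z) (hcP _ (div_ne_zero ht₀ hy₀))
  have i3 := torusIntegrable_of_continuous
    (g := fun z => (∏ j, thetaPM p y (z j)) * Psi n p q t c z) (hcP _ hy₀)
  have j1 := TorusIntegrable.const_mul i1 A₁
  have j2 := TorusIntegrable.const_mul i2 A₂
  have j3 := TorusIntegrable.const_mul i3 B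
  have j12 : TorusIntegrable (fun z => A₁ * ((∏ j, thetaPM p (t * y) (z j)) * Psi n p q t c z) +
      A₂ * ((∏ j, thetaPM p (t / y) (z j)) * Psi n p q t c z)) 0 1 := j1.add j2
  rwa [torusMean_add j12 j3, torusMean_add j1 j2,
    torusMean_const_mul, torusMean_const_mul, torusMean_const_mul] at hk

end TorusRelation


/-! ### Holomorphic dependence on a parameter. -/

section ParametricIntegral

open MeasureTheory

/-- A bound M for the integrand on a compact neighbourhood yields, by Cauchy's estimate, the bound M
/ r for its derivative on a smaller ball, so differentiation under the integral is dominated. -/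
theorem differentiableAt_setIntegral_of_continuousOn {n : ℕ} {U : Set ℂ} (hU : IsOpen U)
    {f : ℂ → (Fin n → ℝ) → ℂ} (hc : ContinuousOn (Function.uncurry f) (U ×ˢ Set.univ))
    (hd : ∀ θ, ∀ x ∈ U, DifferentiableAt ℂ (fun x => f x θ) x) {K : Set (Fin n → ℝ)}
    (hK : IsCompact K) {x₀ : ℂ} (hx₀ : x₀ ∈ U) :
    DifferentiableAt ℂ (fun x => ∫ θ in K, f x θ) x₀ := by
  obtain ⟨ε, hε, hεU⟩ := Metric.isOpen_iff.1 hU x₀ hx₀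
  set r := ε / 3 with hr
  have hr0 : 0 < r := by positivity
  have hsub : Metric.closedBall x₀ (2 * r) ⊆ U := fun x hx => hεU (by
    rw [Metric.mem_closedBall] at hx
    rw [Metric.mem_ball]; linarith)
  obtain ⟨M, hM⟩ := ((isCompact_closedBall x₀ (2 * r)).prod hK).exists_bound_of_continuousOn
    (hc.mono (Set.prod_mono hsub (Set.subset_univ K)))
  have hcx : ∀ x ∈ U, Continuous (f x) := fun x hx => by
    have : ContinuousOn (fun θ => Function.uncurry f (x, θ)) Set.univ :=
      hc.comp (by fun_prop) fun θ _ => ⟨hx, trivial⟩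
    exact continuousOn_univ.1 this
  have hmeas : ∀ x ∈ U, AEStronglyMeasurable (f x) (volume.restrict K) := fun x hx =>
    (hcx x hx).aestronglyMeasurable
  refine (hasDerivAt_integral_of_dominated_loc_of_deriv_le (F := f)
    (F' := fun x θ => deriv (fun x => f x θ) x) (bound := fun _ => M / r)
    (Metric.ball_mem_nhds x₀ hr0) ?_ ?_ ?_ ?_ ?_ ?_).2.differentiableAt
  · filter_upwards [hU.mem_nhds hx₀] with x hx using hmeas x hx
  · exact (hcx x₀ hx₀).continuousOn.integrableOn_compact hK
  · have hseq : Tendsto (fun k : ℕ => (r / (k + 1 : ℝ) : ℝ)) atTop (𝓝 0) := by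
      have := tendsto_one_div_add_atTop_nhds_zero_nat (𝕜 := ℝ)
      simpa [div_eq_mul_inv] using this.const_mul r
    have hseq' : Tendsto (fun k : ℕ => ((r / (k + 1 : ℝ) : ℝ) : ℂ)) atTop (𝓝[≠] 0) := by
      refine tendsto_nhdsWithin_iff.2 ⟨by
        have h := (Complex.continuous_ofReal.tendsto 0).comp hseq
        rw [Complex.ofReal_zero] at h
        exact h, Eventually.of_forall
        fun k => ?_⟩
      have : (r / (k + 1 : ℝ) : ℝ) ≠ 0 := by positivity
      simpa only [Set.mem_compl_iff, Set.mem_singleton_iff, Complex.ofReal_eq_zero] using this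
    refine aestronglyMeasurable_of_tendsto_ae atTop (f := fun (k : ℕ) θ =>
      ((r / (k + 1 : ℝ) : ℝ) : ℂ)⁻¹ • (f (x₀ + (r / (k + 1 : ℝ) : ℝ)) θ - f x₀ θ)) (fun k => ?_)
      (Eventually.of_forall fun θ => ((hd θ x₀ hx₀).hasDerivAt.tendsto_slope_zero).comp hseq')
    have hk : r / (k + 1 : ℝ) ≤ r := div_le_self hr0.le (by linarith [k.cast_nonneg (α := ℝ)])
    have hk0 : 0 ≤ r / (k + 1 : ℝ) := by positivity
    have hmem : x₀ + ((r / (k + 1 : ℝ) : ℝ) : ℂ) ∈ U := hsub ?_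
    · exact ((hmeas _ hmem).sub (hmeas _ hx₀)).const_smul (((r / (k + 1 : ℝ) : ℝ) : ℂ)⁻¹)
    rw [Metric.mem_closedBall, dist_eq_norm, add_sub_cancel_left, Complex.norm_real,
      Real.norm_of_nonneg hk0]
    linarith
  · refine ae_restrict_of_forall_mem hK.measurableSet fun θ hθ x hx => ?_
    have hxb : Metric.closedBall x r ⊆ Metric.closedBall x₀ (2 * r) :=
      Metric.closedBall_subset_closedBall' (by rw [Metric.mem_ball] at hx; linarith)
    refine Complex.norm_deriv_le_of_forall_mem_sphere_norm_le hr0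
      (DifferentiableOn.diffContOnCl fun w hw => ?_) fun w hw => ?_
    · rw [closure_ball _ hr0.ne'] at hw
      exact (hd θ w (hsub (hxb hw))).differentiableWithinAt
    · exact hM (w, θ) ⟨hxb (Metric.sphere_subset_closedBall hw), hθ⟩
  · exact integrableOn_const hK.measure_lt_top.ne
  · refine Eventually.of_forall fun θ x hx => (hd θ x (hsub ?_)).hasDerivAt
    rw [Metric.mem_ball] at hx
    rw [Metric.mem_closedBall]; linarith

end ParametricIntegral

/-! ### Theta moments as shifted integrals. -/

section PsiMean

variable {p q t : ℂ} {n : ℕ}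

theorem differentiableAt_torusMean_Psi (hp₁ : ‖p‖ < 1) (hq₁ : ‖q‖ < 1) (ht : t ≠ 0)
    (ht₁ : ‖t‖ < 1) {U : Set ℂ} (hU : IsOpen U) {c : ℂ → Fin 6 → ℂ}
    (hc : ∀ m, ∀ x ∈ U, DifferentiableAt ℂ (fun x => c x m) x) (hc₀ : ∀ x ∈ U, ∀ m, c x m ≠ 0)
    (hc₁ : ∀ x ∈ U, ∀ m, ‖c x m‖ < 1) {x : ℂ} (hx : x ∈ U) :
    DifferentiableAt ℂ (fun x => torusMean (Psi n p q t (c x))) x := by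
  refine differentiableAt_setIntegral_of_continuousOn hU
    (f := fun x θ => Psi n p q t (c x) (torusMap 0 1 θ)) ?_ (fun θ x hx => ?_) isCompact_Icc hx
  · rw [continuousOn_iff_continuous_domRestrict]
    refine continuous_Psi hp₁ hq₁ ht ht₁ (X := ↥(U ×ˢ (Set.univ : Set (Fin n → ℝ))))
      (c := fun s => c s.1.1) ?_ (fun s => hc₀ _ s.2.1)
      (fun s => hc₁ _ s.2.1) (z := fun s => torusMap 0 1 s.1.2)
      (continuous_torusMap.comp (by fun_prop)) (fun s => norm_torusMap _)
    refine continuous_pi fun m => continuous_iff_continuousAt.2 fun s => ?_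
    exact (hc m _ s.2.1).continuousAt.comp (f := fun s : ↥(U ×ˢ (Set.univ : Set (Fin n → ℝ))) =>
      s.1.1) (by fun_prop)
  · have hz := norm_torusMap θ
    simp only [Psi_eq_prod, psiOne, eGammaPM]
    refine (DifferentiableAt.fun_finsetProd fun i _ => DifferentiableAt.div_const
      (DifferentiableAt.fun_finsetProd fun m _ => ?_) _).mul_const _
    refine (differentiableAt_eGamma_comp hp₁ hq₁ ((hc m x hx).mul_const _)
      (mul_ne_zero (hc₀ x hx m) (ne_zero_of_norm_eq_one (hz i))) ?_).mul
      (differentiableAt_eGamma_comp hp₁ hq₁ ((hc m x hx).mul_const _)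
      (mul_ne_zero (hc₀ x hx m) (inv_ne_zero (ne_zero_of_norm_eq_one (hz i)))) ?_)
    · rw [norm_mul, hz, mul_one]; exact hc₁ x hx m
    · rw [norm_mul, norm_inv, hz, inv_one, mul_one]; exact hc₁ x hx m

/-- By Γ(qu) = θ(u;p)Γ(u), the theta factors at y = c i are absorbed into the gamma functions of the
i-th parameter. Values of the theta moment at the parameters are therefore integrals with one
parameter multiplied by q. -/
theorem prod_thetaPM_mul_Psi (hp₁ : ‖p‖ < 1) (hq₁ : ‖q‖ < 1) (hq₀ : q ≠ 0) {c : Fin 6 → ℂ}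
    (hc : ∀ m, c m ≠ 0) (hc₁ : ∀ m, ‖c m‖ < 1) (i : Fin 6) {z : Fin n → ℂ}
    (hz : ∀ j, ‖z j‖ = 1) :
    (∏ j, thetaPM p (c i) (z j)) * Psi n p q t c z =
      Psi n p q t (Function.update c i (q * c i)) z := by
  have h : ∀ j, thetaPM p (c i) (z j) * psiOne p q c (z j) =
      psiOne p q (Function.update c i (q * c i)) (z j) := by
    intro j
    have e : ∏ m ∈ Finset.univ.erase i,
        eGammaPM p q (Function.update c i (q * c i) m) (z j) =
        ∏ m ∈ Finset.univ.erase i, eGammaPM p q (c m) (z j) :=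
      Finset.prod_congr rfl fun m hm => by rw [Function.update_of_ne (Finset.ne_of_mem_erase hm)]
    have hz₀ := ne_zero_of_norm_eq_one (hz j)
    have e1 := eGamma_mul (p := p) hp₁ hq₁ hq₀ (mul_ne_zero (hc i) hz₀)
      (by rw [norm_mul, hz, mul_one]; exact hc₁ i)
    have e2 := eGamma_mul (p := p) hp₁ hq₁ hq₀ (mul_ne_zero (hc i) (inv_ne_zero hz₀))
      (by rw [norm_mul, norm_inv, hz, inv_one, mul_one]; exact hc₁ i)
    rw [psiOne, psiOne, ← Finset.mul_prod_erase _ _ (Finset.mem_univ i),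
      ← Finset.mul_prod_erase _ (fun m => eGammaPM p q (Function.update c i (q * c i) m) (z j))
      (Finset.mem_univ i), e, Function.update_self, eGammaPM, eGammaPM, eGammaPM, mul_assoc q, mul_assoc q,
      e1, e2, thetaPM, div_eq_mul_inv (c i)]
    ring
  rw [Psi_eq_prod, Psi_eq_prod, ← mul_assoc, ← Finset.prod_mul_distrib]
  simp only [h]

theorem thetaMoment_self (hp₁ : ‖p‖ < 1) (hq₁ : ‖q‖ < 1) (hq₀ : q ≠ 0) {c : Fin 6 → ℂ}
    (hc : ∀ m, c m ≠ 0) (hc₁ : ∀ m, ‖c m‖ < 1) (i : Fin 6) :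
    thetaMoment n p q t c (c i) =
      torusMean (Psi n p q t (Function.update c i (q * c i))) :=
  torusMean_congr fun _ hz => prod_thetaPM_mul_Psi hp₁ hq₁ hq₀ hc hc₁ i hz

theorem thetaMoment_eq_nodeProd (hp₁ : ‖p‖ < 1) (hp₀ : p ≠ 0) (hq₁ : ‖q‖ < 1)
    (ht : t ≠ 0) (ht₁ : ‖t‖ < 1) {c : Fin 6 → ℂ} (hc : ∀ m, c m ≠ 0) (hc₁ : ∀ m, ‖c m‖ < 1)
    {α β : ℂ} (hα : α ≠ 0) (hβ : β ≠ 0) (hgen : NodeGeneric p t α β n) :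
    ∃ L : ℕ → ℂ, ∀ y ≠ 0, thetaMoment n p q t c y =
      ∑ r ∈ Finset.range (n + 1), L r * nodeProd p t α β y r (n - r) := by
  refine exists_node_expansion hp₁ hp₀ ht hα hβ (fun i j hij => ?_) fun s l h => ?_
  · refine mul_ne_zero ?_ ?_
    · have := hgen.prod (i + j) hij
      convert this using 2; ring
    · have := hgen.ratio (i - j)
      convert this using 2
      rw [zpow_sub₀ ht]; norm_cast; field_simp
  · have hcont : ∀ y ∈ s, Continuous fun θ : Fin n → ℝ => l y *
        ((∏ j, thetaPM p (y : ℂ) (torusMap 0 1 θ j)) * Psi n p q t c (torusMap 0 1 θ)) :=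
      fun y _ => continuous_const.mul
        ((continuous_prod_thetaPM hp₁ y.2 continuous_torusMap norm_torusMap _).mul
        (continuous_Psi hp₁ hq₁ ht ht₁ (continuous_const (y := c)) (fun _ => hc)
          (fun _ => hc₁) continuous_torusMap norm_torusMap))
    simp only [thetaMoment, ← torusMean_const_mul]
    rw [← torusMean_finset_sum s (g := fun y z => l y *
      ((∏ j, thetaPM p (y : ℂ) (z j)) * Psi n p q t c z)) hcont]
    have h0 : torusMean (fun _ : Fin n → ℂ => (0 : ℂ)) = 0 := by simp [torusMean]
    refine (torusMean_congr fun z hz => ?_).trans h0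
    have := h z fun i => ne_zero_of_norm_eq_one (hz i)
    simp only [← mul_assoc]
    rw [← Finset.sum_mul, this, zero_mul]

theorem torusMean_Psi_ratio_of_generic (hp₁ : ‖p‖ < 1) (hp₀ : p ≠ 0) (hq₁ : ‖q‖ < 1)
    (hq₀ : q ≠ 0) (ht : ‖p‖ < ‖t‖) (ht₁ : ‖t‖ < 1) (hn : 0 < n) {c : Fin 6 → ℂ}
    (hc : ∀ m, c m ≠ 0) (hc₁ : ∀ m, ‖c m‖ < 1) (hbal : (∏ m, c m) * t ^ (2 * n) = p * t ^ 2)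
    {i₁ i₂ : Fin 6} (h₁₂ : i₁ ≠ i₂) (hgen : NodeGeneric p t (c i₁) (c i₂) n)
    (hann : ∀ k < n, ‖p‖ < ‖c i₁ * t ^ k‖) :
    torusMean (Psi n p q t (Function.update c i₂ (q * c i₂))) *
        ∏ s ∈ Finset.range n, ∏ k ∈ (Finset.univ.erase i₁).erase i₂,
          theta p (c k * (c i₁ * t ^ s)) =
      torusMean (Psi n p q t (Function.update c i₁ (q * c i₁))) *
        ∏ s ∈ Finset.range n, ∏ k ∈ (Finset.univ.erase i₁).erase i₂,
          theta p (c k * (c i₂ * t ^ s)) := by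
  have ht₀ : t ≠ 0 := norm_pos_iff.1 ((norm_nonneg p).trans_lt ht)
  obtain ⟨L, hL⟩ := thetaMoment_eq_nodeProd (q := q) (n := n) hp₁ hp₀ hq₁ ht₀ ht₁ hc hc₁ (hc i₁)
    (hc i₂) hgen
  have hrec := node_recursion hp₁ hp₀ ht₀ rfl rfl (hc i₁) (hc i₂) hn hgen
    (fun k hk => ⟨hann k hk, by
      rw [norm_mul, norm_pow]
      exact (mul_le_of_le_one_right (norm_nonneg _)
        (pow_le_one₀ (norm_nonneg _) ht₁.le)).trans_lt (hc₁ i₁)⟩) hL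
    fun y hy hy₁ h1 h2 h3 => thetaMoment_relation hp₁ hp₀ hq₁ hq₀ ht ht₁ hc hc₁ hbal hy hy₁ h1 h2 h3
  have hfin := node_ratio hp₁ ht₀ h₁₂ rfl rfl (hc i₁) (hc i₂) hgen hrec
  -- At y = β every node whose second block is nonempty contains the factor θ(β/β) = 0, which leaves
  -- the pure α node; the value at y = α leaves the pure β node for the same reason.
  have e2 : thetaMoment n p q t c (c i₂) = L n * nodeProd p t (c i₁) (c i₂) (c i₂) n 0 := by
    rw [hL _ (hc i₂), Finset.sum_eq_single n, Nat.sub_self]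
    · intro r hr hrn
      have : 0 < n - r := by have := Finset.mem_range.1 hr; omega
      rw [nodeProd, Finset.prod_eq_zero (Finset.mem_range.2 this)
        (by rw [pow_zero, mul_one]; exact thetaPM_self hp₁ (hc i₂)), mul_zero, mul_zero]
    · simp
  have e1 : thetaMoment n p q t c (c i₁) = L 0 * nodeProd p t (c i₁) (c i₂) (c i₁) 0 n := by
    rw [hL _ (hc i₁), Finset.sum_eq_single 0, Nat.sub_zero]
    · intro r hr hrn
      rw [nodeProd, Finset.prod_eq_zero (Finset.mem_range.2 (Nat.pos_of_ne_zero hrn))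
        (by rw [pow_zero, mul_one]; exact thetaPM_self hp₁ (hc i₁)), zero_mul, mul_zero]
    · simp
  rw [← thetaMoment_self hp₁ hq₁ hq₀ hc hc₁, ← thetaMoment_self hp₁ hq₁ hq₀ hc hc₁, e1, e2]
  exact hfin

end PsiMean


/-! ### Removing genericity: transfer between two parameters. -/

section Ratio

variable {p q t : ℂ} {n : ℕ} {c : Fin 6 → ℂ}

/-- The tuple `c` with `c i₁` replaced by `x` and `c i₂` replaced so that the product of the two
entries is unchanged. -/
noncomputable def transfer (c : Fin 6 → ℂ) (i₁ i₂ : Fin 6) (x : ℂ) : Fin 6 → ℂ :=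
  Function.update (Function.update c i₁ x) i₂ (c i₁ * c i₂ / x)

theorem transfer_left {i₁ i₂ : Fin 6} (h : i₁ ≠ i₂) (c : Fin 6 → ℂ) (x : ℂ) :
    transfer c i₁ i₂ x i₁ = x := by
  rw [transfer, Function.update_of_ne h, Function.update_self]

theorem transfer_right (i₁ i₂ : Fin 6) (c : Fin 6 → ℂ) (x : ℂ) :
    transfer c i₁ i₂ x i₂ = c i₁ * c i₂ / x := by
  rw [transfer, Function.update_self]

theorem transfer_of_ne {i₁ i₂ k : Fin 6} (h₁ : k ≠ i₁) (h₂ : k ≠ i₂) (c : Fin 6 → ℂ) (x : ℂ) :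
    transfer c i₁ i₂ x k = c k := by
  rw [transfer, Function.update_of_ne h₂, Function.update_of_ne h₁]

theorem transfer_self {i₁ i₂ : Fin 6} (h : i₁ ≠ i₂) (hc : c i₁ ≠ 0) :
    transfer c i₁ i₂ (c i₁) = c := by
  funext k
  by_cases h₁ : k = i₁
  · rw [h₁, transfer_left h]
  by_cases h₂ : k = i₂
  · rw [h₂, transfer_right, mul_div_cancel_left₀ _ hc]
  · rw [transfer_of_ne h₁ h₂]

theorem prod_transfer {i₁ i₂ : Fin 6} (h : i₁ ≠ i₂) {x : ℂ} (hx : x ≠ 0) :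
    ∏ m, transfer c i₁ i₂ x m = ∏ m, c m := by
  have h2 : i₂ ∈ Finset.univ.erase i₁ := Finset.mem_erase.2 ⟨h.symm, Finset.mem_univ i₂⟩
  rw [← Finset.mul_prod_erase _ _ (Finset.mem_univ i₁), ← Finset.mul_prod_erase _ _ h2,
    ← Finset.mul_prod_erase _ c (Finset.mem_univ i₁), ← Finset.mul_prod_erase _ c h2,
    transfer_left h, transfer_right, Finset.prod_congr rfl fun k hk =>
      transfer_of_ne (Finset.ne_of_mem_erase (Finset.mem_of_mem_erase hk))
        (Finset.ne_of_mem_erase hk) c x]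
  field_simp

theorem forall_transfer {i₁ i₂ : Fin 6} (h : i₁ ≠ i₂) {P : ℂ → Prop} {x : ℂ} (hx : P x)
    (hx' : P (c i₁ * c i₂ / x)) (hc : ∀ m, P (c m)) (m : Fin 6) : P (transfer c i₁ i₂ x m) := by
  by_cases h₁ : m = i₁
  · rw [h₁, transfer_left h]; exact hx
  by_cases h₂ : m = i₂
  · rw [h₂, transfer_right]; exact hx'
  · rw [transfer_of_ne h₁ h₂]; exact hc m

theorem differentiableAt_transfer (c : Fin 6 → ℂ) (i₁ i₂ m : Fin 6) {x : ℂ} (hx : x ≠ 0) :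
    DifferentiableAt ℂ (fun x => transfer c i₁ i₂ x m) x := by
  by_cases h₂ : m = i₂
  · subst h₂
    simp only [transfer_right]
    exact (differentiableAt_const _).div differentiableAt_id hx
  by_cases h₁ : m = i₁
  · subst h₁
    simp only [transfer_left h₂]
    exact differentiableAt_id
  · simp only [transfer_of_ne h₁ h₂]
    exact differentiableAt_const _

/-- The open annulus of those `x` for which the entries of `transfer c i₁ i₂ x` at `i₁` and `i₂`
have norm less than one. -/
def transferDomain (c : Fin 6 → ℂ) (i₁ i₂ : Fin 6) : Set ℂ := {x | ‖c i₁ * c i₂‖ < ‖x‖ ∧ ‖x‖ < 1}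

theorem isOpen_transferDomain (c : Fin 6 → ℂ) (i₁ i₂ : Fin 6) :
    IsOpen (transferDomain c i₁ i₂) :=
  (isOpen_lt continuous_const continuous_norm).inter (isOpen_lt continuous_norm continuous_const)

theorem ne_zero_of_mem_transferDomain {i₁ i₂ : Fin 6} {x : ℂ} (hx : x ∈ transferDomain c i₁ i₂) :
    x ≠ 0 := norm_pos_iff.1 ((norm_nonneg _).trans_lt hx.1)

theorem transfer_ne_zero {i₁ i₂ : Fin 6} (h : i₁ ≠ i₂) (hc : ∀ m, c m ≠ 0) {x : ℂ} (hx : x ≠ 0)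
    (m : Fin 6) : transfer c i₁ i₂ x m ≠ 0 :=
  forall_transfer h (P := (· ≠ 0)) hx (div_ne_zero (mul_ne_zero (hc _) (hc _)) hx) hc m

theorem norm_transfer_lt_one {i₁ i₂ : Fin 6} (h : i₁ ≠ i₂) (hc₁ : ∀ m, ‖c m‖ < 1) {x : ℂ}
    (hx : x ∈ transferDomain c i₁ i₂) (m : Fin 6) : ‖transfer c i₁ i₂ x m‖ < 1 :=
  forall_transfer h (P := (‖·‖ < 1)) hx.2 (by
    rw [norm_div, div_lt_one ((norm_nonneg _).trans_lt hx.1)]; exact hx.1) hc₁ m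

theorem mem_transferDomain_self (i₁ i₂ : Fin 6) (hc : ∀ m, c m ≠ 0) (hc₁ : ∀ m, ‖c m‖ < 1) :
    c i₁ ∈ transferDomain c i₁ i₂ := by
  refine ⟨?_, hc₁ i₁⟩
  rw [norm_mul]
  exact mul_lt_of_lt_one_right (norm_pos_iff.2 (hc i₁)) (hc₁ i₂)

/-- Balancing expresses r as c i₁ c i₂ t^k times the other four parameters and t^{2n-2-k}, whose
exponent is nonnegative for k < n. Together with the obvious upper bound this keeps arguments of
gamma functions (r = pq) and of theta functions (r = p) inside the annulus where they do not vanish.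
-/
theorem norm_balance_lt_mul {r : ℂ} (ht : t ≠ 0) (ht₁ : ‖t‖ < 1) (hc : ∀ m, c m ≠ 0)
    (hc₁ : ∀ m, ‖c m‖ < 1) (hbal : (∏ m, c m) * t ^ (2 * n) = r * t ^ 2) {i₁ i₂ : Fin 6}
    (h : i₁ ≠ i₂) {k : ℕ} (hk : k < n) : ‖r‖ < ‖c i₁ * c i₂ * t ^ k‖ := by
  have h2 : i₂ ∈ Finset.univ.erase i₁ := Finset.mem_erase.2 ⟨h.symm, Finset.mem_univ i₂⟩
  have e : r = c i₁ * c i₂ * t ^ k *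
      ((∏ m ∈ (Finset.univ.erase i₁).erase i₂, c m) * t ^ (2 * n - 2 - k)) := by
    refine mul_right_cancel₀ (pow_ne_zero 2 ht) ?_
    rw [← hbal, ← Finset.mul_prod_erase _ _ (Finset.mem_univ i₁), ← Finset.mul_prod_erase _ _ h2,
      show 2 * n = k + (2 * n - 2 - k) + 2 by omega, pow_add, pow_add]
    simp only [Nat.add_sub_cancel, Nat.add_sub_cancel_left]
    ring
  have hpos : 0 < ‖c i₁ * c i₂ * t ^ k‖ :=
    norm_pos_iff.2 (mul_ne_zero (mul_ne_zero (hc _) (hc _)) (pow_ne_zero _ ht))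
  conv_lhs => rw [e]
  rw [norm_mul]
  refine mul_lt_of_lt_one_right hpos ?_
  rw [norm_mul, norm_pow, norm_prod]
  refine mul_lt_one_of_nonneg_of_lt_one_left (Finset.prod_nonneg fun _ _ => norm_nonneg _) ?_
    (pow_le_one₀ (norm_nonneg _) ht₁.le)
  have hne : ((Finset.univ.erase i₁).erase i₂).Nonempty := by
    rw [← Finset.card_pos, Finset.card_erase_of_mem h2, Finset.card_erase_of_mem (Finset.mem_univ _)]
    simp
  calc ∏ m ∈ (Finset.univ.erase i₁).erase i₂, ‖c m‖
      < ∏ m ∈ (Finset.univ.erase i₁).erase i₂, (1 : ℝ) :=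
        Finset.prod_lt_prod_of_nonempty (fun m _ => norm_pos_iff.2 (hc m)) (fun m _ => hc₁ m) hne
    _ = 1 := Finset.prod_const_one

theorem norm_mul_mul_pow_lt_one (ht₁ : ‖t‖ < 1) (hc₁ : ∀ m, ‖c m‖ < 1) (i₁ i₂ : Fin 6) (k : ℕ) :
    ‖c i₁ * c i₂ * t ^ k‖ < 1 := by
  rw [norm_mul, norm_mul, norm_pow]
  exact mul_lt_one_of_nonneg_of_lt_one_left (by positivity)
    (mul_lt_one_of_nonneg_of_lt_one_left (norm_nonneg _) (hc₁ _) (hc₁ _).le)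
    (pow_le_one₀ (norm_nonneg _) ht₁.le)

theorem norm_lt_norm_pow (ht : ‖p‖ < ‖t‖) (ht₁ : ‖t‖ < 1) (hc : ∀ m, c m ≠ 0)
    (hc₁ : ∀ m, ‖c m‖ < 1) (hbal : (∏ m, c m) * t ^ (2 * n) = p * t ^ 2) {k : ℕ} (hk : k ≤ n) :
    ‖p‖ < ‖t ^ k‖ := by
  have ht₀ : t ≠ 0 := norm_pos_iff.1 ((norm_nonneg p).trans_lt ht)
  -- For k ≥ 2 the bound follows from balancing, since 2n - 2 - k ≥ 0. For k = 0 and 1 it is taken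
  -- from ‖p‖ < ‖t‖ < 1, because that exponent would be negative when n = k = 1.
  rcases k with _ | k
  · rw [pow_zero, norm_one]; exact ht.trans ht₁
  rcases k with _ | k
  · simpa using ht
  have e : p = t ^ (k + 1 + 1) * ((∏ m, c m) * t ^ (2 * n - 2 - (k + 1 + 1))) := by
    refine mul_right_cancel₀ (pow_ne_zero 2 ht₀) ?_
    rw [← hbal, show 2 * n = (k + 1 + 1) + (2 * n - 2 - (k + 1 + 1)) + 2 by omega, pow_add _ _ 2,
      pow_add]
    simp only [Nat.add_sub_cancel, Nat.add_sub_cancel_left]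
    ring
  conv_lhs => rw [e]
  rw [norm_mul]
  refine mul_lt_of_lt_one_right (norm_pos_iff.2 (pow_ne_zero _ ht₀)) ?_
  rw [norm_mul, norm_pow, norm_prod]
  refine mul_lt_one_of_nonneg_of_lt_one_left (Finset.prod_nonneg fun _ _ => norm_nonneg _) ?_
    (pow_le_one₀ (norm_nonneg _) ht₁.le)
  calc ∏ m, ‖c m‖ < ∏ m : Fin 6, (1 : ℝ) :=
        Finset.prod_lt_prod_of_nonempty (fun m _ => norm_pos_iff.2 (hc m)) (fun m _ => hc₁ m)
          Finset.univ_nonempty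
    _ = 1 := Finset.prod_const_one

/-- Moving along `transfer` preserves balancing and keeps both sides continuous, while genericity of
the two parameters fails for countably many x only. The remaining conditions of `NodeGeneric` follow
from norm bounds. -/
theorem torusMean_Psi_ratio (hp₁ : ‖p‖ < 1) (hp₀ : p ≠ 0) (hq₁ : ‖q‖ < 1)
    (hq₀ : q ≠ 0) (ht : ‖p‖ < ‖t‖) (ht₁ : ‖t‖ < 1) (hn : 0 < n)
    (hc : ∀ m, c m ≠ 0) (hc₁ : ∀ m, ‖c m‖ < 1) (hbal : (∏ m, c m) * t ^ (2 * n) = p * t ^ 2)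
    {i₁ i₂ : Fin 6} (h₁₂ : i₁ ≠ i₂) :
    torusMean (Psi n p q t (Function.update c i₂ (q * c i₂))) *
        ∏ s ∈ Finset.range n, ∏ k ∈ (Finset.univ.erase i₁).erase i₂,
          theta p (c k * (c i₁ * t ^ s)) =
      torusMean (Psi n p q t (Function.update c i₁ (q * c i₁))) *
        ∏ s ∈ Finset.range n, ∏ k ∈ (Finset.univ.erase i₁).erase i₂,
          theta p (c k * (c i₂ * t ^ s)) := by
  have ht₀ : t ≠ 0 := norm_pos_iff.1 ((norm_nonneg p).trans_lt ht)
  let F : (Fin 6 → ℂ) → ℂ := fun c =>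
    torusMean (Psi n p q t (Function.update c i₂ (q * c i₂))) *
        ∏ s ∈ Finset.range n, ∏ k ∈ (Finset.univ.erase i₁).erase i₂,
          theta p (c k * (c i₁ * t ^ s)) -
      torusMean (Psi n p q t (Function.update c i₁ (q * c i₁))) *
        ∏ s ∈ Finset.range n, ∏ k ∈ (Finset.univ.erase i₁).erase i₂,
          theta p (c k * (c i₂ * t ^ s))
  set U := transferDomain c i₁ i₂ with hUdef
  have hU := isOpen_transferDomain c i₁ i₂
  have hx₀ : c i₁ ∈ U := mem_transferDomain_self i₁ i₂ hc hc₁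
  have hK : c i₁ * c i₂ ≠ 0 := mul_ne_zero (hc _) (hc _)
  let bad : ℂ → ℤ → Set ℂ := fun c k => {y | y ≠ 0 ∧ theta p (c * y ^ k) = 0}
  have hb : ∀ c ≠ 0, ∀ k ≠ 0, (bad c k).Countable := fun c hc k hk =>
    countable_theta_zpow_eq_zero hp₁ hp₀ hc hk
  let C : Set ℂ := (⋃ k : ℤ, bad (t ^ k) 2) ∪ ((⋃ k : ℤ, bad ((c i₁ * c i₂) ^ 2 * t ^ k) (-2)) ∪
    ⋃ k : ℤ, bad (t ^ k / (c i₁ * c i₂)) 2)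
  have hC : C.Countable := by
    refine (Set.countable_iUnion fun k => hb _ (zpow_ne_zero _ ht₀) _ (by norm_num)).union
      ((Set.countable_iUnion fun k => hb _ (mul_ne_zero (pow_ne_zero 2 hK) (zpow_ne_zero _ ht₀)) _
        (by norm_num)).union (Set.countable_iUnion fun k =>
          hb _ (div_ne_zero (zpow_ne_zero _ ht₀) hK) _ (by norm_num)))
  have hF : F (transfer c i₁ i₂ (c i₁)) = 0 := by
    refine eq_zero_of_eventually_of_countable (f := fun x => F (transfer c i₁ i₂ x)) ?_ hC ?_
    · have hupd : ∀ i, ContinuousAt (fun x => torusMean (Psi n p q t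
          (Function.update (transfer c i₁ i₂ x) i (q * transfer c i₁ i₂ x i)))) (c i₁) := by
        intro i
        refine (differentiableAt_torusMean_Psi hp₁ hq₁ ht₀ ht₁ hU
          (c := fun x => Function.update (transfer c i₁ i₂ x) i (q * transfer c i₁ i₂ x i))
          (fun m x hx => ?_) (fun x hx m => ?_) (fun x hx m => ?_) hx₀).continuousAt
        · by_cases h : m = i
          · subst h
            simp only [Function.update_self]
            exact (differentiableAt_transfer c _ _ _ (ne_zero_of_mem_transferDomain hx)).const_mul _
          · simp only [Function.update_of_ne h]
            exact differentiableAt_transfer c _ _ _ (ne_zero_of_mem_transferDomain hx)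
        · have := transfer_ne_zero h₁₂ hc (ne_zero_of_mem_transferDomain hx)
          by_cases h : m = i
          · subst h
            simp only [Function.update_self]
            exact mul_ne_zero hq₀ (this m)
          · simp only [Function.update_of_ne h]
            exact this m
        · have := norm_transfer_lt_one h₁₂ hc₁ hx
          by_cases h : m = i
          · subst h
            simp only [Function.update_self, norm_mul]
            exact mul_lt_one_of_nonneg_of_lt_one_left (norm_nonneg _) hq₁ (this m).le
          · simp only [Function.update_of_ne h]
            exact this m
      have hth : ∀ i, ContinuousAt (fun x => ∏ s ∈ Finset.range n,
          ∏ k ∈ (Finset.univ.erase i₁).erase i₂, theta p (transfer c i₁ i₂ x k *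
            (transfer c i₁ i₂ x i * t ^ s))) (c i₁) := by
        intro i
        refine tendsto_finsetProd _ fun s _ => tendsto_finsetProd _ fun k _ => ?_
        have hd := fun m => differentiableAt_transfer c i₁ i₂ m (hc i₁)
        have h0 := transfer_ne_zero h₁₂ hc (hc i₁)
        exact (differentiableAt_theta_comp hp₁ ((hd k).mul ((hd i).mul_const _))
          (mul_ne_zero (h0 _) (mul_ne_zero (h0 _) (pow_ne_zero _ ht₀)))).continuousAt
      exact ((hupd i₂).mul (hth i₁)).sub ((hupd i₁).mul (hth i₂))
    · filter_upwards [hU.mem_nhds hx₀] with x hx hxC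
      have hx0 : x ≠ 0 := ne_zero_of_mem_transferDomain hx
      have hd := transfer_ne_zero h₁₂ hc hx0
      have hd₁ := norm_transfer_lt_one h₁₂ hc₁ hx
      have hdb : (∏ m, transfer c i₁ i₂ x m) * t ^ (2 * n) = p * t ^ 2 := by
        rw [prod_transfer h₁₂ hx0, hbal]
      simp only [C, bad, Set.mem_union, Set.mem_iUnion, Set.mem_ofPred_eq, not_or, not_exists,
        not_and] at hxC
      obtain ⟨g1, g2, g3⟩ := hxC
      have hlow : ∀ k < n, ‖p‖ < ‖transfer c i₁ i₂ x i₁ * transfer c i₁ i₂ x i₂ * t ^ k‖ :=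
        fun k hk => norm_balance_lt_mul ht₀ ht₁ hd hd₁ hdb h₁₂ hk
      refine sub_eq_zero.2 (torusMean_Psi_ratio_of_generic hp₁ hp₀ hq₁ hq₀ ht ht₁ hn hd hd₁ hdb h₁₂
        ⟨fun k => ?_, fun k => ?_, fun k => ?_, fun k hk => ?_, fun k hk hkn => ?_⟩ fun k hk => ?_)
      · rw [transfer_left h₁₂]
        convert g1 k hx0 using 2
        rw [mul_comm]; norm_cast
      · rw [transfer_right]
        convert g2 k hx0 using 2
        rw [zpow_neg]; norm_cast; field_simp
      · rw [transfer_left h₁₂, transfer_right]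
        convert g3 k hx0 using 2
        norm_cast; field_simp
      · exact theta_ne_zero_of_norm hp₁ (hlow k hk) (norm_mul_mul_pow_lt_one ht₁ hd₁ _ _ _)
      · refine theta_ne_zero_of_norm hp₁ (norm_lt_norm_pow ht ht₁ hd hd₁ hdb hkn) ?_
        rw [norm_pow]; exact pow_lt_one₀ (norm_nonneg _) ht₁ hk.ne'
      · refine (hlow k hk).trans_le ?_
        rw [mul_right_comm, norm_mul]
        exact mul_le_of_le_one_right (norm_nonneg _) (hd₁ i₂).le
  rw [transfer_self h₁₂ (hc i₁)] at hF
  exact sub_eq_zero.1 hF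

end Ratio


/-! ### Multiplicatively periodic functions on an annulus. -/

section PeriodicAnnulus

/-- A Laurent coefficient is independent of the radius, yet passing from radius ρ₀ to ‖q‖ρ₀
multiplies it by a nontrivial power of q. -/
theorem angleIntegral_zpow_mul_eq_zero_of_periodic {q : ℂ} (hq₀ : q ≠ 0) (hq₁ : ‖q‖ < 1) {κ : ℝ}
    (hκ : 0 ≤ κ) (hκq : κ < ‖q‖) {g : ℂ → ℂ}
    (hg : ∀ x : ℂ, κ < ‖x‖ → ‖x‖ < 1 → DifferentiableAt ℂ g x)
    (hper : ∀ x : ℂ, κ < ‖q * x‖ → ‖x‖ < 1 → g (q * x) = g x) {n : ℤ} (hn : n ≠ 0) {ρ : ℝ}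
    (h1 : κ < ρ) (h2 : ρ < 1) : angleIntegral (fun x => x ^ n * g x) ρ = 0 := by
  have hqp := norm_pos_iff.2 hq₀
  have hdiff : ∀ x : ℂ, κ < ‖x‖ → ‖x‖ < 1 → DifferentiableAt ℂ (fun x => x ^ n * g x) x :=
    fun x h h' =>
      (differentiableAt_zpow.2 (Or.inl (norm_pos_iff.1 (hκ.trans_lt h)))).mul (hg x h h')
  have hle : ∀ r R : ℝ, κ < r → r ≤ R → R < 1 → angleIntegral (fun x => x ^ n * g x) R =
      angleIntegral (fun x => x ^ n * g x) r := fun r R hr hrR hR =>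
    angleIntegral_eq_of_differentiableOn (hκ.trans_lt hr) hrR fun x hx hx' =>
      hdiff x (hr.trans_le hx) (hx'.trans_lt hR)
  have heq : ∀ r R : ℝ, κ < r → r < 1 → κ < R → R < 1 → angleIntegral (fun x => x ^ n * g x) R =
      angleIntegral (fun x => x ^ n * g x) r := fun r R hr hr' hR hR' => by
    rcases le_total r R with h | h
    · exact hle r R hr h hR'
    · exact (hle R r hR h hr').symm
  -- A radius for which both circles lie in the annulus; it exists precisely because κ < ‖q‖.
  obtain ⟨ρ₀, h3, h4⟩ := exists_between ((div_lt_one hqp).2 hκq)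
  have h5 : κ < ‖q‖ * ρ₀ := by rwa [div_lt_iff₀' hqp] at h3
  have h6 : 0 < ρ₀ := (div_nonneg hκ hqp.le).trans_lt h3
  have h7 : ‖q‖ * ρ₀ < 1 := mul_lt_one_of_nonneg_of_lt_one_left hqp.le hq₁ h4.le
  have h8 : ‖q‖ * ρ₀ ≤ ρ₀ := mul_le_of_le_one_left h6.le hq₁.le
  have e1 := heq (‖q‖ * ρ₀) ρ₀ h5 h7 (h5.trans_le h8) h4
  have e2 : angleIntegral (fun x => x ^ n * g x) (‖q‖ * ρ₀) =
      q ^ n * angleIntegral (fun x => x ^ n * g x) ρ₀ := by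
    rw [← angleIntegral_comp_mul, angleIntegral, angleIntegral,
      ← intervalIntegral.integral_const_mul]
    refine intervalIntegral.integral_congr fun θ _ => ?_
    have hx : ‖circleMap 0 ρ₀ θ‖ = ρ₀ := by simp [abs_of_pos h6]
    simp only [hper _ (by rw [norm_mul, hx]; exact h5) (by rw [hx]; exact h4), mul_zpow]
    ring
  have hqn : q ^ n ≠ 1 := by
    intro h
    have h' := congrArg norm h
    rw [norm_zpow, norm_one] at h'
    rcases lt_or_gt_of_ne hn with h0 | h0
    · exact (one_lt_zpow_of_neg₀ hqp hq₁ h0).ne' h'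
    · exact (zpow_lt_one₀ hqp hq₁ h0).ne h'
  rw [heq ρ₀ ρ (h5.trans_le h8) h4 h1 h2]
  have e3 : (1 - q ^ n) * angleIntegral (fun x => x ^ n * g x) ρ₀ = 0 := by
    linear_combination e1 + e2
  exact (mul_eq_zero.1 e3).resolve_left (sub_ne_zero.2 hqn.symm)

/-- Only the coefficient of index zero can survive, so the function equals its mean A throughout the
annulus. -/
theorem eq_of_periodic_on_annulus {q : ℂ} (hq₀ : q ≠ 0) (hq₁ : ‖q‖ < 1) {κ : ℝ}
    (hκ : 0 ≤ κ) (hκq : κ < ‖q‖) {g : ℂ → ℂ}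
    (hg : ∀ x : ℂ, κ < ‖x‖ → ‖x‖ < 1 → DifferentiableAt ℂ g x)
    (hper : ∀ x : ℂ, κ < ‖q * x‖ → ‖x‖ < 1 → g (q * x) = g x) {x y : ℂ}
    (hx : κ < ‖x‖) (hx₁ : ‖x‖ < 1) (hy : κ < ‖y‖) (hy₁ : ‖y‖ < 1) : g x = g y := by
  set A : ℂ := angleIntegral g ‖x‖ / (2 * π) with hA
  have hπ : (2 * (π : ℂ)) ≠ 0 := by exact_mod_cast Real.two_pi_pos.ne'
  have hcont : ∀ ρ : ℝ, κ < ρ → ρ < 1 → ContinuousOn g (Metric.sphere 0 ρ) := fun ρ h h' w hw => by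
    rw [mem_sphere_zero_iff_norm] at hw
    exact (hg w (by rwa [hw]) (by rwa [hw])).continuousAt.continuousWithinAt
  have hint : ∀ ρ : ℝ, κ < ρ → ρ < 1 → angleIntegral g ρ = angleIntegral g ‖x‖ := by
    intro ρ h h'
    rcases le_total ρ ‖x‖ with hle | hle
    · exact (angleIntegral_eq_of_differentiableOn (hκ.trans_lt h) hle fun w hw hw' =>
        hg w (h.trans_le hw) (hw'.trans_lt hx₁)).symm
    · exact angleIntegral_eq_of_differentiableOn (hκ.trans_lt hx) hle fun w hw hw' =>
        hg w (hx.trans_le hw) (hw'.trans_lt h')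
  have key : ∀ w : ℂ, κ < ‖w‖ → ‖w‖ < 1 → g w = A := by
    intro w hw hw₁
    have hpos : 0 < ‖w‖ := hκ.trans_lt hw
    refine sub_eq_zero.1 (eq_zero_of_angleIntegral_zpow_eq_zero (f := fun x => g x - A) hpos
      ((hcont _ hw hw₁).sub continuousOn_const) (fun n => ?_) rfl)
    by_cases hn : n = 0
    · subst hn
      simp only [zpow_zero, one_mul]
      rw [angleIntegral, intervalIntegral.integral_sub, ← angleIntegral, hint _ hw hw₁,
        intervalIntegral.integral_const, hA]
      · simp only [sub_zero, Complex.real_smul]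
        push_cast
        field_simp
        ring
      · refine Continuous.intervalIntegrable ?_ _ _
        exact (hcont _ hw hw₁).comp_continuous (continuous_circleMap 0 ‖w‖) fun θ =>
          circleMap_mem_sphere 0 hpos.le θ
      · exact intervalIntegrable_const
    · exact angleIntegral_zpow_mul_eq_zero_of_periodic hq₀ hq₁ hκ hκq
        (fun x h h' => (hg x h h').sub_const A) (fun x h h' => by rw [hper x h h']) hn hw hw₁
  rw [key x hx hx₁, key y hy hy₁]

end PeriodicAnnulus

/-! ### Constancy of the quotient of the integral by its evaluation. -/

section Constancy

variable {p q t : ℂ} {n : ℕ}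

theorem gammaJ_update (hp₁ : ‖p‖ < 1) (hq₁ : ‖q‖ < 1) (hq₀ : q ≠ 0) (ht : t ≠ 0) (ht₁ : ‖t‖ < 1)
    {c : Fin 6 → ℂ} (hc : ∀ m, c m ≠ 0) (hc₁ : ∀ m, ‖c m‖ < 1) (i : Fin 6) :
    gammaJ n p q t (Function.update c i (q * c i)) = gammaJ n p q t c *
      ∏ s ∈ Finset.range n, ∏ k ∈ Finset.univ.erase i, theta p (c k * (c i * t ^ s)) := by
  rw [gammaJ, gammaJ, Fin.prod_univ_eq_prod_range (fun s => ∏ j, ∏ k ∈ Finset.Ioi j, eGamma p q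
      (Function.update c i (q * c i) j * Function.update c i (q * c i) k * t ^ s)) n,
    Fin.prod_univ_eq_prod_range
      (fun s => ∏ j, ∏ k ∈ Finset.Ioi j, eGamma p q (c j * c k * t ^ s)) n,
    ← Finset.prod_mul_distrib (s := Finset.range n)]
  refine Finset.prod_congr rfl fun s _ => ?_
  rw [prod_prod_Ioi_eq (fun j k => eGamma p q
      (Function.update c i (q * c i) j * Function.update c i (q * c i) k * t ^ s))
      (fun j k => by rw [mul_comm (Function.update c i (q * c i) j)]) i,
    prod_prod_Ioi_eq (fun j k => eGamma p q (c j * c k * t ^ s))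
      (fun j k => by rw [mul_comm (c j)]) i, mul_right_comm]
  refine congrArg₂ (· * ·) ?_ ?_
  · rw [← Finset.prod_mul_distrib]
    refine Finset.prod_congr rfl fun k hk => ?_
    rw [Function.update_self, Function.update_of_ne (Finset.ne_of_mem_erase hk),
      show q * c i * c k * t ^ s = q * (c i * c k * t ^ s) by ring,
      eGamma_mul hp₁ hq₁ hq₀ (mul_ne_zero (mul_ne_zero (hc _) (hc _)) (pow_ne_zero _ ht))
        (norm_mul_mul_pow_lt_one ht₁ hc₁ _ _ _),
      show c i * c k * t ^ s = c k * (c i * t ^ s) by ring, mul_comm]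
  · refine Finset.prod_congr rfl fun j hj => Finset.prod_congr rfl fun k hk => ?_
    rw [Function.update_of_ne (Finset.ne_of_mem_erase hj),
      Function.update_of_ne (Finset.ne_of_mem_erase hk)]

/-- A shift of one parameter multiplies J by thetas over the five pairs containing it. The pair (i₁,
i₂) contributes equally to both shifts, and the other four pairs give exactly the products in
`torusMean_Psi_ratio`. -/
theorem torusMean_Psi_mul_gammaJ_update (hp₁ : ‖p‖ < 1) (hp₀ : p ≠ 0) (hq₁ : ‖q‖ < 1)
    (hq₀ : q ≠ 0) (ht : ‖p‖ < ‖t‖) (ht₁ : ‖t‖ < 1) (hn : 0 < n) {c : Fin 6 → ℂ}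
    (hc : ∀ m, c m ≠ 0) (hc₁ : ∀ m, ‖c m‖ < 1) (hbal : (∏ m, c m) * t ^ (2 * n) = p * t ^ 2)
    {i₁ i₂ : Fin 6} (h₁₂ : i₁ ≠ i₂) :
    torusMean (Psi n p q t (Function.update c i₂ (q * c i₂))) *
        gammaJ n p q t (Function.update c i₁ (q * c i₁)) =
      torusMean (Psi n p q t (Function.update c i₁ (q * c i₁))) *
        gammaJ n p q t (Function.update c i₂ (q * c i₂)) := by
  have ht₀ : t ≠ 0 := norm_pos_iff.1 ((norm_nonneg p).trans_lt ht)
  have h := torusMean_Psi_ratio hp₁ hp₀ hq₁ hq₀ ht ht₁ hn hc hc₁ hbal h₁₂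
  have e1 : ∀ s, ∏ k ∈ Finset.univ.erase i₁, theta p (c k * (c i₁ * t ^ s)) =
      theta p (c i₁ * c i₂ * t ^ s) *
        ∏ k ∈ (Finset.univ.erase i₁).erase i₂, theta p (c k * (c i₁ * t ^ s)) := fun s => by
    rw [← Finset.mul_prod_erase _ _ (Finset.mem_erase.2 ⟨h₁₂.symm, Finset.mem_univ i₂⟩)]
    congr 2; ring
  have e2 : ∀ s, ∏ k ∈ Finset.univ.erase i₂, theta p (c k * (c i₂ * t ^ s)) =
      theta p (c i₁ * c i₂ * t ^ s) *
        ∏ k ∈ (Finset.univ.erase i₁).erase i₂, theta p (c k * (c i₂ * t ^ s)) := fun s => by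
    rw [← Finset.mul_prod_erase _ _ (Finset.mem_erase.2 ⟨h₁₂, Finset.mem_univ i₁⟩),
      Finset.erase_right_comm]
    congr 2; ring
  rw [gammaJ_update hp₁ hq₁ hq₀ ht₀ ht₁ hc hc₁, gammaJ_update hp₁ hq₁ hq₀ ht₀ ht₁ hc hc₁]
  simp only [e1, e2, Finset.prod_mul_distrib]
  linear_combination (gammaJ n p q t c *
    ∏ s ∈ Finset.range n, theta p (c i₁ * c i₂ * t ^ s)) * h

/-- The set of the balanced parameters of norm less than one. -/
def balancedDomain (n : ℕ) (p q t : ℂ) : Set (Fin 6 → ℂ) :=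
  {a | (∀ m, a m ≠ 0) ∧ (∀ m, ‖a m‖ < 1) ∧ (∏ m, a m) * t ^ (2 * n) = p * q * t ^ 2}

theorem gammaJ_ne_zero (hp₁ : ‖p‖ < 1) (hq₁ : ‖q‖ < 1) (ht : t ≠ 0) (ht₁ : ‖t‖ < 1)
    {a : Fin 6 → ℂ} (ha : a ∈ balancedDomain n p q t) : gammaJ n p q t a ≠ 0 :=
  Finset.prod_ne_zero_iff.2 fun i _ => Finset.prod_ne_zero_iff.2 fun _ _ =>
    Finset.prod_ne_zero_iff.2 fun _ hk => eGamma_ne_zero hp₁ hq₁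
      (norm_balance_lt_mul ht ht₁ ha.1 ha.2.1 ha.2.2 (Finset.mem_Ioi.1 hk).ne i.2)
      (norm_mul_mul_pow_lt_one ht₁ ha.2.1 _ _ _)

/-- The quotient of the Selberg integral, without its normalization, by its evaluation. -/
noncomputable def selbergRatio (n : ℕ) (p q t : ℂ) (a : Fin 6 → ℂ) : ℂ :=
  torusMean (Psi n p q t a) / gammaJ n p q t a

theorem transfer_mem_balancedDomain {a : Fin 6 → ℂ} (ha : a ∈ balancedDomain n p q t)
    {i j : Fin 6} (hij : i ≠ j) {x : ℂ} (hx : x ∈ transferDomain a i j) :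
    transfer a i j x ∈ balancedDomain n p q t :=
  ⟨transfer_ne_zero hij ha.1 (ne_zero_of_mem_transferDomain hx),
    norm_transfer_lt_one hij ha.2.1 hx, by
      rw [prod_transfer hij (ne_zero_of_mem_transferDomain hx)]; exact ha.2.2⟩

theorem selbergRatio_transfer_mul (hp₁ : ‖p‖ < 1) (hp₀ : p ≠ 0) (hq₁ : ‖q‖ < 1)
    (hq₀ : q ≠ 0) (ht : ‖p‖ < ‖t‖) (ht₁ : ‖t‖ < 1) (hn : 0 < n) {a : Fin 6 → ℂ}
    (ha : a ∈ balancedDomain n p q t) {i j : Fin 6} (hij : i ≠ j) {x : ℂ}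
    (hx : ‖a i * a j‖ < ‖q * x‖) (hx₁ : ‖x‖ < 1) :
    selbergRatio n p q t (transfer a i j (q * x)) = selbergRatio n p q t (transfer a i j x) := by
  have ht₀ : t ≠ 0 := norm_pos_iff.1 ((norm_nonneg p).trans_lt ht)
  have hqx : ‖q * x‖ ≤ ‖x‖ := by
    rw [norm_mul]; exact mul_le_of_le_one_left (norm_nonneg _) hq₁.le
  have hxU : x ∈ transferDomain a i j := ⟨hx.trans_le hqx, hx₁⟩
  have hqxU : q * x ∈ transferDomain a i j := ⟨hx, hqx.trans_lt hx₁⟩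
  have hx0 := ne_zero_of_mem_transferDomain hxU
  have hb := transfer_mem_balancedDomain ha hij hxU
  have hb' := transfer_mem_balancedDomain ha hij hqxU
  have hK : a i * a j ≠ 0 := mul_ne_zero (ha.1 i) (ha.1 j)
  -- The tuple c has the entries x and a i a j / (q x), so the two products of entries differ by q.
  -- Giving the missing q to the entry j produces the transfer at x, and giving it to the entry i
  -- produces the transfer at qx.
  set y : ℂ := a i * a j / (q * x) with hy
  have hy0 : y ≠ 0 := div_ne_zero hK (mul_ne_zero hq₀ hx0)
  have hy1 : ‖y‖ < 1 := by rwa [hy, norm_div, div_lt_one ((norm_nonneg _).trans_lt hx)]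
  set c : Fin 6 → ℂ := Function.update (transfer a i j x) j y with hcdef
  have hci : c i = x := by rw [hcdef, Function.update_of_ne hij, transfer_left hij]
  have hcj : c j = y := by rw [hcdef, Function.update_self]
  have hck : ∀ k, k ≠ i → k ≠ j → c k = a k := fun k h h' => by
    rw [hcdef, Function.update_of_ne h', transfer_of_ne h h']
  have hc0 : ∀ m, c m ≠ 0 := fun m => by
    by_cases h : m = j
    · rw [h, hcj]; exact hy0
    · rw [hcdef, Function.update_of_ne h]; exact hb.1 m
  have hc1 : ∀ m, ‖c m‖ < 1 := fun m => by
    by_cases h : m = j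
    · rw [h, hcj]; exact hy1
    · rw [hcdef, Function.update_of_ne h]; exact hb.2.1 m
  have e1 : Function.update c j (q * c j) = transfer a i j x := by
    rw [hcdef, Function.update_self, Function.update_idem]
    refine Function.update_eq_iff.2 ⟨?_, fun _ _ => rfl⟩
    rw [transfer_right, hy]; field_simp
  have e2 : Function.update c i (q * c i) = transfer a i j (q * x) := by
    rw [hci]
    refine Function.update_eq_iff.2 ⟨(transfer_left hij a _).symm, fun k hk => ?_⟩
    by_cases h : k = j
    · rw [h, hcj, transfer_right]
    · rw [hck k hk h, transfer_of_ne hk h]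
  have hbal : (∏ m, c m) * t ^ (2 * n) = p * t ^ 2 := by
    refine mul_left_cancel₀ hq₀ ?_
    have h := hb.2.2
    rw [← e1, Finset.prod_update_of_mem (Finset.mem_univ j)] at h
    rw [← Finset.mul_prod_erase _ _ (Finset.mem_univ j), Finset.erase_eq]
    linear_combination h
  have h := torusMean_Psi_mul_gammaJ_update hp₁ hp₀ hq₁ hq₀ ht ht₁ hn hc0 hc1 hbal hij
  rw [e1, e2] at h
  rw [selbergRatio, selbergRatio, div_eq_div_iff (gammaJ_ne_zero hp₁ hq₁ ht₀ ht₁ hb')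
    (gammaJ_ne_zero hp₁ hq₁ ht₀ ht₁ hb)]
  exact h.symm

theorem differentiableAt_selbergRatio_transfer (hp₁ : ‖p‖ < 1) (hq₁ : ‖q‖ < 1)
    (ht : t ≠ 0) (ht₁ : ‖t‖ < 1) {a : Fin 6 → ℂ}
    (ha : a ∈ balancedDomain n p q t) {i j : Fin 6} (hij : i ≠ j) {x : ℂ}
    (hx : x ∈ transferDomain a i j) :
    DifferentiableAt ℂ (fun x => selbergRatio n p q t (transfer a i j x)) x := by
  have hd := fun m => differentiableAt_transfer a i j m (ne_zero_of_mem_transferDomain hx)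
  have hb := transfer_mem_balancedDomain ha hij hx
  refine (differentiableAt_torusMean_Psi hp₁ hq₁ ht ht₁ (isOpen_transferDomain a i j)
    (fun m x hx => differentiableAt_transfer a i j m (ne_zero_of_mem_transferDomain hx))
    (fun x hx => transfer_ne_zero hij ha.1 (ne_zero_of_mem_transferDomain hx))
    (fun x hx => norm_transfer_lt_one hij ha.2.1 hx) hx).div ?_ (gammaJ_ne_zero hp₁ hq₁ ht ht₁ hb)
  refine DifferentiableAt.fun_finsetProd fun s _ => DifferentiableAt.fun_finsetProd fun k _ =>
    DifferentiableAt.fun_finsetProd fun l _ => ?_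
  exact differentiableAt_eGamma_comp hp₁ hq₁ (((hd k).mul (hd l)).mul_const _)
    (mul_ne_zero (mul_ne_zero (hb.1 _) (hb.1 _)) (pow_ne_zero _ ht))
    (norm_mul_mul_pow_lt_one ht₁ hb.2.1 _ _ _)

theorem selbergRatio_transfer (hp₁ : ‖p‖ < 1) (hp₀ : p ≠ 0) (hq₁ : ‖q‖ < 1)
    (hq₀ : q ≠ 0) (ht : ‖p‖ < ‖t‖) (ht₁ : ‖t‖ < 1) (hn : 0 < n) {a : Fin 6 → ℂ}
    (ha : a ∈ balancedDomain n p q t) {i j : Fin 6} (hij : i ≠ j) (hK : ‖a i * a j‖ < ‖q‖) {x : ℂ}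
    (hx : x ∈ transferDomain a i j) :
    selbergRatio n p q t (transfer a i j x) = selbergRatio n p q t a := by
  have ht₀ : t ≠ 0 := norm_pos_iff.1 ((norm_nonneg p).trans_lt ht)
  have h0 := mem_transferDomain_self i j ha.1 ha.2.1
  have := eq_of_periodic_on_annulus hq₀ hq₁ (norm_nonneg _) hK
    (g := fun x => selbergRatio n p q t (transfer a i j x))
    (fun x h h' => differentiableAt_selbergRatio_transfer hp₁ hq₁ ht₀ ht₁ ha hij ⟨h, h'⟩)
    (fun x h h' => selbergRatio_transfer_mul hp₁ hp₀ hq₁ hq₀ ht ht₁ hn ha hij h h')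
    hx.1 hx.2 h0.1 h0.2
  rwa [transfer_self hij (ha.1 i)] at this

/-- If all six norms were at least ‖q‖, the balancing condition would contradict the smallness of p.
-/
theorem exists_norm_lt_of_mem_balancedDomain
    (hM : ‖p‖ * ‖q‖ * ‖t‖ ^ 2 < ‖q‖ ^ 6 * ‖t‖ ^ (2 * n)) {a : Fin 6 → ℂ}
    (ha : a ∈ balancedDomain n p q t) : ∃ k, ‖a k‖ < ‖q‖ := by
  by_contra! h
  have h1 : ‖q‖ ^ 6 ≤ ∏ m, ‖a m‖ := by
    calc ‖q‖ ^ 6 = ∏ m : Fin 6, ‖q‖ := by simp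
      _ ≤ _ := Finset.prod_le_prod (fun _ _ => norm_nonneg _) fun m _ => h m
  have h2 := congrArg norm ha.2.2
  simp only [norm_mul, norm_pow, norm_prod] at h2
  have := mul_le_mul_of_nonneg_right h1 (by positivity : 0 ≤ ‖t‖ ^ (2 * n))
  linarith

/-- The last entry serves as a reservoir: entries are set to δ one at a time and the last one
compensates. It never grows in norm, because the replaced entry has norm at most ‖δ‖, so it stays
below ‖q‖ and every transfer is admissible. -/
theorem exists_selbergRatio_eq_last (hp₁ : ‖p‖ < 1) (hp₀ : p ≠ 0) (hq₁ : ‖q‖ < 1)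
    (hq₀ : q ≠ 0) (ht : ‖p‖ < ‖t‖) (ht₁ : ‖t‖ < 1) (hn : 0 < n) {a : Fin 6 → ℂ}
    (ha : a ∈ balancedDomain n p q t) {δ : ℂ} (hδ : ∀ m, ‖a m‖ ≤ ‖δ‖) (hδ₁ : ‖δ‖ < 1)
    (hlast : ‖a (Fin.last 5)‖ < ‖q‖) (hlastδ : ‖a (Fin.last 5)‖ < ‖δ‖)
    (s : Finset (Fin 6)) (hs : Fin.last 5 ∉ s) :
    ∃ b ∈ balancedDomain n p q t, selbergRatio n p q t b = selbergRatio n p q t a ∧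
      (∀ m ∈ s, b m = δ) ∧ (∀ m ∉ s, m ≠ Fin.last 5 → b m = a m) ∧
      ‖b (Fin.last 5)‖ < ‖q‖ ∧ ‖b (Fin.last 5)‖ < ‖δ‖ := by
  induction s using Finset.induction_on with
  | empty => exact ⟨a, ha, rfl, by simp, fun _ _ _ => rfl, hlast, hlastδ⟩
  | insert i s his ih =>
    obtain ⟨b, hb, hba, hbs, hbn, hbl, hbd⟩ := ih fun h => hs (Finset.mem_insert_of_mem h)
    have hi : i ≠ Fin.last 5 := fun h => hs (h ▸ Finset.mem_insert_self i s)
    have hbi : ‖b i‖ ≤ ‖δ‖ := by rw [hbn i his hi]; exact hδ i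
    have hlt : ‖b i * b (Fin.last 5)‖ < ‖b (Fin.last 5)‖ := by
      rw [norm_mul]
      exact mul_lt_of_lt_one_left (norm_pos_iff.2 (hb.1 _)) (hb.2.1 i)
    have hx : δ ∈ transferDomain b i (Fin.last 5) := ⟨hlt.trans hbd, hδ₁⟩
    have hr : ‖transfer b i (Fin.last 5) δ (Fin.last 5)‖ ≤ ‖b (Fin.last 5)‖ := by
      rw [transfer_right, norm_div, norm_mul, div_le_iff₀ ((norm_nonneg _).trans_lt hbd), mul_comm]
      exact mul_le_mul_of_nonneg_left hbi (norm_nonneg _)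
    refine ⟨transfer b i (Fin.last 5) δ, transfer_mem_balancedDomain hb hi hx, ?_, ?_, ?_,
      hr.trans_lt hbl, hr.trans_lt hbd⟩
    · rw [selbergRatio_transfer hp₁ hp₀ hq₁ hq₀ ht ht₁ hn hb hi (hlt.trans hbl) hx, hba]
    · intro m hm
      by_cases hmi : m = i
      · rw [hmi, transfer_left hi]
      · have hms := Finset.mem_of_mem_insert_of_ne hm hmi
        rw [transfer_of_ne hmi (fun h => by rw [h] at hm; exact hs hm), hbs m hms]
    · intro m hm hml
      rw [transfer_of_ne (fun h => hm (by rw [h]; exact Finset.mem_insert_self i s)) hml,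
        hbn m (fun h => hm (Finset.mem_insert_of_mem h)) hml]

theorem exists_selbergRatio_eq (hp₁ : ‖p‖ < 1) (hp₀ : p ≠ 0) (hq₁ : ‖q‖ < 1)
    (hq₀ : q ≠ 0) (ht : ‖p‖ < ‖t‖) (ht₁ : ‖t‖ < 1) (hn : 0 < n)
    (hM : ‖p‖ * ‖q‖ * ‖t‖ ^ 2 < ‖q‖ ^ 6 * ‖t‖ ^ (2 * n)) {a : Fin 6 → ℂ}
    (ha : a ∈ balancedDomain n p q t) {δ : ℂ} (hδ : ∀ m, ‖a m‖ < ‖δ‖)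
    (hδq : ∀ m, ‖a m‖ < ‖q‖ → ‖a m‖ < ‖q‖ * ‖δ‖) (hδ₁ : ‖δ‖ < 1) :
    ∃ b ∈ balancedDomain n p q t, selbergRatio n p q t b = selbergRatio n p q t a ∧
      ∀ m ≠ Fin.last 5, b m = δ := by
  have hδ0 : 0 < ‖δ‖ := (norm_nonneg _).trans_lt (hδ 0)
  suffices h : ∃ a' ∈ balancedDomain n p q t, selbergRatio n p q t a' = selbergRatio n p q t a ∧
      ‖a' (Fin.last 5)‖ < ‖q‖ ∧ ‖a' (Fin.last 5)‖ < ‖δ‖ ∧ ∀ m, ‖a' m‖ ≤ ‖δ‖ by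
    obtain ⟨a', ha', hr, h1, h2, h3⟩ := h
    obtain ⟨b, hb, hba, hbs, -⟩ := exists_selbergRatio_eq_last hp₁ hp₀ hq₁ hq₀ ht ht₁ hn ha' h3
      hδ₁ h1 h2 (Finset.univ.erase (Fin.last 5)) (by simp)
    exact ⟨b, hb, hba.trans hr, fun m hm => hbs m (Finset.mem_erase.2 ⟨hm, Finset.mem_univ m⟩)⟩
  obtain ⟨k, hk⟩ := exists_norm_lt_of_mem_balancedDomain hM ha
  by_cases hkl : k = Fin.last 5
  · subst hkl
    exact ⟨a, ha, rfl, hk, hδ _, fun m => (hδ m).le⟩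
  -- When the small entry is not the last one, a preliminary transfer sets it to δ and makes the
  -- last entry small. The bound ‖a k‖ < ‖q‖‖δ‖ is what keeps the new last entry below ‖q‖ after
  -- division by δ.
  · have hK : ‖a k * a (Fin.last 5)‖ < ‖a k‖ := by
      rw [norm_mul]
      exact mul_lt_of_lt_one_right (norm_pos_iff.2 (ha.1 _)) (ha.2.1 _)
    have hx : δ ∈ transferDomain a k (Fin.last 5) := ⟨hK.trans (hδ k), hδ₁⟩
    have h1 : ‖a k * a (Fin.last 5) / δ‖ < ‖q‖ := by
      rw [norm_div, div_lt_iff₀ hδ0]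
      exact hK.trans (hδq k hk)
    have h2 : ‖a k * a (Fin.last 5) / δ‖ < ‖δ‖ := by
      rw [norm_div, div_lt_iff₀ hδ0, norm_mul]
      exact mul_lt_mul'' (hδ _) (hδ _) (norm_nonneg _) (norm_nonneg _)
    refine ⟨transfer a k (Fin.last 5) δ, transfer_mem_balancedDomain ha hkl hx,
      selbergRatio_transfer hp₁ hp₀ hq₁ hq₀ ht ht₁ hn ha hkl (hK.trans hk) hx, ?_, ?_, ?_⟩
    · rwa [transfer_right]
    · rwa [transfer_right]
    · exact forall_transfer hkl (P := (‖·‖ ≤ ‖δ‖)) le_rfl h2.le fun m => (hδ m).le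

/-- A real δ close enough to 1 is admissible for both tuples. Both are moved to a tuple with five
entries δ, and balancing forces the last entries to coincide. -/
theorem selbergRatio_eq (hp₁ : ‖p‖ < 1) (hp₀ : p ≠ 0) (hq₁ : ‖q‖ < 1)
    (hq₀ : q ≠ 0) (ht : ‖p‖ < ‖t‖) (ht₁ : ‖t‖ < 1) (hn : 0 < n)
    (hM : ‖p‖ * ‖q‖ * ‖t‖ ^ 2 < ‖q‖ ^ 6 * ‖t‖ ^ (2 * n)) {a a' : Fin 6 → ℂ}
    (ha : a ∈ balancedDomain n p q t) (ha' : a' ∈ balancedDomain n p q t) :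
    selbergRatio n p q t a = selbergRatio n p q t a' := by
  have ht₀ : t ≠ 0 := norm_pos_iff.1 ((norm_nonneg p).trans_lt ht)
  have hev : ∀ a ∈ balancedDomain n p q t, ∀ᶠ δ in 𝓝[<] (1 : ℝ),
      ∀ m, ‖a m‖ < δ ∧ (‖a m‖ < ‖q‖ → ‖a m‖ < ‖q‖ * δ) := by
    intro a ha
    refine eventually_all.2 fun m => nhdsWithin_le_nhds ((eventually_gt_nhds (ha.2.1 m)).and ?_)
    by_cases h : ‖a m‖ < ‖q‖
    · have hT : Tendsto (fun δ : ℝ => ‖q‖ * δ) (𝓝 1) (𝓝 ‖q‖) := by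
        simpa using (tendsto_id (α := ℝ) (x := 𝓝 1)).const_mul ‖q‖
      exact (hT.eventually_const_lt h).mono fun δ hδ _ => hδ
    · exact Eventually.of_forall fun δ h' => absurd h' h
  obtain ⟨δ, ⟨h1, h2⟩, hδ₁⟩ := (((hev a ha).and (hev a' ha')).and self_mem_nhdsWithin).exists
  have hδ0 : 0 ≤ δ := (norm_nonneg _).trans (h1 0).1.le
  have hδn : ‖(δ : ℂ)‖ = δ := by rw [Complex.norm_real, Real.norm_of_nonneg hδ0]
  have key : ∀ a ∈ balancedDomain n p q t, (∀ m, ‖a m‖ < δ ∧ (‖a m‖ < ‖q‖ → ‖a m‖ < ‖q‖ * δ)) →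
      ∃ b ∈ balancedDomain n p q t, selbergRatio n p q t b = selbergRatio n p q t a ∧
      ∀ m ≠ Fin.last 5, b m = δ := fun a ha h =>
    exists_selbergRatio_eq hp₁ hp₀ hq₁ hq₀ ht ht₁ hn hM ha (by rw [hδn]; exact fun m => (h m).1)
      (by rw [hδn]; exact fun m => (h m).2) (by rw [hδn]; exact hδ₁)
  obtain ⟨b, hb, e, hbδ⟩ := key a ha h1
  obtain ⟨b', hb', e', hbδ'⟩ := key a' ha' h2
  have hbb : b = b' := by
    have hoff : ∀ m ≠ Fin.last 5, b m = b' m := fun m hm => (hbδ m hm).trans (hbδ' m hm).symm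
    funext m
    by_cases hm : m = Fin.last 5
    · have h := hb.2.2.trans hb'.2.2.symm
      have h' := mul_right_cancel₀ (pow_ne_zero _ ht₀) h
      rw [← Finset.mul_prod_erase _ _ (Finset.mem_univ (Fin.last 5)),
        ← Finset.mul_prod_erase _ b' (Finset.mem_univ (Fin.last 5)),
        Finset.prod_congr rfl fun k hk => hoff k (Finset.ne_of_mem_erase hk)] at h'
      rw [hm]
      exact mul_right_cancel₀ (Finset.prod_ne_zero_iff.2 fun k _ => hb'.1 k) h'
    · exact hoff m hm
  rw [← e, ← e', hbb]

end Constancy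


/-! ### Evaluation on U_0 and meromorphic continuation. -/

section Conclusion

variable {n : ℕ} {p q t : ℂ}

theorem balanced_castSucc (b : Fin 5 → ℂ) (m : Fin 5) :
    balanced n p q t b m.castSucc = b m := by
  rw [balanced, Fin.snoc_castSucc]

theorem balanced_last (b : Fin 5 → ℂ) :
    balanced n p q t b (Fin.last 5) = p * q / ((∏ m, b m) * t ^ (2 * (n : ℤ) - 2)) := by
  rw [balanced, Fin.snoc_last]

theorem balanced_ne_zero (hp₀ : p ≠ 0) (hq₀ : q ≠ 0) (ht : t ≠ 0) {b : Fin 5 → ℂ}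
    (hb : b ∈ cTorus) (m : Fin 6) : balanced n p q t b m ≠ 0 := by
  induction m using Fin.lastCases with
  | last =>
    rw [balanced_last]
    exact div_ne_zero (mul_ne_zero hp₀ hq₀)
      (mul_ne_zero (Finset.prod_ne_zero_iff.2 fun i _ => hb i) (zpow_ne_zero _ ht))
  | cast m => rw [balanced_castSucc]; exact hb m

theorem balanced_mem_balancedDomain (hp₀ : p ≠ 0) (hq₀ : q ≠ 0) (ht : t ≠ 0) {b : Fin 5 → ℂ}
    (hb : b ∈ domainU0 n p q t) : balanced n p q t b ∈ balancedDomain n p q t := by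
  obtain ⟨h0, h1, h2⟩ := hb
  have hprod : ∏ m, b m ≠ 0 := Finset.prod_ne_zero_iff.2 fun i _ => h0 i
  refine ⟨balanced_ne_zero hp₀ hq₀ ht h0, fun m => ?_, ?_⟩
  · induction m using Fin.lastCases with
    | last =>
      have htz : 0 < ‖t‖ ^ (2 * (n : ℤ) - 2) := zpow_pos (norm_pos_iff.2 ht) _
      rw [balanced_last, norm_div, norm_mul, norm_mul, norm_zpow,
        div_lt_one (mul_pos (norm_pos_iff.2 hprod) htz)]
      rwa [div_lt_iff₀ htz] at h2
    | cast m => rw [balanced_castSucc]; exact h1 m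
  · rw [Fin.prod_univ_castSucc]
    simp only [balanced_castSucc, balanced_last]
    rw [zpow_sub₀ ht, show (2 * (n : ℤ)) = ((2 * n : ℕ) : ℤ) by push_cast; ring, zpow_natCast]
    have := pow_ne_zero (2 * n) ht
    norm_cast
    field_simp

theorem torusIntegrable_integrand (hp₁ : ‖p‖ < 1) (hq₁ : ‖q‖ < 1) (ht : t ≠ 0) (ht₁ : ‖t‖ < 1)
    {a : Fin 6 → ℂ} (ha : a ∈ balancedDomain n p q t) :
    TorusIntegrable (integrand n p q t a) 0 1 := by
  refine torusIntegrable_of_continuous ((continuous_Psi hp₁ hq₁ ht ht₁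
    (continuous_const (y := a)) (fun _ => ha.1) (fun _ => ha.2.1) continuous_torusMap
    norm_torusMap).div (continuous_finsetProd _ fun i _ =>
      (continuous_apply i).comp continuous_torusMap) fun θ => ?_)
  exact Finset.prod_ne_zero_iff.2 fun i _ => ne_zero_of_norm_eq_one (norm_torusMap θ i)

theorem selbergI_eq_torusMean (n : ℕ) (p q t : ℂ) (a : Fin 6 → ℂ) :
    selbergI n p q t a = (1 / (2 * (π : ℂ)) ^ n) * torusMean (Psi n p q t a) :=
  torusIntegral_div_prod _

theorem exists_selbergI_eq_of_norm_lt (hp₁ : ‖p‖ < 1) (hp₀ : p ≠ 0) (hq₁ : ‖q‖ < 1)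
    (hq₀ : q ≠ 0) (ht : ‖p‖ < ‖t‖) (ht₁ : ‖t‖ < 1) (hn : 0 < n)
    (hM : ‖p‖ * ‖q‖ * ‖t‖ ^ 2 < ‖q‖ ^ 6 * ‖t‖ ^ (2 * n)) :
    ∃ c : ℂ, ∀ a ∈ balancedDomain n p q t, selbergI n p q t a = c * gammaJ n p q t a := by
  have ht₀ : t ≠ 0 := norm_pos_iff.1 ((norm_nonneg p).trans_lt ht)
  by_cases hne : (balancedDomain n p q t).Nonempty
  · obtain ⟨a₀, ha₀⟩ := hne
    refine ⟨1 / (2 * (π : ℂ)) ^ n * selbergRatio n p q t a₀, fun a ha => ?_⟩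
    rw [selbergRatio_eq hp₁ hp₀ hq₁ hq₀ ht ht₁ hn hM ha₀ ha, selbergI_eq_torusMean, selbergRatio,
      mul_assoc, div_mul_cancel₀ _ (gammaJ_ne_zero hp₁ hq₁ ht₀ ht₁ ha)]
  · exact ⟨0, fun a ha => absurd ⟨a, ha⟩ hne⟩

theorem exists_selbergI_eq (hp₀ : p ≠ 0) (hp₁ : ‖p‖ < 1) (hq₀ : q ≠ 0) (hq₁ : ‖q‖ < 1)
    (ht₀ : t ≠ 0) (ht₁ : ‖t‖ < 1)
    (hsmall : ‖p‖ < ‖q‖ ^ (25 / 4 : ℝ) * ‖t‖ ^ (2 * (n : ℤ) - 2)) :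
    ∃ c : ℂ, ∀ a ∈ balancedDomain n p q t, selbergI n p q t a = c * gammaJ n p q t a := by
  have hqp := norm_pos_iff.2 hq₀
  have htp := norm_pos_iff.2 ht₀
  -- The argument needs only the fifth power of ‖q‖; the exponent 25/4 is stronger.
  have hq5 : ‖q‖ ^ (25 / 4 : ℝ) ≤ ‖q‖ ^ 5 := by
    rw [← Real.rpow_natCast]
    exact Real.rpow_le_rpow_of_exponent_ge hqp hq₁.le (by norm_num)
  have hsmall' : ‖p‖ < ‖q‖ ^ 5 * ‖t‖ ^ (2 * (n : ℤ) - 2) :=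
    hsmall.trans_le (mul_le_mul_of_nonneg_right hq5 (zpow_nonneg htp.le _))
  have hq5' : ‖q‖ ^ 5 ≤ ‖q‖ := pow_le_of_le_one hqp.le hq₁.le (by norm_num)
  rcases n with _ | _ | n
  · exact ⟨1, fun a _ => by simp [selbergI, integrand, Psi, gammaJ]⟩
  -- For n = 1 the hypothesis does not compare p with t. Neither the integral nor J involves t in
  -- this case, so t is replaced by q, for which ‖p‖ < ‖q‖ is available.
  · have hpq : ‖p‖ < ‖q‖ ^ 5 := by simpa using hsmall'
    obtain ⟨c, hc⟩ := exists_selbergI_eq_of_norm_lt (n := 1) (t := q) hp₁ hp₀ hq₁ hq₀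
      (hpq.trans_le hq5') hq₁ one_pos (by
        have := mul_lt_mul_of_pos_right hpq (pow_pos hqp 3)
        calc ‖p‖ * ‖q‖ * ‖q‖ ^ 2 = ‖p‖ * ‖q‖ ^ 3 := by ring
          _ < _ := this
          _ = _ := by ring)
    refine ⟨c, fun a ha => ?_⟩
    have h1 : selbergI 1 p q t a = selbergI 1 p q q a := by
      simp [selbergI_eq_torusMean, torusMean, Psi_eq_prod]
    have h2 : gammaJ 1 p q t a = gammaJ 1 p q q a := by simp [gammaJ]
    have h3 : ∏ m, a m = p * q := by
      have := ha.2.2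
      exact mul_right_cancel₀ (pow_ne_zero 2 ht₀) this
    rw [zero_add, h1, h2]
    exact hc a ⟨ha.1, ha.2.1, by rw [h3]⟩
  · have e : ‖t‖ ^ (2 * ((n + 1 + 1 : ℕ) : ℤ) - 2) = ‖t‖ ^ (2 * n + 2) := by
      rw [← zpow_natCast]; congr 1; push_cast; ring
    rw [e] at hsmall'
    have ht2 : ‖t‖ ^ (2 * n + 2) ≤ ‖t‖ := pow_le_of_le_one htp.le ht₁.le (by omega)
    refine exists_selbergI_eq_of_norm_lt hp₁ hp₀ hq₁ hq₀ ?_ ht₁ (by omega) ?_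
    -- With at least two variables the power of t in the smallness hypothesis is at least 2, and
    -- this yields ‖p‖ < ‖t‖.
    · refine hsmall'.trans_le ((mul_le_of_le_one_left (by positivity) ?_).trans ht2)
      exact pow_le_one₀ hqp.le hq₁.le
    · have := mul_lt_mul_of_pos_right hsmall' (mul_pos hqp (pow_pos htp 2))
      calc ‖p‖ * ‖q‖ * ‖t‖ ^ 2 = ‖p‖ * (‖q‖ * ‖t‖ ^ 2) := by ring
        _ < _ := this
        _ = _ := by ring

theorem isOpen_cTorus : IsOpen cTorus := by
  rw [cTorus, Set.ofPred_forall]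
  exact isOpen_iInter_of_finite fun m => isOpen_ne_fun (continuous_apply m) continuous_const

theorem isOpen_domainU0 (n : ℕ) (p q t : ℂ) : IsOpen (domainU0 n p q t) := by
  have h1 : IsOpen {b : Fin 5 → ℂ | ∀ m, ‖b m‖ < 1} := by
    rw [Set.ofPred_forall]
    exact isOpen_iInter_of_finite fun m => isOpen_lt (by fun_prop) continuous_const
  exact isOpen_cTorus.inter (h1.inter (isOpen_lt continuous_const
    (by fun_prop : Continuous fun b : Fin 5 → ℂ => ‖∏ m, b m‖)))

theorem analyticAt_balanced (ht : t ≠ 0) {b : Fin 5 → ℂ} (hb : b ∈ cTorus) (m : Fin 6) :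
    AnalyticAt ℂ (fun b => balanced n p q t b m) b := by
  have hproj : ∀ i : Fin 5, AnalyticAt ℂ (fun b : Fin 5 → ℂ => b i) b := fun i =>
    (ContinuousLinearMap.proj (R := ℂ) (φ := fun _ : Fin 5 => ℂ) i).analyticAt b
  induction m using Fin.lastCases with
  | last =>
    simp only [balanced_last]
    exact analyticAt_const.div ((Finset.analyticAt_fun_prod _ fun i _ => hproj i).mul
      analyticAt_const) (mul_ne_zero (Finset.prod_ne_zero_iff.2 fun i _ => hb i)
        (zpow_ne_zero _ ht))
  | cast m => simp only [balanced_castSucc]; exact hproj m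

/-- The argument `a_j a_k t^{i-1}` of a factor of `J`. -/
noncomputable def gammaArg (n : ℕ) (p q t : ℂ) (i : Fin n) (j k : Fin 6) (b : Fin 5 → ℂ) : ℂ :=
  balanced n p q t b j * balanced n p q t b k * t ^ (i : ℕ)

theorem gammaArg_ne_zero (hp₀ : p ≠ 0) (hq₀ : q ≠ 0) (ht : t ≠ 0) {b : Fin 5 → ℂ}
    (hb : b ∈ cTorus) (i : Fin n) (j k : Fin 6) : gammaArg n p q t i j k b ≠ 0 :=
  mul_ne_zero (mul_ne_zero (balanced_ne_zero hp₀ hq₀ ht hb j) (balanced_ne_zero hp₀ hq₀ ht hb k))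
    (pow_ne_zero _ ht)

theorem analyticAt_gammaArg (ht : t ≠ 0) {b : Fin 5 → ℂ}
    (hb : b ∈ cTorus) (i : Fin n) (j k : Fin 6) : AnalyticAt ℂ (gammaArg n p q t i j k) b :=
  ((analyticAt_balanced ht hb j).mul (analyticAt_balanced ht hb k)).mul analyticAt_const

theorem analyticAt_qPoch_comp (hp₁ : ‖p‖ < 1) (hq₁ : ‖q‖ < 1) {E : Type*} [NormedAddCommGroup E]
    [NormedSpace ℂ E] {f : E → ℂ} {x : E} (hf : AnalyticAt ℂ f x) :
    AnalyticAt ℂ (fun x => qPoch p q (f x)) x :=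
  ((differentiable_qPoch hp₁ hq₁).analyticAt (f x)).comp hf

theorem gammaJ_balanced_eq_div (n : ℕ) (p q t : ℂ) (b : Fin 5 → ℂ) :
    gammaJ n p q t (balanced n p q t b) =
      (∏ i, ∏ j, ∏ k ∈ Finset.Ioi j, qPoch p q (p * q * (gammaArg n p q t i j k b)⁻¹)) /
        ∏ i, ∏ j, ∏ k ∈ Finset.Ioi j, qPoch p q (gammaArg n p q t i j k b) := by
  simp only [gammaJ, eGamma, gammaArg, Finset.prod_div_distrib]

theorem balanced_smul (l : ℂ) (b : Fin 5 → ℂ) (m : Fin 6) :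
    balanced n p q t (l • b) m =
      l ^ (if m = Fin.last 5 then -5 else 1 : ℤ) * balanced n p q t b m := by
  induction m using Fin.lastCases with
  | last =>
    rw [if_pos rfl, balanced_last, balanced_last]
    simp only [Pi.smul_apply, smul_eq_mul, Finset.prod_mul_distrib, Finset.prod_const,
      Finset.card_univ, Fintype.card_fin]
    rw [zpow_neg, show l ^ (5 : ℤ) = l ^ 5 by norm_cast, mul_assoc, ← div_div,
      div_eq_mul_inv _ (l ^ 5)]
    ring
  | cast m =>
    rw [if_neg (Fin.castSucc_ne_last m), zpow_one, balanced_castSucc, balanced_castSucc,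
      Pi.smul_apply, smul_eq_mul]

/-- Scaling the five free parameters by l scales the last one by l^{-5}, so a product of two
parameters acquires l², l^{-4} or l^{-10}, never l⁰. -/
theorem exists_gammaArg_smul (j k : Fin 6) : ∃ e : ℤ, e ≠ 0 ∧
    ∀ (i : Fin n) (l : ℂ) (b : Fin 5 → ℂ), l ≠ 0 →
      gammaArg n p q t i j k (l • b) = l ^ e * gammaArg n p q t i j k b := by
  refine ⟨(if j = Fin.last 5 then -5 else 1) + if k = Fin.last 5 then -5 else 1, ?_, ?_⟩
  · split_ifs <;> norm_num
  · intro i l b hl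
    rw [gammaArg, gammaArg, balanced_smul, balanced_smul, zpow_add₀ hl]
    ring

/-- Along the line l ↦ l • b each polar equation fixes a nonzero power of l. The line therefore
meets the polar divisor in a countable set, and b itself, at l = 1, is a limit of points off it. -/
theorem dense_qPoch_gammaArg_ne_zero (hp₀ : p ≠ 0) (hp₁ : ‖p‖ < 1) (hq₀ : q ≠ 0) (hq₁ : ‖q‖ < 1)
    (ht : t ≠ 0) : cTorus ⊆ closure {b | b ∈ cTorus ∧
      ∏ i, ∏ j, ∏ k ∈ Finset.Ioi j, qPoch p q (gammaArg n p q t i j k b) ≠ 0} := by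
  intro b hb
  let C : Set ℂ := {0} ∪ ⋃ (i : Fin n) (j : Fin 6) (k : Fin 6) (_ : j < k) (m : ℕ × ℕ),
    {l : ℂ | l ≠ 0 ∧ p ^ m.1 * q ^ m.2 * gammaArg n p q t i j k (l • b) = 1}
  have hC : C.Countable := by
    refine (Set.countable_singleton 0).union (Set.countable_iUnion fun i =>
      Set.countable_iUnion fun j => Set.countable_iUnion fun k => Set.countable_iUnion fun _ =>
      Set.countable_iUnion fun m => ?_)
    obtain ⟨e, he, h⟩ := exists_gammaArg_smul (n := n) (p := p) (q := q) (t := t) j k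
    have hu := gammaArg_ne_zero hp₀ hq₀ ht hb i j k
    refine (countable_zpow_eq he
      (p ^ m.1 * q ^ m.2 * gammaArg n p q t i j k b)⁻¹).mono fun l hl => ?_
    have hl' := hl.2
    rw [h i l b hl.1] at hl'
    exact eq_inv_of_mul_eq_one_left (by rw [← hl']; ring)
  have h1 : (1 : ℂ) ∈ closure Cᶜ := hC.dense_compl ℂ 1
  have hcont : Continuous fun l : ℂ => l • b := by fun_prop
  have h2 := map_mem_closure hcont h1 (t := {b | b ∈ cTorus ∧
      ∏ i, ∏ j, ∏ k ∈ Finset.Ioi j, qPoch p q (gammaArg n p q t i j k b) ≠ 0}) ?_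
  · simpa using h2
  · intro l hl
    simp only [C, Set.mem_compl_iff, Set.mem_union, Set.mem_singleton_iff, Set.mem_iUnion,
      Set.mem_ofPred_eq, not_or, not_exists, not_and] at hl
    refine ⟨fun m => mul_ne_zero hl.1 (hb m), Finset.prod_ne_zero_iff.2 fun i _ =>
      Finset.prod_ne_zero_iff.2 fun j _ => Finset.prod_ne_zero_iff.2 fun k hk =>
        qPoch_ne_zero hp₁ hq₁ fun μ ν => ?_⟩
    exact hl.2 i j k (Finset.mem_Ioi.1 hk) (μ, ν) hl.1

theorem isMeromorphicOn_gammaJ_balanced (hp₀ : p ≠ 0) (hp₁ : ‖p‖ < 1) (hq₀ : q ≠ 0)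
    (hq₁ : ‖q‖ < 1) (ht : t ≠ 0) (c : ℂ) :
    IsMeromorphicOn (fun b => c * gammaJ n p q t (balanced n p q t b)) cTorus := by
  refine fun x hx => ⟨cTorus, isOpen_cTorus, hx, subset_rfl,
    fun b => c * ∏ i, ∏ j, ∏ k ∈ Finset.Ioi j, qPoch p q (p * q * (gammaArg n p q t i j k b)⁻¹),
    fun b => ∏ i, ∏ j, ∏ k ∈ Finset.Ioi j, qPoch p q (gammaArg n p q t i j k b),
    fun b hb => ?_, fun b hb => ?_, dense_qPoch_gammaArg_ne_zero hp₀ hp₁ hq₀ hq₁ ht,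
    fun b _ _ => ?_⟩
  · exact analyticAt_const.mul (Finset.analyticAt_fun_prod _ fun i _ =>
      Finset.analyticAt_fun_prod _ fun j _ => Finset.analyticAt_fun_prod _ fun k _ =>
      analyticAt_qPoch_comp hp₁ hq₁ (analyticAt_const.mul
        ((analyticAt_gammaArg ht hb i j k).inv (gammaArg_ne_zero hp₀ hq₀ ht hb i j k))))
  · exact Finset.analyticAt_fun_prod _ fun i _ =>
      Finset.analyticAt_fun_prod _ fun j _ => Finset.analyticAt_fun_prod _ fun k _ =>
      analyticAt_qPoch_comp hp₁ hq₁ (analyticAt_gammaArg ht hb i j k)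
  · simp only [gammaJ_balanced_eq_div, mul_div_assoc]

theorem analyticAt_gammaJ_balanced (hp₀ : p ≠ 0) (hp₁ : ‖p‖ < 1) (hq₀ : q ≠ 0)
    (hq₁ : ‖q‖ < 1) (ht : t ≠ 0) (ht₁ : ‖t‖ < 1) {b : Fin 5 → ℂ} (hb : b ∈ domainU0 n p q t) :
    AnalyticAt ℂ (fun b => gammaJ n p q t (balanced n p q t b)) b := by
  have ha := balanced_mem_balancedDomain hp₀ hq₀ ht hb
  simp only [gammaJ_balanced_eq_div]
  refine (Finset.analyticAt_fun_prod _ fun i _ =>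
      Finset.analyticAt_fun_prod _ fun j _ => Finset.analyticAt_fun_prod _ fun k _ =>
      analyticAt_qPoch_comp hp₁ hq₁ (analyticAt_const.mul
        ((analyticAt_gammaArg ht hb.1 i j k).inv (gammaArg_ne_zero hp₀ hq₀ ht hb.1 i j k)))).div
    (Finset.analyticAt_fun_prod _ fun i _ =>
      Finset.analyticAt_fun_prod _ fun j _ => Finset.analyticAt_fun_prod _ fun k _ =>
      analyticAt_qPoch_comp hp₁ hq₁ (analyticAt_gammaArg ht hb.1 i j k)) ?_
  exact Finset.prod_ne_zero_iff.2 fun i _ => Finset.prod_ne_zero_iff.2 fun j _ =>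
    Finset.prod_ne_zero_iff.2 fun k _ => qPoch_ne_zero_of_norm_lt hp₁ hq₁
      (norm_mul_mul_pow_lt_one ht₁ ha.2.1 j k i)

end Conclusion

end EllipticSelberg

theorem mainTheorem2 (n : ℕ) (p q t : ℂ)
    (hp₀ : p ≠ 0) (hp₁ : ‖p‖ < 1) (hq₀ : q ≠ 0) (hq₁ : ‖q‖ < 1) (ht₀ : t ≠ 0) (ht₁ : ‖t‖ < 1)
    (hsmall : ‖p‖ < ‖q‖ ^ (25 / 4 : ℝ) * ‖t‖ ^ (2 * (n : ℤ) - 2)) :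
    (∀ b ∈ EllipticSelberg.domainU0 n p q t,
      TorusIntegrable
        (EllipticSelberg.integrand n p q t (EllipticSelberg.balanced n p q t b)) 0 1) ∧
    AnalyticOnNhd ℂ
      (fun b => EllipticSelberg.selbergI n p q t (EllipticSelberg.balanced n p q t b))
      (EllipticSelberg.domainU0 n p q t) ∧
    ∃ (F : (Fin 5 → ℂ) → ℂ) (c : ℂ),
      EllipticSelberg.IsMeromorphicOn F EllipticSelberg.cTorus ∧
      (∀ b ∈ EllipticSelberg.domainU0 n p q t,
        F b = EllipticSelberg.selbergI n p q t (EllipticSelberg.balanced n p q t b)) ∧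
      (∀ b ∈ EllipticSelberg.cTorus,
        ¬ EllipticSelberg.OnPolarDivisor n p q t (EllipticSelberg.balanced n p q t b) →
        F b = c * EllipticSelberg.gammaJ n p q t (EllipticSelberg.balanced n p q t b)) := by
  obtain ⟨c, hc⟩ := EllipticSelberg.exists_selbergI_eq hp₀ hp₁ hq₀ hq₁ ht₀ ht₁ hsmall
  have hmem : ∀ b ∈ EllipticSelberg.domainU0 n p q t,
      EllipticSelberg.balanced n p q t b ∈ EllipticSelberg.balancedDomain n p q t := fun b hb =>
    EllipticSelberg.balanced_mem_balancedDomain hp₀ hq₀ ht₀ hb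
  -- The continuation F is cJ itself, so the last clause is definitional.
  refine ⟨fun b hb => EllipticSelberg.torusIntegrable_integrand hp₁ hq₁ ht₀ ht₁ (hmem b hb), ?_,
    fun b => c * EllipticSelberg.gammaJ n p q t (EllipticSelberg.balanced n p q t b), c,
    EllipticSelberg.isMeromorphicOn_gammaJ_balanced hp₀ hp₁ hq₀ hq₁ ht₀ c,
    fun b hb => (hc _ (hmem b hb)).symm, fun b _ _ => rfl⟩
  have han : AnalyticOnNhd ℂ
      (fun b => c * EllipticSelberg.gammaJ n p q t (EllipticSelberg.balanced n p q t b))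
      (EllipticSelberg.domainU0 n p q t) := fun b hb => analyticAt_const.mul
    (EllipticSelberg.analyticAt_gammaJ_balanced hp₀ hp₁ hq₀ hq₁ ht₀ ht₁ hb)
  -- Holomorphy of the integral is inherited from cJ, with which it agrees on the open set U_0.
  exact han.congr (EllipticSelberg.isOpen_domainU0 n p q t) fun b hb => (hc _ (hmem b hb)).symm
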